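/- An additive quaternary $[n,k,d]_4$-code (with $2k$ a positive integer) is a $2k$-dimensional $\mathbb{F}_2$-subspace $C$ of $(\mathbb{F}_2^2)^n$ such that $d$ is the smallest weight of a nonzero codeword, where the weight of a codeword is the number of its $n$ coordinates in $\mathbb{F}_2^2$ that differ from $00$. Let $A_i$ denote the number of codewords of weight $i$. Then every additive $[12,6,6]_4$-code has one of the following two weight distributions: (linear case) $A_0=1$, $A_6=330$, $A_7=396$, $A_8=495$, $A_9=1320$, $A_{10}=990$, $A_{11}=396$, $A_{12}=168$, and $A_i=0$ for all other $i$; (quantum case) $A_0=1$, $A_6=396$, $A_8=1485$, $A_{10}=1980$, $A_{12}=234$, and $A_i=0$ for all other $i$. Both cases occur; the first one occurs for an $\mathbb{F}_4$-linear $[12,6,6]_4$-code, that is, for one which is closed under coordinatewise multiplication by $\omega$ when $(a,b)\in\mathbb{F}_2^2$ is identified with $a+b\omega\in\mathbb{F}_4$, $\omega^2=\omega+1$. -/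

import Mathlib

/-- The ambient space `F₂^{2n}` with coordinates taken in pairs: `n`-tuples over the
alphabet `F₂²`. The Hamming norm `hammingNorm` of such a tuple is the number of its
coordinates which differ from `00`. -/
abbrev QuaternaryWord (n : ℕ) : Type := Fin n → ZMod 2 × ZMod 2

/-- `C` is an additive quaternary `[n, k, d]₄`-code, where `k` is a positive integer or
half-integer: the binary dimension of the subspace `C` of `F₂^{2n}` is `2k`, and `d` is the
smallest weight of a nonzero codeword. -/
structure IsAdditiveCode (n : ℕ) (k : ℚ) (d : ℕ)
    (C : Submodule (ZMod 2) (QuaternaryWord n)) : Prop where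
  dim_pos : 0 < k
  dim_eq : (Module.finrank (ZMod 2) C : ℚ) = 2 * k
  minWeight : IsLeast {w : ℕ | ∃ c ∈ C, c ≠ 0 ∧ hammingNorm c = w} d

/-- The number `A_i` of codewords of weight `i`, as a function of `i`. -/
noncomputable def weightDistribution {n : ℕ} (C : Submodule (ZMod 2) (QuaternaryWord n))
    (i : ℕ) : ℕ :=
  Set.ncard {c : QuaternaryWord n | c ∈ C ∧ hammingNorm c = i}

/-- Multiplication by `ω` on `F₄ = {a + b ω}`, with `ω² = ω + 1`, where `a + b ω` is written
as the pair `(a, b)`: we have `ω (a + b ω) = b + (a + b) ω`. -/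
def mulOmega (x : ZMod 2 × ZMod 2) : ZMod 2 × ZMod 2 := (x.2, x.1 + x.2)

/-- An additive code is `F₄`-linear (for the identification of `F₂²` with `F₄` above)
if it is closed under coordinatewise multiplication by `ω`. -/
def IsF4Linear {n : ℕ} (C : Submodule (ZMod 2) (QuaternaryWord n)) : Prop :=
  ∀ c ∈ C, (fun i => mulOmega (c i)) ∈ C

/-- The weight distribution of the linear `[12, 6, 6]₄`-code. -/
def linearDistribution : ℕ → ℕ
  | 0 => 1
  | 6 => 330
  | 7 => 396
  | 8 => 495
  | 9 => 1320
  | 10 => 990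
  | 11 => 396
  | 12 => 168
  | _ => 0

/-- The weight distribution of the quantum case. -/
def quantumDistribution : ℕ → ℕ
  | 0 => 1
  | 6 => 396
  | 8 => 1485
  | 10 => 1980
  | 12 => 234
  | _ => 0

/-! The parity of the weight is a quadratic form on `F₂^{2n}`: on a symbol `(a, b)` it is `a² + ab +
b²`, with the symplectic form as polar form. So the sum `signSum D` of `(-1)^wt` over a space `D` is
a Gauss sum: it is zero, or its square is `|D| · |rad D|`. If `|D| = 4^m` and the sum is nonzero, it
equals `2^m f` with `f` plus or minus a power of two and `f² = |rad D|`; this `f` is the level.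

Let `C_U` be the subcode vanishing on `U`. Double counting of zeros and the Gauss sum bound the
sizes of short codes of minimum weight 6, and show that any five coordinates of `C` are independent
(`IsFullCode.size_shorten`): `|C_U| = 4^(6-|U|)` for `|U| ≤ 5`. Counting zeros again, for `|U| ≤ 4`
the weight distribution of `C_U` is affine in its level `f_U`, and for `|U| ≤ 3` the sum of the
levels of `U ∪ {i}` is affine in `f_U` (`distribution_two` to `distribution_six`).

It remains to see which levels occur. From `U` to `U ∪ {i}` a nonzero level changes in absolute
value by a factor of at most 2, and it changes sign only if its absolute value stays, in which case
the radical vanishes at `i` (`HasLevel.abs_le`, `HasLevel.eq_neg`). Moreover, a space has room for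
few even subspaces that pairwise span it (`card_even_cover`). Together with the sum relations this
gives the possible levels `1, 2, 4` for `|U| = 4`, then `8, 2, 1, -1`, then `16, 4, 1`, then `32, 8,
2, -1`, and finally `64, -2` for `C` itself. At the top the values 1, 4 and 16 need the structure of
the radicals of subcodes (`level_ne_one`, `level_ne_four`, `level_ne_sixteen`). Since `A₆ = 332 +
f`, level 64 is the quantum case and level -2 the linear one.

Existence is a kernel computation over all sums of twelve generators; the classification then
identifies the distributions. -/

open Finset

/-! ### Parity signs, the symplectic pairing, and sums over subspaces. -/

/-- The finite set of elements of a subspace of words. -/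
noncomputable def codewords {n : ℕ} (D : Submodule (ZMod 2) (QuaternaryWord n)) :
    Finset (QuaternaryWord n) :=
  (Set.toFinite (D : Set (QuaternaryWord n))).toFinset

@[simp]
theorem mem_codewords {n : ℕ} {D : Submodule (ZMod 2) (QuaternaryWord n)}
    {c : QuaternaryWord n} : c ∈ codewords D ↔ c ∈ D := by
  simp [codewords]

/-- The number of elements of a subspace of words. -/
noncomputable def size {n : ℕ} (D : Submodule (ZMod 2) (QuaternaryWord n)) : ℕ :=
  (codewords D).card

/-- The sign of a symbol: `1` for `00`, and `-1` otherwise. -/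
def symbolSign (a : ZMod 2 × ZMod 2) : ℤ := if a = 0 then 1 else -1

/-- The sign of the symplectic pairing of two symbols. -/
def symbolPairing (a b : ZMod 2 × ZMod 2) : ℤ := if a.1 * b.2 + a.2 * b.1 = 0 then 1 else -1

/-- The parity sign `(-1) ^ wt c` of a word. -/
def sgn {n : ℕ} (c : QuaternaryWord n) : ℤ := ∏ i, symbolSign (c i)

/-- The sign of the symplectic form of two words. -/
def pairing {n : ℕ} (x y : QuaternaryWord n) : ℤ := ∏ i, symbolPairing (x i) (y i)

/-- The sum of the parity signs over a subspace. -/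
noncomputable def signSum {n : ℕ} (D : Submodule (ZMod 2) (QuaternaryWord n)) : ℤ :=
  ∑ c ∈ codewords D, sgn c

section Signs

variable {n : ℕ}

/-- Being nonzero is the anisotropic quadratic form `x² + xy + y²` on `F₂²`, whose polarisation is
the symplectic form. -/
theorem symbolSign_add (a b : ZMod 2 × ZMod 2) :
    symbolSign (a + b) = symbolSign a * symbolSign b * symbolPairing a b := by
  revert a b; decide

theorem symbolPairing_add (a b c : ZMod 2 × ZMod 2) :
    symbolPairing (a + b) c = symbolPairing a c * symbolPairing b c := by
  revert a b c; decide

theorem symbolPairing_comm (a b : ZMod 2 × ZMod 2) :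
    symbolPairing a b = symbolPairing b a := by
  revert a b; decide

theorem sgn_add (x y : QuaternaryWord n) : sgn (x + y) = sgn x * sgn y * pairing x y := by
  simp only [sgn, pairing, Pi.add_apply, symbolSign_add, Finset.prod_mul_distrib]

theorem pairing_add_left (x y z : QuaternaryWord n) :
    pairing (x + y) z = pairing x z * pairing y z := by
  simp only [pairing, Pi.add_apply, symbolPairing_add, Finset.prod_mul_distrib]

theorem pairing_comm (x y : QuaternaryWord n) : pairing x y = pairing y x := by
  simp only [pairing, symbolPairing_comm]

theorem pairing_add_right (x y z : QuaternaryWord n) :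
    pairing x (y + z) = pairing x y * pairing x z := by
  rw [pairing_comm, pairing_add_left, pairing_comm y, pairing_comm z]

@[simp]
theorem pairing_zero_right (x : QuaternaryWord n) : pairing x 0 = 1 := by
  simp [pairing, symbolPairing]

@[simp]
theorem pairing_zero_left (x : QuaternaryWord n) : pairing 0 x = 1 := by
  simp [pairing, symbolPairing]

@[simp]
theorem sgn_zero : sgn (0 : QuaternaryWord n) = 1 := by simp [sgn, symbolSign]

theorem sgn_eq_pow (x : QuaternaryWord n) : sgn x = (-1) ^ hammingNorm x := by
  simp only [sgn, symbolSign, hammingNorm, Finset.prod_ite]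
  simp

theorem sgn_eq_or (x : QuaternaryWord n) : sgn x = 1 ∨ sgn x = -1 := by
  rw [sgn_eq_pow]; exact neg_one_pow_eq_or ℤ _

theorem sgn_mul_self (x : QuaternaryWord n) : sgn x * sgn x = 1 := by
  rcases sgn_eq_or x with h | h <;> simp [h]

theorem word_add_self (x : QuaternaryWord n) : x + x = 0 := by
  funext i
  exact (by decide : ∀ a : ZMod 2 × ZMod 2, a + a = 0) (x i)

theorem pairing_eq_or (x y : QuaternaryWord n) : pairing x y = 1 ∨ pairing x y = -1 := by
  have h : pairing x y * pairing x y = 1 := by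
    rw [← pairing_add_left, word_add_self, pairing_zero_left]
  rcases Int.eq_one_or_neg_one_of_mul_eq_one h with h | h <;> simp [h]

end Signs

section Sizes

variable {n : ℕ} {A B D E : Submodule (ZMod 2) (QuaternaryWord n)}

theorem size_eq_two_pow (D : Submodule (ZMod 2) (QuaternaryWord n)) :
    size D = 2 ^ Module.finrank (ZMod 2) D := by
  have h := Module.natCard_eq_pow_finrank (K := ZMod 2) (V := D)
  rw [Nat.card_zmod] at h
  rw [← h, size, codewords, ← Set.ncard_eq_toFinset_card, ← Nat.card_coe_set_eq]
  rfl

theorem size_pos (D : Submodule (ZMod 2) (QuaternaryWord n)) : 0 < size D := by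
  rw [size_eq_two_pow]; positivity

theorem size_sup_mul_inf (A B : Submodule (ZMod 2) (QuaternaryWord n)) :
    size (A ⊔ B) * size (A ⊓ B) = size A * size B := by
  simp only [size_eq_two_pow, ← pow_add]
  rw [Submodule.finrank_sup_add_finrank_inf_eq]

theorem size_le (h : A ≤ B) : size A ≤ size B := by
  apply Finset.card_le_card
  intro x; simpa using fun hx => h hx

theorem size_dvd (h : A ≤ B) : size A ∣ size B := by
  simp only [size_eq_two_pow]
  exact pow_dvd_pow _ (Submodule.finrank_mono h)

theorem eq_of_le_of_size_le (h : A ≤ B) (h' : size B ≤ size A) : A = B := by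
  have : codewords A = codewords B :=
    Finset.eq_of_subset_of_card_le (fun x => by simpa using fun hx => h hx) h'
  ext x
  rw [← mem_codewords, this, mem_codewords]

/-- Every element of `A ⊔ B` is a sum in `|A ⊓ B|` ways. -/
theorem sum_sum_add (A B : Submodule (ZMod 2) (QuaternaryWord n)) (g : QuaternaryWord n → ℤ) :
    ∑ a ∈ codewords A, ∑ b ∈ codewords B, g (a + b) =
      size (A ⊓ B) * ∑ c ∈ codewords (A ⊔ B), g c := by
  classical
  rw [← Finset.sum_product', Finset.mul_sum]
  rw [← Finset.sum_fiberwise_of_maps_to (t := codewords (A ⊔ B)) (g := fun p => p.1 + p.2)]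
  · refine Finset.sum_congr rfl fun c hc => ?_
    rw [mem_codewords, Submodule.mem_sup] at hc
    obtain ⟨a, ha, b, hb, rfl⟩ := hc
    rw [Finset.sum_congr rfl (g := fun _ => g (a + b))
      (fun p hp => by rw [(Finset.mem_filter.mp hp).2])]
    rw [Finset.sum_const, nsmul_eq_mul]
    congr 2
    -- The representations of `a + b` are the pairs `(a + d, b - d)` with `d` in `A ⊓ B`.
    refine Finset.card_bij' (fun p _ => p.1 - a) (fun d _ => (a + d, b - d)) ?_ ?_ ?_ ?_
    · rintro ⟨x, y⟩ h
      simp only [mem_filter, mem_product, mem_codewords, Submodule.mem_inf] at h ⊢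
      refine ⟨A.sub_mem h.1.1 ha, ?_⟩
      have : x - a = b - y := by
        rw [sub_eq_sub_iff_add_eq_add, h.2, add_comm]
      rw [this]; exact B.sub_mem hb h.1.2
    · intro d h
      simp only [mem_filter, mem_product, mem_codewords, Submodule.mem_inf] at h ⊢
      exact ⟨⟨A.add_mem ha h.1, B.sub_mem hb h.2⟩, by abel⟩
    · rintro ⟨x, y⟩ h
      simp only [mem_filter, mem_product, mem_codewords] at h
      ext1
      · simp
      · simp only
        rw [sub_sub_eq_add_sub, add_comm b, ← h.2]; abel
    · intro d _
      simp
  · rintro ⟨x, y⟩ h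
    simp only [mem_product, mem_codewords] at h ⊢
    exact Submodule.add_mem_sup h.1 h.2

/-- The sum over a subspace of a multiplicative sign. -/
theorem sum_character (D : Submodule (ZMod 2) (QuaternaryWord n)) (g : QuaternaryWord n → ℤ)
    (hg : ∀ x ∈ D, ∀ y ∈ D, g (x + y) = g x * g y) :
    ((∀ x ∈ D, g x = 1) → ∑ x ∈ codewords D, g x = size D) ∧
      ((∃ x ∈ D, g x = -1) → ∑ x ∈ codewords D, g x = 0) := by
  constructor
  · intro h
    rw [Finset.sum_congr rfl (g := fun _ => 1) (fun x hx => h x (mem_codewords.mp hx))]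
    simp [size]
  · rintro ⟨y, hy, hgy⟩
    have h : ∑ x ∈ codewords D, g x = ∑ x ∈ codewords D, g (x + y) :=
      Finset.sum_equiv (Equiv.addRight (-y))
        (fun x => by
          simp only [mem_codewords, Equiv.coe_addRight]
          exact ⟨fun h => D.add_mem h (D.neg_mem hy),
            fun h => by simpa using D.add_mem h hy⟩)
        (fun x _ => by simp)
    have h' : ∑ x ∈ codewords D, g (x + y) = ∑ x ∈ codewords D, -g x :=
      Finset.sum_congr rfl fun x hx => by
        rw [hg x (mem_codewords.mp hx) y hy, hgy, mul_neg_one]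
    rw [h', Finset.sum_neg_distrib] at h
    omega

end Sizes

/-! ### Orthogonality, radicals and Gauss sums. -/

/-- The orthogonal subspace for the symplectic form. -/
def perp {n : ℕ} (A : Submodule (ZMod 2) (QuaternaryWord n)) :
    Submodule (ZMod 2) (QuaternaryWord n) where
  carrier := {b | ∀ a ∈ A, pairing a b = 1}
  add_mem' := by
    intro x y hx hy a ha
    rw [pairing_add_right, hx a ha, hy a ha, one_mul]
  zero_mem' := by intro a _; simp
  smul_mem' := by
    intro r x hx a ha
    rcases (by decide : ∀ r : ZMod 2, r = 0 ∨ r = 1) r with rfl | rfl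
    · simp
    · simpa using hx a ha

theorem mem_perp {n : ℕ} {A : Submodule (ZMod 2) (QuaternaryWord n)} {b : QuaternaryWord n} :
    b ∈ perp A ↔ ∀ a ∈ A, pairing a b = 1 := Iff.rfl

/-- The radical of a subspace for the symplectic form. -/
def rad {n : ℕ} (D : Submodule (ZMod 2) (QuaternaryWord n)) :
    Submodule (ZMod 2) (QuaternaryWord n) := perp D ⊓ D

/-- All words of a subspace have even weight. -/
def IsEven {n : ℕ} (D : Submodule (ZMod 2) (QuaternaryWord n)) : Prop := ∀ x ∈ D, sgn x = 1

section Perp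

variable {n : ℕ} {A B D E : Submodule (ZMod 2) (QuaternaryWord n)}

theorem IsEven.signSum_eq (h : IsEven D) : signSum D = size D := by
  rw [signSum, Finset.sum_congr rfl (g := fun _ => 1) (fun x hx => h x (mem_codewords.mp hx))]
  simp [size]

theorem IsEven.pairing_eq (h : IsEven D) {x y : QuaternaryWord n} (hx : x ∈ D) (hy : y ∈ D) :
    pairing x y = 1 := by
  have := sgn_add x y
  rwa [h _ (D.add_mem hx hy), h _ hx, h _ hy, one_mul, one_mul, eq_comm] at this

theorem IsEven.le_perp (h : IsEven D) : D ≤ perp D := fun _ hx _ ha => h.pairing_eq ha hx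

theorem perp_anti (h : A ≤ B) : perp B ≤ perp A := fun _ hx a ha => hx a (h ha)

theorem le_perp_comm : A ≤ perp B ↔ B ≤ perp A := by
  constructor <;> intro h x hx y hy <;> rw [pairing_comm] <;> exact h hy x hx

theorem sum_pairing (A : Submodule (ZMod 2) (QuaternaryWord n)) (b : QuaternaryWord n) :
    (b ∈ perp A → ∑ a ∈ codewords A, pairing a b = size A) ∧
      (b ∉ perp A → ∑ a ∈ codewords A, pairing a b = 0) := by
  have h := sum_character A (fun a => pairing a b) (fun x _ y _ => pairing_add_left x y b)
  refine ⟨fun hb => h.1 hb, fun hb => h.2 ?_⟩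
  simp only [mem_perp, not_forall] at hb
  obtain ⟨a, ha, hab⟩ := hb
  exact ⟨a, ha, (pairing_eq_or a b).resolve_left hab⟩

/-- A weighted sum of the pairings with `A` picks out the words orthogonal to `A`. -/
theorem sum_mul_sum_pairing (A B : Submodule (ZMod 2) (QuaternaryWord n))
    (g : QuaternaryWord n → ℤ) :
    ∑ b ∈ codewords B, g b * ∑ a ∈ codewords A, pairing a b =
      size A * ∑ b ∈ codewords (perp A ⊓ B), g b := by
  classical
  have h : codewords (perp A ⊓ B) = (codewords B).filter (· ∈ perp A) := by
    ext x; simp [and_comm]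
  rw [h, Finset.sum_filter, Finset.mul_sum]
  refine Finset.sum_congr rfl fun b _ => ?_
  split_ifs with hb
  · rw [(sum_pairing A b).1 hb, mul_comm]
  · rw [(sum_pairing A b).2 hb, mul_zero, mul_zero]

/-- Both sides evaluate the double sum of the pairing over `A × B`. With `A ≤ B` it replaces the
dimension formula for orthogonal complements in a possibly degenerate space. -/
theorem size_perp_inf_mul (A B : Submodule (ZMod 2) (QuaternaryWord n)) :
    size (perp A ⊓ B) * size A = size B * size (perp B ⊓ A) := by
  have h1 := sum_mul_sum_pairing A B (fun _ => 1)
  have h2 := sum_mul_sum_pairing B A (fun _ => 1)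
  simp only [one_mul] at h1 h2
  rw [Finset.sum_comm] at h1
  have h3 : ∑ a ∈ codewords A, ∑ b ∈ codewords B, pairing a b =
      ∑ a ∈ codewords A, ∑ b ∈ codewords B, pairing b a :=
    Finset.sum_congr rfl fun a _ => Finset.sum_congr rfl fun b _ => pairing_comm a b
  rw [h1, h2] at h3
  simp only [sum_const, nsmul_eq_mul, mul_one] at h3
  rw [mul_comm]
  exact_mod_cast h3

/-- Summing the signs over the translates of the words of `B` by an even subspace `A`. -/
theorem signSum_perp_inf (hA : IsEven A) (hAB : A ≤ B) :
    signSum (perp A ⊓ B) = signSum B := by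
  have h1 := sum_sum_add B A sgn
  rw [inf_eq_right.mpr hAB, sup_eq_left.mpr hAB] at h1
  have h2 := sum_mul_sum_pairing A B sgn
  -- Summed over a translate `x + A`, the sign becomes `sgn x` times a character sum, which vanishes
  -- unless `x` is orthogonal to `A`.
  have h3 : ∑ a ∈ codewords B, ∑ b ∈ codewords A, sgn (a + b) =
      ∑ b ∈ codewords B, sgn b * ∑ a ∈ codewords A, pairing a b := by
    refine Finset.sum_congr rfl fun x _ => ?_
    rw [Finset.mul_sum]
    refine Finset.sum_congr rfl fun y hy => ?_
    rw [sgn_add, hA y (mem_codewords.mp hy), mul_one, pairing_comm]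
  have h4 : (size A : ℤ) ≠ 0 := by exact_mod_cast (size_pos A).ne'
  exact mul_left_cancel₀ h4 (h2.symm.trans (h3.symm.trans h1))

/-- Signs over `D ⊔ A` when `A` is even and orthogonal to `D`. -/
theorem signSum_sup_mul (hA : IsEven A) (hAD : A ≤ perp D) :
    size (D ⊓ A) * signSum (D ⊔ A) = size A * signSum D := by
  have h1 := sum_sum_add D A sgn
  rw [signSum, ← h1, signSum, Finset.mul_sum]
  refine Finset.sum_congr rfl fun x hx => ?_
  rw [Finset.sum_congr rfl (g := fun _ => sgn x)]
  · rw [Finset.sum_const, nsmul_eq_mul]; rfl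
  · intro y hy
    rw [sgn_add, hA y (mem_codewords.mp hy), mul_one,
      hAD (mem_codewords.mp hy) x (mem_codewords.mp hx), mul_one]

/-- The Gauss sum computation: put `y = x + r` in the double sum over `x, y`. Then `sgn x * sgn y =
sgn r * pairing x r`, and summing over `x` leaves only the `r` in the radical. -/
theorem signSum_sq (D : Submodule (ZMod 2) (QuaternaryWord n)) :
    signSum D ^ 2 = size D * signSum (rad D) := by
  have h := sum_mul_sum_pairing D D sgn
  unfold signSum rad
  rw [← h, sq, Finset.sum_mul]
  have h1 : ∀ x ∈ codewords D, sgn x * ∑ y ∈ codewords D, sgn y =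
      ∑ r ∈ codewords D, sgn r * pairing x r := by
    intro x hx
    rw [Finset.mul_sum]
    refine Finset.sum_equiv (Equiv.addLeft (-x)) (fun y => ?_) (fun y _ => ?_)
    · simp only [mem_codewords, Equiv.coe_addLeft]
      rw [mem_codewords] at hx
      exact ⟨fun h => D.add_mem (D.neg_mem hx) h, fun h => by simpa using D.add_mem hx h⟩
    · have h3 : y = x + (-x + y) := by abel
      have h2 := sgn_add x (-x + y)
      rw [← h3] at h2
      rw [h2, Equiv.coe_addLeft, ← mul_assoc, ← mul_assoc, sgn_mul_self, one_mul]
  rw [Finset.sum_congr rfl h1, Finset.sum_comm]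
  simp only [Finset.mul_sum]

theorem rad_le : rad D ≤ D := inf_le_right

theorem signSum_rad (D : Submodule (ZMod 2) (QuaternaryWord n)) :
    (IsEven (rad D) → signSum (rad D) = size (rad D)) ∧
      ((∃ r ∈ rad D, sgn r = -1) → signSum (rad D) = 0) := by
  refine sum_character _ sgn fun x hx y hy => ?_
  rw [sgn_add, hy.1 x hx.2, mul_one]

/-- On the radical the sign is a character, so one odd radical word already annihilates the sum. -/
theorem isEven_rad_of_signSum_ne_zero (h : signSum D ≠ 0) : IsEven (rad D) := by
  intro r hr
  by_contra h1
  apply h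
  have h2 := signSum_sq D
  rw [(signSum_rad D).2 ⟨r, hr, (sgn_eq_or r).resolve_left h1⟩, mul_zero] at h2
  exact pow_eq_zero_iff (two_ne_zero) |>.mp h2

theorem signSum_sq_of_ne_zero (h : signSum D ≠ 0) :
    signSum D ^ 2 = size D * size (rad D) := by
  rw [signSum_sq, (signSum_rad D).1 (isEven_rad_of_signSum_ne_zero h)]

theorem exists_odd_of_signSum_eq_zero (h : signSum D = 0) : ∃ r ∈ rad D, sgn r = -1 := by
  by_contra h1
  push Not at h1
  have h2 := signSum_sq D
  rw [(signSum_rad D).1 fun r hr => (sgn_eq_or r).resolve_right (h1 r hr), h] at h2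
  have h3 := size_pos D
  have h4 := size_pos (rad D)
  have : (0 : ℤ) < size D * size (rad D) := by positivity
  rw [← h2] at this
  simp at this

end Perp

/-! ### Sign sums of a space and of a subspace compared. -/

section Steps

variable {n : ℕ} {A B D E : Submodule (ZMod 2) (QuaternaryWord n)}

theorem IsEven.sup (hA : IsEven A) (hD : IsEven D) (hAD : A ≤ perp D) : IsEven (D ⊔ A) := by
  intro x hx
  obtain ⟨d, hd, a, ha, rfl⟩ := Submodule.mem_sup.mp hx
  rw [sgn_add, hA a ha, hD d hd, hAD ha d hd, one_mul, one_mul]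

theorem rad_le_perp : rad D ≤ perp D := inf_le_left

theorem inf_rad_le_rad (h : D ≤ E) : D ⊓ rad E ≤ rad D :=
  le_inf ((inf_le_right.trans rad_le_perp).trans (perp_anti h)) inf_le_left

/-- Comparison of the radicals of a subspace `D ≤ E` and of `E`. -/
theorem size_rad_mul_size_rad (hDE : D ≤ E) (hE : signSum E ≠ 0) (hD : signSum D ≠ 0) :
    size D * size (rad E) ≤ size E * size (D ⊓ rad E) ∧
    size D * size (rad E) * size (rad D) ≤ size E * size (D ⊓ rad E) ^ 2 ∧
    (signSum E * signSum D < 0 →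
      size D * size (rad E) * size (rad D) < size E * size (D ⊓ rad E) ^ 2) := by
  have hRE := isEven_rad_of_signSum_ne_zero hE
  have hRD := isEven_rad_of_signSum_ne_zero hD
  have hDp : rad E ≤ perp D := rad_le_perp.trans (perp_anti hDE)
  set δ := size (D ⊓ rad E) with hδ
  have hδ0 : 0 < δ := size_pos _
  have hH : size (D ⊔ rad E) * δ = size D * size (rad E) := size_sup_mul_inf _ _
  have hHE : D ⊔ rad E ≤ E := sup_le hDE rad_le
  have hE' : signSum (perp (rad D) ⊓ E) = signSum E :=
    signSum_perp_inf hRD (rad_le.trans hDE)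
  have hsE' : size (perp (rad D) ⊓ E) * size (rad D) = size E * δ := by
    rw [size_perp_inf_mul, hδ]
    congr 2
    apply le_antisymm
    · exact le_inf (inf_le_right.trans rad_le)
        (le_inf inf_le_left (inf_le_right.trans (rad_le.trans hDE)))
    · exact le_inf (inf_le_right.trans rad_le_perp) (inf_rad_le_rad hDE)
  -- The key inclusion; the second inequality compares the sizes of its two sides.
  have hle : D ⊔ rad E ≤ perp (rad D) ⊓ E := by
    refine le_inf (sup_le (le_perp_comm.mp rad_le_perp) ?_) hHE
    exact rad_le_perp.trans (perp_anti (rad_le.trans hDE))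
  have hF : δ * signSum (D ⊔ rad E) = size (rad E) * signSum D := signSum_sup_mul hRE hDp
  have h2 : size D * size (rad E) * size (rad D) ≤ size E * δ ^ 2 := by
    calc size D * size (rad E) * size (rad D) = size (D ⊔ rad E) * size (rad D) * δ := by
          rw [← hH]; ring
      _ ≤ size (perp (rad D) ⊓ E) * size (rad D) * δ := by gcongr; exact size_le hle
      _ = size E * δ ^ 2 := by rw [hsE']; ring
  refine ⟨?_, h2, fun hneg => lt_of_le_of_ne h2 fun heq => ?_⟩
  · rw [← hH]; gcongr; exact size_le hHE
  -- In the equality case the inclusion is an equality of spaces. One side has the sign sum of `E`,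
  -- the other a positive multiple of that of `D`, so opposite signs are impossible.
  · have h3 : size (perp (rad D) ⊓ E) * (size (rad D) * δ) =
        size (D ⊔ rad E) * (size (rad D) * δ) := by
      calc _ = size E * δ ^ 2 := by rw [← mul_assoc, hsE']; ring
        _ = size D * size (rad E) * size (rad D) := heq.symm
        _ = _ := by rw [← hH]; ring
    have h4 := Nat.eq_of_mul_eq_mul_right (Nat.mul_pos (size_pos _) hδ0) h3
    rw [eq_of_le_of_size_le hle h4.le, hE'] at hF
    have h5 : (0 : ℤ) < size (rad E) := by exact_mod_cast size_pos _
    have h6 : (0 : ℤ) < δ := by exact_mod_cast hδ0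
    have h7 : (δ : ℤ) * (signSum E * signSum D) = size (rad E) * signSum D ^ 2 := by
      rw [← mul_assoc, hF]; ring
    have h8 : (0 : ℤ) < size (rad E) * signSum D ^ 2 := by positivity
    rw [← h7] at h8
    nlinarith

/-- Pairwise complementary even subspaces have room only for few of them. -/
theorem card_even_cover {ι : Type*} (s : Finset ι) (G : ι → Submodule (ZMod 2) (QuaternaryWord n))
    (hs : 1 < s.card) (hG : ∀ a ∈ s, IsEven (G a) ∧ G a ≤ E)
    (hpair : ∀ a ∈ s, ∀ b ∈ s, a ≠ b → G a ⊔ G b = E) (hF : 0 < signSum E) :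
    2 * (s.card * (signSum E - size (rad E)) + size (rad E)) ≤ size E + signSum E := by
  classical
  have hR := isEven_rad_of_signSum_ne_zero hF.ne'
  have hsq := signSum_sq_of_ne_zero hF.ne'
  set H : ι → Submodule (ZMod 2) (QuaternaryWord n) := fun a => G a ⊔ rad E with hHdef
  have hHE : ∀ a ∈ s, H a ≤ E := fun a ha => sup_le (hG a ha).2 rad_le
  have hHeven : ∀ a ∈ s, IsEven (H a) := fun a ha =>
    hR.sup (hG a ha).1 (rad_le_perp.trans (perp_anti (hG a ha).2))
  -- An even subspace lies in its own orthogonal space, so its size is at most the square root of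
  -- `|E| |rad E|`, which is `signSum E`.
  have hHle : ∀ a ∈ s, (size (H a) : ℤ) ≤ signSum E := by
    intro a ha
    have h1 := size_perp_inf_mul (H a) E
    have h2 : size (H a) ≤ size (perp (H a) ⊓ E) :=
      size_le (le_inf (hHeven a ha).le_perp (hHE a ha))
    have h3 : size (perp E ⊓ H a) ≤ size (rad E) :=
      size_le (inf_le_inf_left _ (hHE a ha))
    have h4 : size (H a) * size (H a) ≤ size E * size (rad E) := by
      calc _ ≤ size (perp (H a) ⊓ E) * size (H a) := by gcongr
        _ = _ := h1
        _ ≤ _ := by gcongr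
    have h5 : (size (H a) : ℤ) * size (H a) ≤ signSum E ^ 2 := by
      rw [hsq]; exact_mod_cast h4
    nlinarith
  -- Two such subspaces spanning `E` must both attain the bound, and meet exactly in the radical.
  have hHH : ∀ a ∈ s, ∀ b ∈ s, a ≠ b →
      signSum E ≤ size (H a) ∧ H a ⊓ H b = rad E := by
    intro a ha b hb hab
    have h1 : H a ⊔ H b = E := by
      apply le_antisymm (sup_le (hHE a ha) (hHE b hb))
      rw [← hpair a ha b hb hab]
      exact sup_le_sup le_sup_left le_sup_left
    have h2 := size_sup_mul_inf (H a) (H b)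
    rw [h1] at h2
    have hle : rad E ≤ H a ⊓ H b := le_inf le_sup_right le_sup_right
    have h3 := size_le hle
    have ha' := hHle a ha
    have hb' := hHle b hb
    have h2' : (size E : ℤ) * size (H a ⊓ H b) = size (H a) * size (H b) := by
      exact_mod_cast h2
    have h3' : (size (rad E) : ℤ) ≤ size (H a ⊓ H b) := by exact_mod_cast h3
    have h4 : (0 : ℤ) < size E := by exact_mod_cast size_pos E
    have ha0 : (0 : ℤ) < size (H a) := by exact_mod_cast size_pos _
    have hb0 : (0 : ℤ) < size (H b) := by exact_mod_cast size_pos _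
    constructor
    · by_contra! hlt
      nlinarith
    · refine (eq_of_le_of_size_le hle ?_).symm
      have : (size (H a ⊓ H b) : ℤ) ≤ size (rad E) := by
        by_contra! hlt
        nlinarith
      exact_mod_cast this
  have hHsize : ∀ a ∈ s, (size (H a) : ℤ) = signSum E := by
    intro a ha
    obtain ⟨b, hb, hab⟩ := Finset.exists_mem_ne hs a
    exact le_antisymm (hHle a ha) (hHH a ha b hb hab.symm).1
  set P := (codewords E).filter (fun x => sgn x = 1)
  have hP : 2 * (P.card : ℤ) = size E + signSum E := by
    have : ∀ x ∈ codewords E, (1 + sgn x : ℤ) = 2 * (if sgn x = 1 then 1 else 0) := by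
      intro x _
      rcases sgn_eq_or x with h | h <;> simp [h]
    have h1 := Finset.sum_congr rfl this
    rw [Finset.sum_add_distrib, ← Finset.mul_sum, Finset.sum_boole] at h1
    rw [← h1]; simp [size, signSum]
  have hdisj : Set.PairwiseDisjoint (s : Set ι) (fun a => codewords (H a) \ codewords (rad E)) := by
    intro a ha b hb hab
    rw [Function.onFun, Finset.disjoint_left]
    intro x hx hx'
    simp only [Finset.mem_sdiff, mem_codewords] at hx hx'
    exact hx.2 ((hHH a ha b hb hab).2 ▸ ⟨hx.1, hx'.1⟩)
  -- Outside the radical the `H a` are disjoint sets of even words, and `E` has `(|E| + signSum E) /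
  -- 2` even words.
  have hsub : codewords (rad E) ∪ s.biUnion (fun a => codewords (H a) \ codewords (rad E)) ⊆ P := by
    intro x hx
    simp only [Finset.mem_union, Finset.mem_biUnion, Finset.mem_sdiff, mem_codewords] at hx
    simp only [P, Finset.mem_filter, mem_codewords]
    rcases hx with hx | ⟨a, ha, hx, _⟩
    · exact ⟨rad_le hx, hR x hx⟩
    · exact ⟨hHE a ha hx, hHeven a ha x hx⟩
  have hcard := Finset.card_le_card hsub
  rw [Finset.card_union_of_disjoint, Finset.card_biUnion hdisj] at hcard
  · rw [← hP]
    have h5 : ∀ a ∈ s, ((codewords (H a) \ codewords (rad E)).card : ℤ) =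
        signSum E - size (rad E) := by
      intro a ha
      rw [Finset.card_sdiff_of_subset, Nat.cast_sub, ← hHsize a ha]
      · rfl
      · exact size_le (le_sup_right : rad E ≤ H a)
      · intro x; simpa using fun hx => (le_sup_right : rad E ≤ H a) hx
    have h6 : (∑ a ∈ s, ((codewords (H a) \ codewords (rad E)).card : ℤ)) =
        s.card * (signSum E - size (rad E)) := by
      rw [Finset.sum_congr rfl h5, Finset.sum_const, nsmul_eq_mul]
    have h7 : ((size (rad E) : ℤ) + ∑ a ∈ s, ((codewords (H a) \ codewords (rad E)).card : ℤ)) ≤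
      P.card := by exact_mod_cast hcard
    linarith
  · rw [Finset.disjoint_left]
    intro x hx hx'
    simp only [Finset.mem_biUnion, Finset.mem_sdiff] at hx'
    obtain ⟨a, _, _, h⟩ := hx'
    exact h hx

theorem natAbs_eq_two_pow {f : ℤ} (h : f ^ 2 = size D) : ∃ b, f.natAbs = 2 ^ b := by
  rw [size_eq_two_pow] at h
  have h1 : f.natAbs ^ 2 = 2 ^ Module.finrank (ZMod 2) D := by
    zify; rw [sq_abs, h]; simp
  obtain ⟨b, _, hb⟩ := (Nat.dvd_prime_pow Nat.prime_two).mp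
    (Dvd.intro _ ((sq _).symm.trans h1))
  exact ⟨b, hb⟩

/-- The sign sum `2 ^ m * f` of a space with `4 ^ m` elements. -/
structure HasLevel (D : Submodule (ZMod 2) (QuaternaryWord n)) (m : ℕ) (f : ℤ) : Prop where
  size_eq : size D = 4 ^ m
  signSum_eq : signSum D = 2 ^ m * f

theorem HasLevel.sq_eq {m : ℕ} {f : ℤ} (h : HasLevel D m f) (hf : f ≠ 0) :
    f ^ 2 = size (rad D) := by
  have h1 := h.signSum_eq
  have h2 := signSum_sq_of_ne_zero (D := D) (by rw [h1]; positivity)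
  rw [h1, h.size_eq, mul_pow, ← pow_mul, mul_comm m 2, pow_mul] at h2
  push_cast at h2
  norm_num at h2
  exact h2

theorem HasLevel.isEven_rad {m : ℕ} {f : ℤ} (h : HasLevel D m f) (hf : f ≠ 0) :
    IsEven (rad D) :=
  isEven_rad_of_signSum_ne_zero (by rw [h.signSum_eq]; positivity)

/-- The square `f²` is the order of the binary space `rad D`, and `rad D ≤ D` bounds the exponent.
-/
theorem HasLevel.natAbs_eq {m : ℕ} {f : ℤ} (h : HasLevel D m f) (hf : f ≠ 0) :
    ∃ b ≤ m, f.natAbs = 2 ^ b := by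
  obtain ⟨b, hb⟩ := natAbs_eq_two_pow (h.sq_eq hf)
  refine ⟨b, ?_, hb⟩
  have h1 := size_le (rad_le (D := D))
  have h2 := h.sq_eq hf
  rw [h.size_eq] at h1
  have h3 : f.natAbs ^ 2 = size (rad D) := by zify; rw [sq_abs, h2]
  rw [← h3, hb, ← pow_mul, mul_comm, pow_mul] at h1
  exact (Nat.pow_le_pow_iff_right (by norm_num)).mp h1

/-- The inequalities of `size_rad_mul_size_rad` with the powers of 4 cancelled; everything is
controlled by the single number `|D ⊓ rad E|`. -/
theorem HasLevel.step {m : ℕ} {f g : ℤ} (hDE : D ≤ E) (hE : HasLevel E (m + 1) f)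
    (hD : HasLevel D m g) (hf : f ≠ 0) (hg : g ≠ 0) :
    |f * g| ≤ 2 * size (D ⊓ rad E) ∧
      (f * g < 0 → |f * g| < 2 * size (D ⊓ rad E)) ∧
      f ^ 2 ≤ 4 * size (D ⊓ rad E) ∧ (size (D ⊓ rad E) : ℤ) ≤ f ^ 2 ∧
      (size (D ⊓ rad E) : ℤ) ≤ g ^ 2 := by
  have hFE := hE.signSum_eq
  have hFD := hD.signSum_eq
  obtain ⟨h1, h2, h3⟩ := size_rad_mul_size_rad hDE (by rw [hFE]; positivity)
    (by rw [hFD]; positivity)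
  have hrE := hE.sq_eq hf
  have hrD := hD.sq_eq hg
  have h4 : (size (D ⊓ rad E) : ℤ) ≤ f ^ 2 := by
    rw [hrE]; exact_mod_cast size_le inf_le_right
  have h5 : (size (D ⊓ rad E) : ℤ) ≤ g ^ 2 := by
    rw [hrD]; exact_mod_cast size_le (inf_rad_le_rad hDE)
  set δ := size (D ⊓ rad E)
  rw [hE.size_eq, hD.size_eq] at h1 h2 h3
  have hp : (0 : ℤ) < 4 ^ m := by positivity
  have h1' : (4 : ℤ) ^ m * f ^ 2 ≤ 4 ^ m * (4 * δ) := by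
    rw [hrE]; rw [pow_succ, mul_assoc] at h1; exact_mod_cast h1
  have h2' : (4 : ℤ) ^ m * (f * g) ^ 2 ≤ 4 ^ m * (2 * δ) ^ 2 := by
    have : (4 : ℤ) ^ m * size (rad E) * size (rad D) ≤ 4 ^ (m + 1) * δ ^ 2 := by exact_mod_cast h2
    rw [← hrE, ← hrD] at this
    calc _ = (4 : ℤ) ^ m * f ^ 2 * g ^ 2 := by ring
      _ ≤ _ := this
      _ = _ := by ring
  refine ⟨abs_le_of_sq_le_sq (le_of_mul_le_mul_left h2' hp) (by positivity), fun hneg => ?_,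
    le_of_mul_le_mul_left h1' hp, h4, h5⟩
  have h6 := h3 (by
    rw [hFE, hFD]
    have : (2 : ℤ) ^ (m + 1) * f * (2 ^ m * g) = 2 ^ (m + 1) * 2 ^ m * (f * g) := by ring
    rw [this]
    exact mul_neg_of_pos_of_neg (by positivity) hneg)
  have h3' : (4 : ℤ) ^ m * (f * g) ^ 2 < 4 ^ m * (2 * δ) ^ 2 := by
    have : (4 : ℤ) ^ m * size (rad E) * size (rad D) < 4 ^ (m + 1) * δ ^ 2 := by exact_mod_cast h6
    rw [← hrE, ← hrD] at this
    calc _ = (4 : ℤ) ^ m * f ^ 2 * g ^ 2 := by ring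
      _ < _ := this
      _ = _ := by ring
  exact abs_lt_of_sq_lt_sq (lt_of_mul_lt_mul_left h3' hp.le) (by positivity)

/-- The product `|f| |g|` is at most `2 |D ⊓ rad E|`, and this intersection has at most `f²` and at
most `g²` elements. -/
theorem HasLevel.abs_le {m : ℕ} {f g : ℤ} (hDE : D ≤ E) (hE : HasLevel E (m + 1) f)
    (hD : HasLevel D m g) (hf : f ≠ 0) (hg : g ≠ 0) : |g| ≤ 2 * |f| ∧ |f| ≤ 2 * |g| := by
  obtain ⟨h1, _, _, h4, h5⟩ := HasLevel.step hDE hE hD hf hg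
  have hf' := abs_pos.mpr hf
  have hg' := abs_pos.mpr hg
  rw [abs_mul] at h1
  rw [← sq_abs] at h4 h5
  constructor <;> nlinarith

/-- If the level doubles, then the radical lies in the subspace. -/
theorem HasLevel.rad_le_of_two_mul_le {m : ℕ} {f g : ℤ} (hDE : D ≤ E) (hE : HasLevel E (m + 1) f)
    (hD : HasLevel D m g) (hf : f ≠ 0) (hg : g ≠ 0) (h : 2 * |f| ≤ |g|) : rad E ≤ D := by
  obtain ⟨h1, _, _, h4, h5⟩ := HasLevel.step hDE hE hD hf hg
  have hf' := abs_pos.mpr hf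
  rw [abs_mul] at h1
  have h2 : f ^ 2 ≤ size (D ⊓ rad E) := by
    rw [← sq_abs]; nlinarith
  rw [hE.sq_eq hf] at h2
  rw [← eq_of_le_of_size_le (inf_le_right : D ⊓ rad E ≤ rad E) (by exact_mod_cast h2)]
  exact inf_le_left

/-- If the level is halved, then the radical of the subspace lies in the radical. -/
theorem HasLevel.rad_eq_of_two_mul_le {m : ℕ} {f g : ℤ} (hDE : D ≤ E) (hE : HasLevel E (m + 1) f)
    (hD : HasLevel D m g) (hf : f ≠ 0) (hg : g ≠ 0) (h : 2 * |g| ≤ |f|) :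
    D ⊓ rad E = rad D := by
  obtain ⟨h1, _, _, h4, h5⟩ := HasLevel.step hDE hE hD hf hg
  have hg' := abs_pos.mpr hg
  rw [abs_mul] at h1
  have h2 : g ^ 2 ≤ size (D ⊓ rad E) := by
    rw [← sq_abs]; nlinarith
  rw [hD.sq_eq hg] at h2
  exact eq_of_le_of_size_le (inf_rad_le_rad hDE) (by exact_mod_cast h2)

/-- If the level changes its sign, then its absolute value stays. -/
theorem HasLevel.eq_neg {m : ℕ} {f g : ℤ} (hDE : D ≤ E) (hE : HasLevel E (m + 1) f)
    (hD : HasLevel D m g) (h : f * g < 0) : g = -f ∧ rad E ≤ D := by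
  have hf : f ≠ 0 := by rintro rfl; simp at h
  have hg : g ≠ 0 := by rintro rfl; simp at h
  obtain ⟨_, h1, _, h4, h5⟩ := HasLevel.step hDE hE hD hf hg
  have h1 := h1 h
  have hf' := abs_pos.mpr hf
  have hg' := abs_pos.mpr hg
  rw [abs_mul] at h1
  have h4' := h4
  rw [← sq_abs] at h4 h5
  have h6 : |g| < 2 * |f| := by nlinarith
  have h7 : |f| < 2 * |g| := by nlinarith
  obtain ⟨a, ha⟩ := natAbs_eq_two_pow (hE.sq_eq hf)
  obtain ⟨b, hb⟩ := natAbs_eq_two_pow (hD.sq_eq hg)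
  -- Two powers of two, each less than twice the other, coincide.
  have h8 : |f| = |g| := by
    rw [Int.abs_eq_natAbs, Int.abs_eq_natAbs, ha, hb] at h6 h7 ⊢
    have h6' : 2 ^ b < 2 ^ (a + 1) := by rw [pow_succ']; exact_mod_cast h6
    have h7' : 2 ^ a < 2 ^ (b + 1) := by rw [pow_succ']; exact_mod_cast h7
    rw [Nat.pow_lt_pow_iff_right (by norm_num)] at h6' h7'
    rw [show a = b by omega]
  constructor
  · rcases abs_eq_abs.mp h8 with h9 | h9
    · exfalso; rw [h9] at h; nlinarith [mul_self_nonneg g]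
    · omega
  · have h9 := hE.sq_eq hf
    have h10 : f ^ 2 < 2 * size (D ⊓ rad E) := by
      rw [← sq_abs, sq]; nth_rewrite 2 [h8]; exact h1
    have h11 := size_dvd (inf_le_right : D ⊓ rad E ≤ rad E)
    rw [h9] at h10 h4'
    -- The size of the intersection divides that of the radical, and the quotient is less than 2.
    have h12 : size (rad E) = size (D ⊓ rad E) := by
      obtain ⟨c, hc⟩ := h11
      have h13 := size_pos (rad E)
      rw [hc] at h10 h13 ⊢
      push_cast at h10
      have : c < 2 := by
        by_contra! hc2
        have : (2 : ℤ) ≤ c := by exact_mod_cast hc2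
        have : (0 : ℤ) ≤ size (D ⊓ rad E) := by positivity
        nlinarith
      interval_cases c
      · simp at h13
      · simp
    rw [← eq_of_le_of_size_le (inf_le_right : D ⊓ rad E ≤ rad E) h12.le]
    exact inf_le_left

end Steps

/-! ### Shortening and the double counting of zeros. -/

/-- The subspace of the words of `D` which vanish on `U`. -/
def shorten {n : ℕ} (D : Submodule (ZMod 2) (QuaternaryWord n)) (U : Finset (Fin n)) :
    Submodule (ZMod 2) (QuaternaryWord n) where
  carrier := {c | c ∈ D ∧ ∀ i ∈ U, c i = 0}
  add_mem' := by
    rintro x y ⟨hx, hx'⟩ ⟨hy, hy'⟩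
    exact ⟨D.add_mem hx hy, fun i hi => by simp [hx' i hi, hy' i hi]⟩
  zero_mem' := ⟨D.zero_mem, fun i _ => rfl⟩
  smul_mem' := by
    rintro r x ⟨hx, hx'⟩
    exact ⟨D.smul_mem r hx, fun i hi => by simp [hx' i hi]⟩

/-- The number of words of weight `w` in a subspace. -/
noncomputable def weightCount {n : ℕ} (D : Submodule (ZMod 2) (QuaternaryWord n)) (w : ℕ) : ℕ :=
  ((codewords D).filter (fun c => hammingNorm c = w)).card

section Shorten

variable {n : ℕ} {D E : Submodule (ZMod 2) (QuaternaryWord n)} {U T : Finset (Fin n)}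

theorem mem_shorten {c : QuaternaryWord n} : c ∈ shorten D U ↔ c ∈ D ∧ ∀ i ∈ U, c i = 0 := Iff.rfl

theorem shorten_le : shorten D U ≤ D := fun _ h => h.1

theorem shorten_empty : shorten D ∅ = D := by
  ext x; simp [mem_shorten]

theorem shorten_anti (h : T ⊆ U) : shorten D U ≤ shorten D T :=
  fun _ hx => ⟨hx.1, fun i hi => hx.2 i (h hi)⟩

theorem shorten_shorten : shorten (shorten D U) T = shorten D (U ∪ T) := by
  ext x
  simp only [mem_shorten, Finset.mem_union, or_imp, forall_and, and_assoc]

theorem shorten_inf_shorten : shorten D U ⊓ shorten D T = shorten D (U ∪ T) := by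
  ext x
  simp only [Submodule.mem_inf, mem_shorten, Finset.mem_union, or_imp, forall_and]
  tauto

theorem shorten_insert (i : Fin n) : shorten D (insert i U) = shorten (shorten D U) {i} := by
  rw [shorten_shorten, Finset.insert_eq, Finset.union_comm]

theorem inf_shorten (h : E ≤ D) : shorten D U ⊓ E = shorten E U := by
  ext x
  simp only [Submodule.mem_inf, mem_shorten]
  exact ⟨fun ⟨⟨_, h2⟩, h3⟩ => ⟨h3, h2⟩, fun ⟨h1, h2⟩ => ⟨⟨h h1, h2⟩, h1⟩⟩

/-- Shortening at one coordinate divides the size by `1`, `2` or `4`. -/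
theorem exists_size_shorten (D : Submodule (ZMod 2) (QuaternaryWord n)) (i : Fin n) :
    ∃ k ≤ 2, size D = 2 ^ k * size (shorten D {i}) := by
  let φ : D →ₗ[ZMod 2] ZMod 2 × ZMod 2 :=
    (LinearMap.proj (R := ZMod 2) (φ := fun _ : Fin n => ZMod 2 × ZMod 2) i).comp D.subtype
  have h1 := LinearMap.finrank_range_add_finrank_ker φ
  have h2 : Module.finrank (ZMod 2) (LinearMap.range φ) ≤ 2 := by
    have := Submodule.finrank_le (LinearMap.range φ)
    simpa using this
  have h3 : (LinearMap.ker φ).map D.subtype = shorten D {i} := by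
    ext x
    simp [mem_shorten, φ, and_comm]
  have h4 : Module.finrank (ZMod 2) (shorten D {i}) = Module.finrank (ZMod 2) (LinearMap.ker φ) := by
    rw [← h3]
    exact (Submodule.equivMapOfInjective _ D.subtype_injective _).finrank_eq.symm
  refine ⟨_, h2, ?_⟩
  rw [size_eq_two_pow, size_eq_two_pow, ← pow_add, h4, h1]

theorem weightCount_zero : weightCount D 0 = 1 := by
  rw [weightCount, Finset.card_eq_one]
  refine ⟨0, ?_⟩
  ext x
  simp only [mem_filter, mem_codewords, hammingNorm_eq_zero, mem_singleton]
  exact ⟨fun h => h.2, fun h => ⟨h ▸ D.zero_mem, h⟩⟩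

theorem sum_range_weightCount (g : ℕ → ℤ) :
    ∑ c ∈ codewords D, g (hammingNorm c) = ∑ w ∈ range (n + 1), g w * weightCount D w := by
  rw [← Finset.sum_fiberwise_of_maps_to (t := range (n + 1)) (g := hammingNorm)]
  · refine Finset.sum_congr rfl fun w _ => ?_
    rw [Finset.sum_congr rfl (g := fun _ => g w)
      (fun c hc => by rw [(Finset.mem_filter.mp hc).2])]
    rw [Finset.sum_const, nsmul_eq_mul, mul_comm]
    rfl
  · intro c _
    rw [mem_range, Nat.lt_succ_iff]
    simpa using hammingNorm_le_card_fintype (x := c)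

/-- Double counting of the zeros outside `U` of the words which vanish on `U`. -/
theorem sum_weightCount_shorten (hU : ∀ c ∈ D, ∀ i ∈ U, c i = 0) (w : ℕ) :
    ∑ i ∈ Uᶜ, weightCount (shorten D {i}) w = (n - U.card - w) * weightCount D w := by
  classical
  have h1 : ∀ i ∈ Uᶜ, weightCount (shorten D {i}) w =
      ∑ c ∈ (codewords D).filter (fun c => hammingNorm c = w), if c i = 0 then 1 else 0 := by
    intro i _
    rw [weightCount, Finset.card_eq_sum_ones, ← Finset.sum_filter]
    refine Finset.sum_congr ?_ fun _ _ => rfl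
    ext c
    simp only [mem_filter, mem_codewords, mem_shorten, mem_singleton, forall_eq]
    tauto
  rw [Finset.sum_congr rfl h1, Finset.sum_comm]
  rw [Finset.sum_congr rfl (g := fun _ => n - U.card - w), Finset.sum_const, smul_eq_mul,
    mul_comm]
  · rfl
  · intro c hc
    simp only [mem_filter, mem_codewords] at hc
    rw [Finset.sum_boole, Nat.cast_id, ← hc.2, hammingNorm]
    have h2 := Finset.card_filter_add_card_filter_not (s := Uᶜ) (fun i => c i = 0)
    rw [Finset.card_compl, Fintype.card_fin] at h2
    have h3 : (Uᶜ.filter (fun i => ¬ c i = 0)) = univ.filter (fun i => c i ≠ 0) := by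
      ext i
      simp only [mem_filter, mem_compl, mem_univ, true_and, ne_eq, and_iff_right_iff_imp]
      intro h3 h4
      exact h3 (hU c hc.1 i h4)
    rw [h3] at h2
    omega

end Shorten

/-! ### Shortened codes of minimum weight 6 and length `6 + m`, where `|U| + m = 6`. -/

/-- The words of `D` vanish on `U`, and its nonzero words have weight at least `6`. -/
structure IsShort (U : Finset (Fin 12)) (D : Submodule (ZMod 2) (QuaternaryWord 12)) : Prop where
  eq_zero : ∀ c ∈ D, ∀ i ∈ U, c i = 0
  six_le : ∀ c ∈ D, c ≠ 0 → 6 ≤ hammingNorm c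

section Short

variable {D E : Submodule (ZMod 2) (QuaternaryWord 12)} {U T : Finset (Fin 12)}

theorem IsShort.shorten (h : IsShort U D) (T : Finset (Fin 12)) :
    IsShort (U ∪ T) (shorten D T) := by
  refine ⟨fun c hc i hi => ?_, fun c hc => h.six_le c hc.1⟩
  rcases Finset.mem_union.mp hi with hi | hi
  · exact h.eq_zero c hc.1 i hi
  · exact hc.2 i hi

theorem IsShort.shorten_singleton (h : IsShort U D) (i : Fin 12) :
    IsShort (insert i U) (_root_.shorten D {i}) := by
  rw [Finset.insert_eq, Finset.union_comm]; exact h.shorten {i}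

theorem IsShort.hammingNorm_add_card_le (h : IsShort U D) {c : QuaternaryWord 12} (hc : c ∈ D) :
    hammingNorm c + U.card ≤ 12 := by
  rw [hammingNorm, ← Finset.card_union_of_disjoint]
  · simpa using Finset.card_le_univ ((univ.filter fun i => c i ≠ 0) ∪ U)
  · rw [Finset.disjoint_left]
    intro i hi hi'
    exact (Finset.mem_filter.mp hi).2 (h.eq_zero c hc i hi')

theorem IsShort.weightCount_eq_zero (h : IsShort U D) {w : ℕ}
    (hw : (0 < w ∧ w < 6) ∨ 12 < w + U.card) : weightCount D w = 0 := by
  rw [weightCount, Finset.card_eq_zero, Finset.filter_eq_empty_iff]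
  intro c hc hcw
  rw [mem_codewords] at hc
  rcases hw with hw | hw
  · have := h.six_le c hc (by rw [← hammingNorm_pos_iff]; omega)
    omega
  · have := h.hammingNorm_add_card_le hc
    omega

/-- Only the weights 0 and 6, ..., `6 + m` can occur, so the size and the sign sum are short
combinations of at most `m + 1` unknown counts. -/
theorem IsShort.sum_sign (h : IsShort U D) {m : ℕ} (hm : U.card + m = 6) (g : ℕ → ℤ) :
    ∑ c ∈ codewords D, g (hammingNorm c) =
      g 0 + ∑ j ∈ range (m + 1), g (6 + j) * weightCount D (6 + j) := by
  rw [sum_range_weightCount, Finset.sum_range_succ', add_comm, weightCount_zero,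
    Nat.cast_one, mul_one]
  congr 1
  have h1 : range 12 = range 5 ∪ (Ico 5 12) := by decide
  rw [h1, Finset.sum_union (by decide), Finset.sum_eq_zero, zero_add]
  · rw [Finset.sum_Ico_eq_sum_range]
    simp only [show 12 - 5 = 7 from rfl]
    rw [← Finset.sum_subset (s₁ := range (m + 1))]
    · refine Finset.sum_congr rfl fun j _ => ?_
      rw [show 5 + j + 1 = 6 + j by omega]
    · intro j; simp only [mem_range]; omega
    · intro j hj hj'
      simp only [mem_range] at hj hj'
      rw [h.weightCount_eq_zero (by omega), Nat.cast_zero, mul_zero]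
  · intro j hj
    rw [mem_range] at hj
    rw [h.weightCount_eq_zero (by omega), Nat.cast_zero, mul_zero]

theorem IsShort.size_eq (h : IsShort U D) {m : ℕ} (hm : U.card + m = 6) :
    size D = 1 + ∑ j ∈ range (m + 1), weightCount D (6 + j) := by
  have := h.sum_sign hm (fun _ => 1)
  simp only [sum_const, nsmul_eq_mul, mul_one, one_mul] at this
  exact_mod_cast this

theorem IsShort.signSum_eq (h : IsShort U D) {m : ℕ} (hm : U.card + m = 6) :
    signSum D = 1 + ∑ j ∈ range (m + 1), (-1 : ℤ) ^ j * weightCount D (6 + j) := by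
  have := h.sum_sign hm (fun w => (-1) ^ w)
  simp only [← sgn_eq_pow, pow_zero] at this
  rw [signSum, this]
  simp [pow_add]

theorem IsShort.sum_weightCount (h : IsShort U D) {m : ℕ} (hm : U.card + m = 6) (j : ℕ) :
    ∑ i ∈ Uᶜ, weightCount (_root_.shorten D {i}) (6 + j) = (m - j) * weightCount D (6 + j) := by
  rw [sum_weightCount_shorten h.eq_zero, show 12 - U.card - (6 + j) = m - j by omega]

end Short

/-! ### Upper bounds for the sizes of short codes. -/

section SmallCodes

variable {D E : Submodule (ZMod 2) (QuaternaryWord 12)} {U T : Finset (Fin 12)}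

theorem size_le_two_pow {n k : ℕ} {D : Submodule (ZMod 2) (QuaternaryWord n)}
    (h : size D < 2 ^ (k + 1)) : size D ≤ 2 ^ k := by
  rw [size_eq_two_pow] at *
  rw [Nat.pow_lt_pow_iff_right (by norm_num)] at h
  exact Nat.pow_le_pow_right (by norm_num) (by omega)

theorem size_le_four_mul {n : ℕ} (D : Submodule (ZMod 2) (QuaternaryWord n)) (i : Fin n) :
    size D ≤ 4 * size (shorten D {i}) := by
  obtain ⟨k, hk, h⟩ := exists_size_shorten D i
  rw [h]
  have : 2 ^ k ≤ 2 ^ 2 := Nat.pow_le_pow_right (by norm_num) hk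
  exact Nat.mul_le_mul_right _ this

theorem card_compl_add {m : ℕ} (hm : U.card + m = 6) : (Uᶜ).card = m + 6 := by
  rw [Finset.card_compl, Fintype.card_fin]; omega

theorem card_insert_add {m : ℕ} (hm : U.card + (m + 1) = 6) {i : Fin 12} (hi : i ∈ Uᶜ) :
    (insert i U).card + m = 6 := by
  rw [Finset.card_insert_of_notMem (by simpa using hi)]; omega

theorem IsShort.sum_size (h : IsShort U D) {m : ℕ} (hm : U.card + (m + 1) = 6) :
    ∑ i ∈ Uᶜ, size (_root_.shorten D {i}) =
      m + 7 + ∑ j ∈ range (m + 1), (m + 1 - j) * weightCount D (6 + j) := by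
  have h1 : ∀ i ∈ Uᶜ, size (_root_.shorten D {i}) =
      1 + ∑ j ∈ range (m + 1), weightCount (_root_.shorten D {i}) (6 + j) := fun i hi =>
    (h.shorten_singleton i).size_eq (card_insert_add hm hi)
  rw [Finset.sum_congr rfl h1, Finset.sum_add_distrib, Finset.sum_comm,
    Finset.sum_congr rfl (fun j _ => h.sum_weightCount hm j)]
  simp [card_compl_add hm]

theorem IsShort.size_eq_one (h : IsShort U D) (hU : 6 < U.card) : size D = 1 := by
  rw [size, Finset.card_eq_one]
  refine ⟨0, ?_⟩
  ext x
  simp only [mem_codewords, mem_singleton]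
  refine ⟨fun hx => ?_, fun hx => hx ▸ D.zero_mem⟩
  by_contra hx0
  have h1 := h.six_le x hx hx0
  have h2 := h.hammingNorm_add_card_le hx
  omega

theorem IsShort.size_le_four (h : IsShort U D) (hU : U.card = 6) : size D ≤ 4 := by
  have hne : (Uᶜ).Nonempty := by rw [← Finset.card_pos, card_compl_add (U := U) (m := 0) (by omega)]; omega
  obtain ⟨i, hi⟩ := hne
  have h1 := size_le_four_mul D i
  rwa [(h.shorten_singleton i).size_eq_one
    (by rw [Finset.card_insert_of_notMem (by simpa using hi)]; omega), mul_one] at h1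

/-- With 16 words every shortening would have exactly 4, and double counting would give `A₆ = 21`,
more than the 15 nonzero words. -/
theorem IsShort.size_le_eight (h : IsShort U D) (hU : U.card = 5) : size D ≤ 8 := by
  have h4 : ∀ i ∈ Uᶜ, size (_root_.shorten D {i}) ≤ 4 := fun i hi =>
    (h.shorten_singleton i).size_le_four
      (by rw [Finset.card_insert_of_notMem (by simpa using hi)]; omega)
  have hne : (Uᶜ).Nonempty := by rw [← Finset.card_pos, card_compl_add (U := U) (m := 1) (by omega)]; omega
  obtain ⟨i, hi⟩ := hne
  have h5 := size_le_four_mul D i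
  have h6 := h4 i hi
  apply size_le_two_pow (k := 3)
  by_contra! h16
  have h1 : ∑ i ∈ Uᶜ, size (_root_.shorten D {i}) = ∑ i ∈ Uᶜ, 4 := by
    refine Finset.sum_congr rfl fun i hi => le_antisymm (h4 i hi) ?_
    have := size_le_four_mul D i
    omega
  rw [h.sum_size (m := 0) (by omega)] at h1
  have h2 := h.size_eq (m := 1) (by omega)
  simp [card_compl_add (U := U) (m := 1) (by omega), Finset.sum_range_succ] at h1 h2
  omega

/-- A code of length `8` and size `32` is unique up to its weight distribution. -/
theorem IsShort.of_size_eq_32 (h : IsShort U D) (hU : U.card = 4) (hD : size D = 32) :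
    (∀ i ∈ Uᶜ, size (_root_.shorten D {i}) = 8) ∧
      weightCount D 6 = 28 ∧ weightCount D 7 = 0 ∧ weightCount D 8 = 3 := by
  have h8 : ∀ i ∈ Uᶜ, size (_root_.shorten D {i}) = 8 := fun i hi => by
    have h1 := (h.shorten_singleton i).size_le_eight
      (by rw [Finset.card_insert_of_notMem (by simpa using hi)]; omega)
    have := size_le_four_mul D i
    omega
  refine ⟨h8, ?_⟩
  have h1 := h.sum_size (m := 1) (by omega)
  rw [Finset.sum_congr rfl h8] at h1
  have h2 := h.size_eq (m := 2) (by omega)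
  have h3 := h.signSum_eq (m := 2) (by omega)
  simp [card_compl_add (U := U) (m := 2) (by omega), Finset.sum_range_succ] at h1 h2 h3
  have h4 : signSum D ≠ 0 := by omega
  have h5 := signSum_sq_of_ne_zero h4
  rw [size_eq_two_pow (rad D)] at h5
  -- The counts give `A₇ = 56 - 2 A₆` and `A₈ = A₆ - 25`, so `25 ≤ A₆ ≤ 28`. Among the resulting
  -- sign sums 20, 24, 28, 32 only 32 has a square of the form `32 * 2^k`.
  have h6 : signSum D = 4 * weightCount D 6 - 80 := by omega
  rw [h6, hD] at h5
  have h7 : weightCount D 6 ≤ 28 := by omega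
  have h8 : 25 ≤ weightCount D 6 := by omega
  generalize weightCount D 6 = a at *
  generalize Module.finrank (ZMod 2) (rad D) = k at *
  have h9 : a = 28 := by
    by_contra hne
    have hk : k ≤ 5 ∨ 6 ≤ k := by omega
    rcases hk with hk | hk
    · interval_cases a <;> interval_cases k <;> first | exact absurd rfl hne | norm_num at h5
    · have : (2 : ℤ) ^ 6 ≤ 2 ^ k := pow_le_pow_right₀ (by norm_num) hk
      push_cast at h5
      have h10 : (a : ℤ) ≤ 28 := by exact_mod_cast h7
      have h11 : (25 : ℤ) ≤ a := by exact_mod_cast h8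
      nlinarith
  omega

theorem IsShort.size_le_32 (h : IsShort U D) (hU : U.card = 4) : size D ≤ 32 := by
  have hne : (Uᶜ).Nonempty := by rw [← Finset.card_pos, card_compl_add (U := U) (m := 2) (by omega)]; omega
  obtain ⟨i, hi⟩ := hne
  have h1 := (h.shorten_singleton i).size_le_eight
    (by rw [Finset.card_insert_of_notMem (by simpa using hi)]; omega)
  have := size_le_four_mul D i
  omega

/-- With 128 words all nine shortenings would be of the type `of_size_eq_32`. This determines the
distribution and the sign sum 96, whose square is not `128 * 2^k`. -/
theorem IsShort.size_le_64 (h : IsShort U D) (hU : U.card = 3) : size D ≤ 64 := by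
  have hcard : ∀ i ∈ Uᶜ, (insert i U).card = 4 := fun i hi => by
    rw [Finset.card_insert_of_notMem (by simpa using hi)]; omega
  have hle : ∀ i ∈ Uᶜ, size (_root_.shorten D {i}) ≤ 32 := fun i hi =>
    (h.shorten_singleton i).size_le_32 (hcard i hi)
  have hne : (Uᶜ).Nonempty := by rw [← Finset.card_pos, card_compl_add (U := U) (m := 3) (by omega)]; omega
  obtain ⟨i, hi⟩ := hne
  have hi1 := hle i hi
  have hi2 := size_le_four_mul D i
  apply size_le_two_pow (k := 6)
  by_contra! h128
  have hD : size D = 128 := by omega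
  have h32 : ∀ i ∈ Uᶜ, _ := fun i hi =>
    ((h.shorten_singleton i).of_size_eq_32 (hcard i hi) (by
      have := size_le_four_mul D i
      have := hle i hi
      omega)).2
  have e6 := h.sum_weightCount (m := 3) (by omega) 0
  have e7 := h.sum_weightCount (m := 3) (by omega) 1
  have e8 := h.sum_weightCount (m := 3) (by omega) 2
  rw [Finset.sum_congr rfl (fun i hi => (h32 i hi).1)] at e6
  rw [Finset.sum_congr rfl (fun i hi => (h32 i hi).2.1)] at e7
  rw [Finset.sum_congr rfl (fun i hi => (h32 i hi).2.2)] at e8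
  have h2 := h.size_eq (m := 3) (by omega)
  have h3 := h.signSum_eq (m := 3) (by omega)
  simp [card_compl_add (U := U) (m := 3) (by omega), Finset.sum_range_succ] at e6 e7 e8 h2 h3
  have h4 : signSum D = 96 := by omega
  have h5 := signSum_sq_of_ne_zero (D := D) (by omega)
  rw [size_eq_two_pow (rad D), hD, h4] at h5
  generalize Module.finrank (ZMod 2) (rad D) = k at *
  have hk : k ≤ 6 ∨ 7 ≤ k := by omega
  rcases hk with hk | hk
  · interval_cases k <;> simp at h5
  · have : (2 : ℤ) ^ 7 ≤ 2 ^ k := pow_le_pow_right₀ (by norm_num) hk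
    push_cast at h5
    omega

/-- The coordinates at which shortening does not divide the size `4 ^ m` by `4`. -/
noncomputable def deficient (D : Submodule (ZMod 2) (QuaternaryWord 12))
    (U : Finset (Fin 12)) : Finset (Fin 12) :=
  Uᶜ.filter (fun i => size D ≠ 4 * size (shorten D {i}))

/-- Codes of length `8` and size `16`. -/
theorem IsShort.of_size_eq_16 (h : IsShort U D) (hU : U.card = 4) (hD : size D = 16) :
    ∃ f : ℤ, HasLevel D 2 f ∧ (f = 1 ∨ f = 2 ∨ f = 4) ∧
      (weightCount D 6 : ℤ) = f + 8 + 2 * (deficient D U).card ∧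
      (weightCount D 7 : ℤ) = 8 - 2 * f ∧
      (weightCount D 8 : ℤ) = f - 1 - 2 * (deficient D U).card ∧
      ((deficient D U).card = 0 ∨ (deficient D U).card = 1 ∧ f = 4) ∧
      ∀ i ∈ deficient D U, size (_root_.shorten D {i}) = 8 := by
  have h48 : ∀ i ∈ Uᶜ, size (_root_.shorten D {i}) = 4 ∨ size (_root_.shorten D {i}) = 8 := by
    intro i hi
    have h1 := (h.shorten_singleton i).size_le_eight
      (by rw [Finset.card_insert_of_notMem (by simpa using hi)]; omega)
    obtain ⟨k, hk, h2⟩ := exists_size_shorten D i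
    rw [hD] at h2
    interval_cases k <;> omega
  have hs : ∀ i ∈ Uᶜ, size (_root_.shorten D {i}) =
      4 + 4 * (if size D ≠ 4 * size (_root_.shorten D {i}) then 1 else 0) := by
    intro i hi
    rcases h48 i hi with h1 | h1 <;> simp [h1, hD]
  have h1 := h.sum_size (m := 1) (by omega)
  rw [Finset.sum_congr rfl hs, Finset.sum_add_distrib, ← Finset.mul_sum, Finset.sum_boole] at h1
  change _ + 4 * (((deficient D U).card : ℕ) : ℕ) = _ at h1
  have h2 := h.size_eq (m := 2) (by omega)
  have h3 := h.signSum_eq (m := 2) (by omega)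
  simp [card_compl_add (U := U) (m := 2) (by omega), Finset.sum_range_succ] at h1 h2 h3
  set b := (deficient D U).card
  -- With `b` deficient coordinates, `A₇ = 8 - 2f` and `A₈ = f - 1 - 2b` must be nonnegative. Hence
  -- `1 + 2b ≤ f ≤ 4`, and `f` is a power of two.
  have hlev : HasLevel D 2 (weightCount D 6 - 8 - 2 * b) := ⟨by rw [hD]; rfl, by omega⟩
  refine ⟨_, hlev, ?_⟩
  have hf0 : (weightCount D 6 : ℤ) - 8 - 2 * b ≠ 0 := by omega
  obtain ⟨e, he, hfe⟩ := hlev.natAbs_eq hf0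
  refine ⟨?_, by omega, by omega, by omega, ?_, ?_⟩
  · interval_cases e <;> omega
  · interval_cases e <;> omega
  · intro i hi
    have h5 := Finset.mem_filter.mp hi
    rcases h48 i h5.1 with h6 | h6
    · exact absurd (by rw [h6, hD]) h5.2
    · exact h6

end SmallCodes

/-! ### Any five coordinates are independent. -/

section Independence

variable {D E C : Submodule (ZMod 2) (QuaternaryWord 12)} {U T : Finset (Fin 12)}

theorem shorten_comm {n : ℕ} (E : Submodule (ZMod 2) (QuaternaryWord n)) (i j : Fin n) :
    shorten (shorten E {i}) {j} = shorten (shorten E {j}) {i} := by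
  rw [shorten_shorten, shorten_shorten, Finset.union_comm]

theorem isEven_of_signSum_eq {n : ℕ} {D : Submodule (ZMod 2) (QuaternaryWord n)}
    (h : signSum D = size D) : IsEven D := by
  intro x hx
  have h1 : ∑ c ∈ codewords D, sgn c = ∑ c ∈ codewords D, 1 := by
    rw [← signSum, h]; simp [size]
  refine (Finset.sum_eq_sum_iff_of_le (fun c _ => ?_)).mp h1 x (mem_codewords.mpr hx)
  rcases sgn_eq_or c with h | h <;> simp [h]

theorem sup_eq_of_size {n : ℕ} {A B E : Submodule (ZMod 2) (QuaternaryWord n)} (hA : A ≤ E)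
    (hB : B ≤ E) (h : size E * size (A ⊓ B) = size A * size B) : A ⊔ B = E := by
  refine eq_of_le_of_size_le (sup_le hA hB) ?_
  rw [← size_sup_mul_inf A B] at h
  exact (Nat.eq_of_mul_eq_mul_right (size_pos _) h).le

/-- A coordinate with a shortening of size 32 is deficient for every shortening of size 16, and
those have at most one deficient coordinate. So all nine coordinates are of this kind, or exactly
one. Then `3 A₆` would be `9 * 28`, which gives more than 63 words, or `28 + 8 * 14 = 140`, which is
not divisible by 3. -/
theorem IsShort.size_shorten_of_64 (h : IsShort U E) (hU : U.card = 3) (hE : size E = 64) :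
    ∀ i ∈ Uᶜ, size (_root_.shorten E {i}) = 16 := by
  have hUc : (Uᶜ).card = 9 := card_compl_add (U := U) (m := 3) (by omega)
  have hcard : ∀ i ∈ Uᶜ, (insert i U).card = 4 := fun i hi => by
    rw [Finset.card_insert_of_notMem (by simpa using hi)]; omega
  have hsz : ∀ i ∈ Uᶜ, size (_root_.shorten E {i}) = 16 ∨ size (_root_.shorten E {i}) = 32 := by
    intro i hi
    have h1 := (h.shorten_singleton i).size_le_32 (hcard i hi)
    obtain ⟨k, hk, h2⟩ := exists_size_shorten E i
    rw [hE] at h2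
    interval_cases k <;> omega
  have h6 := h.sum_weightCount (m := 3) (by omega) 0
  have hs := h.size_eq (m := 3) (by omega)
  simp only [Finset.sum_range_succ, Finset.sum_range_zero] at hs h6
  by_contra! hne
  obtain ⟨i, hi, hi16⟩ := hne
  have hi32 := (hsz i hi).resolve_left hi16
  have hd : ∀ j ∈ Uᶜ, size (_root_.shorten E {j}) = 16 → ∀ k ∈ Uᶜ,
      size (_root_.shorten E {k}) = 32 → k ∈ deficient (_root_.shorten E {j}) (insert j U) := by
    intro j hj hj16 k hk hk32
    have hkj : k ≠ j := by rintro rfl; omega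
    rw [deficient, Finset.mem_filter, shorten_comm, hj16,
      ((h.shorten_singleton k).of_size_eq_32 (hcard k hk) hk32).1 j (by
        simp only [mem_compl, mem_insert, not_or] at hj ⊢; exact ⟨hkj.symm, hj⟩)]
    simp only [mem_compl, mem_insert, not_or] at hk ⊢
    exact ⟨⟨hkj, hk⟩, by norm_num⟩
  by_cases hall : ∀ j ∈ Uᶜ, size (_root_.shorten E {j}) = 32
  · rw [Finset.sum_congr rfl (fun j hj =>
      ((h.shorten_singleton j).of_size_eq_32 (hcard j hj) (hall j hj)).2.1)] at h6
    simp only [sum_const, smul_eq_mul, hUc] at h6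
    omega
  · push Not at hall
    obtain ⟨j, hj, hj32⟩ := hall
    have hj16 := (hsz j hj).resolve_right hj32
    obtain ⟨_, _, _, _, _, _, hdc, _⟩ :=
      (h.shorten_singleton j).of_size_eq_16 (hcard j hj) hj16
    have huniq : ∀ k ∈ Uᶜ, k ≠ i → size (_root_.shorten E {k}) = 16 := by
      intro k hk hki
      by_contra hk16
      have h1 := hd j hj hj16 i hi hi32
      have h2 := hd j hj hj16 k hk ((hsz k hk).resolve_left hk16)
      have h3 : 1 < (deficient (_root_.shorten E {j}) (insert j U)).card :=
        Finset.one_lt_card.mpr ⟨k, h2, i, h1, hki⟩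
      omega
    have h14 : ∀ k ∈ Uᶜ.erase i, weightCount (_root_.shorten E {k}) (6 + 0) = 14 := by
      intro k hk
      obtain ⟨hki, hk⟩ := Finset.mem_erase.mp hk
      have hk16 := huniq k hk hki
      obtain ⟨f, _, _, h1, _, _, h2, _⟩ :=
        (h.shorten_singleton k).of_size_eq_16 (hcard k hk) hk16
      have h3 : 0 < (deficient (_root_.shorten E {k}) (insert k U)).card :=
        Finset.card_pos.mpr ⟨i, hd k hk hk16 i hi hi32⟩
      rw [add_zero]
      omega
    rw [← Finset.add_sum_erase _ _ hi, Finset.sum_congr rfl h14,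
      ((h.shorten_singleton i).of_size_eq_32 (hcard i hi) hi32).2.1] at h6
    simp only [sum_const, smul_eq_mul, Finset.card_erase_of_mem hi, hUc] at h6
    omega

-- Deficiency is a symmetric relation in which a coordinate has at most one partner, and matched
-- coordinates have level 4. If `β` counts the matched coordinates, the levels `f i` add up to `12 +
-- 3 f₃ + β`, where `f₃` is the level of `E`. A matched pair gives `β ≥ 2`, and this contradicts
-- each of the values 1, 2, 4, 8 left for `f₃`.
set_option maxHeartbeats 1000000 in
theorem IsShort.deficient_eq_empty (h : IsShort U E) (hU : U.card = 3) (hE : size E = 64) :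
    ∀ i ∈ Uᶜ, deficient (_root_.shorten E {i}) (insert i U) = ∅ := by
  have hUc : (Uᶜ).card = 9 := card_compl_add (U := U) (m := 3) (by omega)
  have hcard : ∀ i ∈ Uᶜ, (insert i U).card = 4 := fun i hi => by
    rw [Finset.card_insert_of_notMem (by simpa using hi)]; omega
  have h16 := h.size_shorten_of_64 hU hE
  have hex : ∀ i, ∃ f : ℤ, i ∈ Uᶜ → _ := fun i => by
    by_cases hi : i ∈ Uᶜ
    · obtain ⟨f, hf⟩ := (h.shorten_singleton i).of_size_eq_16 (hcard i hi) (h16 i hi)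
      exact ⟨f, fun _ => hf⟩
    · exact ⟨0, fun hi' => absurd hi' hi⟩
  choose f hf' using hex
  obtain ⟨Δ, hΔ⟩ : ∃ Δ : Fin 12 → Finset (Fin 12),
    ∀ i, Δ i = deficient (_root_.shorten E {i}) (insert i U) := ⟨_, fun _ => rfl⟩
  have hf : ∀ i ∈ Uᶜ, HasLevel (_root_.shorten E {i}) 2 (f i) ∧ (f i = 1 ∨ f i = 2 ∨ f i = 4) ∧
      (weightCount (_root_.shorten E {i}) 6 : ℤ) = f i + 8 + 2 * (Δ i).card ∧
      (weightCount (_root_.shorten E {i}) 7 : ℤ) = 8 - 2 * f i ∧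
      (weightCount (_root_.shorten E {i}) 8 : ℤ) = f i - 1 - 2 * (Δ i).card ∧
      ((Δ i).card = 0 ∨ (Δ i).card = 1 ∧ f i = 4) := by
    intro i hi
    rw [hΔ]
    obtain ⟨h1, h2, h3, h4, h5, h6, _⟩ := hf' i hi
    exact ⟨h1, h2, h3, h4, h5, h6⟩
  clear hf'
  have hΔmem : ∀ i ∈ Uᶜ, ∀ j ∈ Uᶜ, j ≠ i →
      (j ∈ Δ i ↔ size (_root_.shorten (_root_.shorten E {i}) {j}) ≠ 4) := by
    intro i hi j hj hji
    rw [hΔ]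
    simp only [deficient, Finset.mem_filter, h16 i hi, mem_compl, mem_insert, not_or] at hj ⊢
    constructor
    · rintro ⟨_, h2⟩ h3; omega
    · exact fun h3 => ⟨⟨hji, hj⟩, by omega⟩
  have hΔsymm : ∀ i ∈ Uᶜ, ∀ j ∈ Uᶜ, j ≠ i → j ∈ Δ i → i ∈ Δ j := by
    intro i hi j hj hji h1
    rw [hΔmem j hj i hi hji.symm, shorten_comm]
    exact (hΔmem i hi j hj hji).mp h1
  have hΔsub : ∀ i ∈ Uᶜ, ∀ j ∈ Δ i, j ∈ Uᶜ ∧ j ≠ i := by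
    intro i hi j hj
    rw [hΔ] at hj
    have := (Finset.mem_filter.mp hj).1
    simp only [mem_compl, mem_insert, not_or] at this ⊢
    exact ⟨this.2, this.1⟩
  have hΔuniq : ∀ i ∈ Uᶜ, ∀ j ∈ Δ i, ∀ k ∈ Δ i, j = k := by
    intro i hi j hj k hk
    by_contra hjk
    have : 1 < (Δ i).card := Finset.one_lt_card.mpr ⟨j, hj, k, hk, hjk⟩
    have := (hf i hi).2.2.2.2.2
    omega
  by_contra! hne
  obtain ⟨i₀, hi₀, hne⟩ := hne
  obtain ⟨j₀, hj₀⟩ := hne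
  rw [← hΔ] at hj₀
  obtain ⟨hj₀U, hji₀⟩ := hΔsub i₀ hi₀ j₀ hj₀
  have hi₀' := hΔsymm i₀ hi₀ j₀ hj₀U hji₀ hj₀
  have hf4 : ∀ i ∈ Uᶜ, (Δ i).Nonempty → f i = 4 ∧ (Δ i).card = 1 := by
    intro i hi h1
    have h2 := Finset.card_pos.mpr h1
    have := (hf i hi).2.2.2.2.2
    omega
  set Φ := ∑ i ∈ Uᶜ, f i with hΦ
  set β := ∑ i ∈ Uᶜ, ((Δ i).card : ℤ) with hβ
  have e6 : Φ + 72 + 2 * β = 3 * weightCount E 6 := by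
    have h1 := congrArg (fun a : ℕ => (a : ℤ)) (h.sum_weightCount (m := 3) (by omega) 0)
    simp only [Nat.cast_sum] at h1
    rw [Finset.sum_congr rfl (fun i hi => (hf i hi).2.2.1), Finset.sum_add_distrib,
      Finset.sum_add_distrib, ← Finset.mul_sum] at h1
    simp only [sum_const, hUc, nsmul_eq_mul] at h1
    push_cast at h1
    rw [hΦ, hβ]
    linarith
  have e7 : 72 - 2 * Φ = 2 * weightCount E 7 := by
    have h1 := congrArg (fun a : ℕ => (a : ℤ)) (h.sum_weightCount (m := 3) (by omega) 1)
    simp only [Nat.cast_sum] at h1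
    rw [Finset.sum_congr rfl (fun i hi => (hf i hi).2.2.2.1), Finset.sum_sub_distrib,
      ← Finset.mul_sum] at h1
    simp only [sum_const, hUc, nsmul_eq_mul] at h1
    push_cast at h1
    rw [hΦ]
    linarith
  have e8 : Φ - 9 - 2 * β = weightCount E 8 := by
    have h1 := congrArg (fun a : ℕ => (a : ℤ)) (h.sum_weightCount (m := 3) (by omega) 2)
    simp only [Nat.cast_sum] at h1
    rw [Finset.sum_congr rfl (fun i hi => (hf i hi).2.2.2.2.1), Finset.sum_sub_distrib,
      Finset.sum_sub_distrib, ← Finset.mul_sum] at h1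
    simp only [sum_const, hUc, nsmul_eq_mul] at h1
    push_cast at h1
    rw [hΦ, hβ]
    linarith
  have hs := h.size_eq (m := 3) (by omega)
  have hF := h.signSum_eq (m := 3) (by omega)
  simp only [Finset.sum_range_succ, Finset.sum_range_zero] at hs hF
  norm_num at hs hF
  obtain ⟨f₃, hf₃⟩ : ∃ f₃ : ℤ, f₃ = weightCount E 6 - 28 - β := ⟨_, rfl⟩
  have hΦ3 : Φ = 12 + 3 * f₃ + β := by omega
  have hlev : HasLevel E (2 + 1) f₃ := ⟨by rw [hE]; rfl, by omega⟩
  have hlevi : ∀ i ∈ Uᶜ, HasLevel (_root_.shorten E {i}) 2 (f i) := fun i hi => (hf i hi).1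
  have hfi : ∀ i ∈ Uᶜ, f i = 1 ∨ f i = 2 ∨ f i = 4 := fun i hi => (hf i hi).2.1
  have hlow : ∀ i ∈ Uᶜ, 1 + 3 * ((Δ i).card : ℤ) ≤ f i := by
    intro i hi
    have := hfi i hi
    by_cases h1 : (Δ i).Nonempty
    · have := hf4 i hi h1; omega
    · rw [Finset.not_nonempty_iff_eq_empty.mp h1, Finset.card_empty]; omega
  have hΦβ : 9 + 3 * β ≤ Φ := by
    have h1 := Finset.sum_le_sum hlow
    rw [Finset.sum_add_distrib, ← Finset.mul_sum] at h1
    simp only [sum_const, hUc] at h1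
    simpa using h1
  have hΦ36 : Φ ≤ 36 := by
    have h1 : Φ ≤ ∑ i ∈ Uᶜ, 4 := Finset.sum_le_sum fun i hi => by
      have := hfi i hi; omega
    rw [Finset.sum_const, hUc] at h1
    simpa using h1
  have hcard1 : ∀ i ∈ Uᶜ, (Δ i).Nonempty → (1 : ℤ) = (Δ i).card := fun i hi h1 => by
    rw [(hf4 i hi h1).2]; rfl
  have hβsub : ∀ S ⊆ Uᶜ, (∀ i ∈ S, (Δ i).Nonempty) → (S.card : ℤ) ≤ β := by
    intro S hS hS'
    calc (S.card : ℤ) = ∑ i ∈ S, (1 : ℤ) := by simp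
      _ = ∑ i ∈ S, ((Δ i).card : ℤ) :=
        Finset.sum_congr rfl fun i hi => hcard1 i (hS hi) (hS' i hi)
      _ ≤ β := Finset.sum_le_sum_of_subset_of_nonneg hS fun i _ _ => Int.natCast_nonneg _
  have hpair : ({i₀, j₀} : Finset (Fin 12)) ⊆ Uᶜ := by
    intro x hx
    rcases Finset.mem_insert.mp hx with rfl | hx
    · exact hi₀
    · rw [Finset.mem_singleton.mp hx]; exact hj₀U
  have hβ2 : 2 ≤ β := by
    have := hβsub {i₀, j₀} hpair (by
      intro x hx
      rcases Finset.mem_insert.mp hx with rfl | hx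
      · exact ⟨_, hj₀⟩
      · rw [Finset.mem_singleton.mp hx]; exact ⟨_, hi₀'⟩)
    rw [Finset.card_pair hji₀.symm] at this
    exact_mod_cast this
  have hfi₀ := (hf4 i₀ hi₀ ⟨_, hj₀⟩).1
  have hfj₀ := (hf4 j₀ hj₀U ⟨_, hi₀'⟩).1
  have hf3 : f₃ = 1 ∨ f₃ = 2 ∨ f₃ = 4 ∨ f₃ = 8 := by
    obtain ⟨b, hb, h1⟩ := hlev.natAbs_eq (by omega)
    interval_cases b <;> omega
  have hf0 : ∀ i ∈ Uᶜ, f i ≠ 0 := fun i hi => by have := hfi i hi; omega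
  rcases hf3 with h1 | h1 | h1 | h1
  · have := (HasLevel.abs_le shorten_le hlev (hlevi i₀ hi₀) (by omega) (hf0 i₀ hi₀)).1
    rw [hfi₀, h1] at this
    norm_num at this
  -- For `f₃ = 2` the radical has four words and vanishes at both matched coordinates. Its three
  -- nonzero words are even, hence of weight 6 on the seven remaining coordinates, so the sizes of
  -- its shortenings there add up to 10. These sizes bound the levels, so `Φ ≤ 18`, whereas `Φ = 18
  -- + β`.
  · have hR : IsShort (U ∪ {i₀, j₀}) (rad E) := by
      refine ⟨fun c hc i hi => ?_, fun c hc => h.six_le c (rad_le hc)⟩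
      have hr : ∀ i ∈ Uᶜ, f i = 4 → c i = 0 := fun i hi hi4 =>
        (HasLevel.rad_le_of_two_mul_le shorten_le hlev (hlevi i hi) (by omega) (hf0 i hi)
          (by rw [hi4, h1]; norm_num) hc).2 i (Finset.mem_singleton_self i)
      rcases Finset.mem_union.mp hi with hi | hi
      · exact h.eq_zero c (rad_le hc) i hi
      · rcases Finset.mem_insert.mp hi with rfl | hi
        · exact hr _ hi₀ hfi₀
        · rw [Finset.mem_singleton.mp hi]; exact hr _ hj₀U hfj₀
    have hUd : Disjoint U {i₀, j₀} := by
      rw [Finset.disjoint_right]; intro x hx; simpa using hpair hx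
    have hcU : (U ∪ {i₀, j₀}).card = 5 := by
      rw [Finset.card_union_of_disjoint hUd, Finset.card_pair hji₀.symm]; omega
    have hRs := hR.size_eq (m := 1) (by omega)
    have hRf := hR.signSum_eq (m := 1) (by omega)
    have hRsum := hR.sum_size (m := 0) (by omega)
    have hReven := (hlev.isEven_rad (by omega)).signSum_eq
    have hRsz := hlev.sq_eq (by omega)
    simp [Finset.sum_range_succ] at hRs hRf hRsum
    have hk : ∀ k ∈ Uᶜ, f k ≤ size (_root_.shorten (rad E) {k}) := by
      intro k hk
      have h2 := (HasLevel.step shorten_le hlev (hlevi k hk) (by omega) (hf0 k hk)).1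
      rw [inf_shorten rad_le, h1] at h2
      have := le_abs_self (2 * f k)
      omega
    have h3 : ∑ k ∈ (U ∪ {i₀, j₀})ᶜ, f k ≤
        ∑ k ∈ (U ∪ {i₀, j₀})ᶜ, (size (_root_.shorten (rad E) {k}) : ℤ) := by
      refine Finset.sum_le_sum fun k hk' => hk k ?_
      simp only [mem_compl, mem_union, not_or] at hk' ⊢; exact hk'.1
    have h4 : Φ = ∑ k ∈ (U ∪ {i₀, j₀})ᶜ, f k + 8 := by
      rw [hΦ, ← Finset.sum_sdiff hpair, Finset.sum_pair hji₀.symm, hfi₀, hfj₀]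
      congr 2
      ext x; simp; tauto
    have h5 : ∑ k ∈ (U ∪ {i₀, j₀})ᶜ, (size (_root_.shorten (rad E) {k}) : ℤ) =
        7 + weightCount (rad E) 6 := by
      have := congrArg (fun a : ℕ => (a : ℤ)) hRsum
      push_cast at this
      rw [← this]
      refine Finset.sum_congr ?_ fun _ _ => rfl
      ext x; simp
    rw [h1] at hRsz
    norm_num at hRsz
    omega
  -- For `f₃ = 4` all levels are 2 or 4, and at least four are 4. Level 4 means that the shortening
  -- is even, and unmatched shortenings span `E`. Three pairwise unmatched coordinates of level 4
  -- then contradict `card_even_cover`, since 128 exceeds 96.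
  · set S := Uᶜ.filter (fun i => f i = 4) with hS
    have hval : ∀ i ∈ Uᶜ, f i = 2 + 2 * (if f i = 4 then 1 else 0) := by
      intro i hi
      have h2 := (HasLevel.abs_le shorten_le hlev (hlevi i hi) (by omega) (hf0 i hi)).2
      rw [h1] at h2
      rcases hfi i hi with h3 | h3 | h3 <;> rw [h3] at h2 ⊢ <;>
        first | (norm_num at h2; done) | norm_num
    have hSc : 2 * (S.card : ℤ) = 6 + β := by
      have h2 : Φ = ∑ i ∈ Uᶜ, (2 + 2 * (if f i = 4 then (1 : ℤ) else 0)) :=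
        Finset.sum_congr rfl hval
      rw [Finset.sum_add_distrib, ← Finset.mul_sum, Finset.sum_boole, ← hS] at h2
      simp only [sum_const, hUc] at h2
      simp at h2
      omega
    have hSU : ∀ i ∈ S, i ∈ Uᶜ := fun i hi => (Finset.mem_filter.mp hi).1
    have herase : ∀ (A B : Finset (Fin 12)), A.card - B.card ≤ (A \ B).card := fun A B =>
      Finset.le_card_sdiff B A
    obtain ⟨k, hk⟩ : (S \ {i₀, j₀}).Nonempty := by
      rw [← Finset.card_pos]
      have := herase S {i₀, j₀}
      rw [Finset.card_pair hji₀.symm] at this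
      omega
    simp only [mem_sdiff, mem_insert, mem_singleton, not_or] at hk
    obtain ⟨hkS, hki, hkj⟩ := hk
    have hkU := hSU k hkS
    -- If `k` is matched too, then `β ≥ 3` and `S` has at least five elements, which leaves room to
    -- avoid the partner of `k` as well.
    obtain ⟨l, hlS, hli, hlj, hlk, hlΔ⟩ :
        ∃ l ∈ S, l ≠ i₀ ∧ l ≠ j₀ ∧ l ≠ k ∧ l ∉ Δ k := by
      by_cases hkΔ : (Δ k).Nonempty
      · have hβ3 := hβsub {i₀, j₀, k} (by
          intro x hx
          simp only [mem_insert, mem_singleton] at hx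
          rcases hx with rfl | rfl | rfl <;> assumption) (by
          intro x hx
          simp only [mem_insert, mem_singleton] at hx
          rcases hx with rfl | rfl | rfl
          · exact ⟨_, hj₀⟩
          · exact ⟨_, hi₀'⟩
          · exact hkΔ)
        have hc3 : ({i₀, j₀, k} : Finset (Fin 12)).card = 3 :=
          Finset.card_eq_three.mpr ⟨_, _, _, hji₀.symm, Ne.symm hki, Ne.symm hkj, rfl⟩
        have h2 := herase S ({i₀, j₀, k} ∪ Δ k)
        have h3 := Finset.card_union_le ({i₀, j₀, k} : Finset (Fin 12)) (Δ k)
        have h4 := (hf4 k hkU hkΔ).2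
        obtain ⟨l, hl⟩ : (S \ ({i₀, j₀, k} ∪ Δ k)).Nonempty := by
          rw [← Finset.card_pos]; omega
        simp only [mem_sdiff, mem_union, mem_insert, mem_singleton, not_or] at hl
        exact ⟨l, hl.1, hl.2.1.1, hl.2.1.2.1, hl.2.1.2.2, hl.2.2⟩
      · have h2 := herase S {i₀, j₀, k}
        have hc3 : ({i₀, j₀, k} : Finset (Fin 12)).card = 3 :=
          Finset.card_eq_three.mpr ⟨_, _, _, hji₀.symm, Ne.symm hki, Ne.symm hkj, rfl⟩
        obtain ⟨l, hl⟩ : (S \ {i₀, j₀, k}).Nonempty := by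
          rw [← Finset.card_pos]; omega
        simp only [mem_sdiff, mem_insert, mem_singleton, not_or] at hl
        refine ⟨l, hl.1, hl.2.1, hl.2.2.1, hl.2.2.2, ?_⟩
        rw [Finset.not_nonempty_iff_eq_empty.mp hkΔ]; simp
    have hlU := hSU l hlS
    have hkΔ₀ : k ∉ Δ i₀ := fun h2 => hkj (hΔuniq i₀ hi₀ k h2 j₀ hj₀)
    have hlΔ₀ : l ∉ Δ i₀ := fun h2 => hlj (hΔuniq i₀ hi₀ l h2 j₀ hj₀)
    have hsup : ∀ a ∈ Uᶜ, ∀ b ∈ Uᶜ, b ≠ a → b ∉ Δ a →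
        _root_.shorten E {a} ⊔ _root_.shorten E {b} = E := by
      intro a ha b hb hba hab
      rw [hΔmem a ha b hb hba, not_not, shorten_shorten] at hab
      refine sup_eq_of_size shorten_le shorten_le ?_
      rw [shorten_inf_shorten, hab, h16 a ha, h16 b hb, hE]
    have hc3 : ({i₀, k, l} : Finset (Fin 12)).card = 3 :=
      Finset.card_eq_three.mpr ⟨_, _, _, Ne.symm hki, Ne.symm hli, Ne.symm hlk, rfl⟩
    have hcov := card_even_cover (E := E) {i₀, k, l} (fun a => _root_.shorten E {a})
      (by omega) (by
        intro a ha
        have ha' : a ∈ Uᶜ ∧ f a = 4 := by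
          simp only [mem_insert, mem_singleton] at ha
          rcases ha with rfl | rfl | rfl
          · exact ⟨hi₀, hfi₀⟩
          · exact Finset.mem_filter.mp hkS
          · exact Finset.mem_filter.mp hlS
        refine ⟨isEven_of_signSum_eq ?_, shorten_le⟩
        rw [(hlevi a ha'.1).signSum_eq, h16 a ha'.1, ha'.2]; norm_num) (by
        have s1 := hsup i₀ hi₀ k hkU hki hkΔ₀
        have s2 := hsup i₀ hi₀ l hlU hli hlΔ₀
        have s3 := hsup k hkU l hlU hlk hlΔ
        intro a ha b hb hab
        simp only [mem_insert, mem_singleton] at ha hb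
        rcases ha with rfl | rfl | rfl <;> rcases hb with rfl | rfl | rfl <;>
          first
            | exact absurd rfl hab
            | assumption
            | (rw [sup_comm]; assumption)) (by rw [hlev.signSum_eq, h1]; norm_num)
    rw [hc3, hlev.signSum_eq, hE, ← hlev.sq_eq (by omega), h1] at hcov
    norm_num at hcov
  -- Level 8 would give `Φ = 36 + β`, but nine levels of at most 4 add up to at most 36.
  · omega

theorem size_le_pow_mul {n : ℕ} (D : Submodule (ZMod 2) (QuaternaryWord n)) (S : Finset (Fin n)) :
    size D ≤ 4 ^ S.card * size (shorten D S) := by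
  classical
  induction S using Finset.induction_on with
  | empty => simp [shorten_empty]
  | insert i S hi ih =>
    rw [Finset.card_insert_of_notMem hi, shorten_insert, pow_succ, mul_assoc]
    exact ih.trans (Nat.mul_le_mul_left _ (size_le_four_mul _ i))

/-- An additive `[12, 6]` code whose nonzero words have weight at least `6`. -/
structure IsFullCode (C : Submodule (ZMod 2) (QuaternaryWord 12)) : Prop where
  size_eq : size C = 4 ^ 6
  six_le : ∀ c ∈ C, c ≠ 0 → 6 ≤ hammingNorm c

theorem IsFullCode.isShort (h : IsFullCode C) (U : Finset (Fin 12)) : IsShort U (shorten C U) :=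
  ⟨fun _ hc => hc.2, fun c hc => h.six_le c hc.1⟩

theorem IsFullCode.size_shorten_three (h : IsFullCode C) (hU : U.card = 3) :
    size (shorten C U) = 64 := by
  have h1 := (h.isShort U).size_le_64 hU
  have h2 := size_le_pow_mul C U
  rw [hU, h.size_eq] at h2
  omega

/-- Any five coordinates of the code are independent. -/
theorem IsFullCode.size_shorten (h : IsFullCode C) {m : ℕ} (hm : U.card + m = 6) (h1 : 1 ≤ m) :
    size (shorten C U) = 4 ^ m := by
  rcases le_or_gt U.card 3 with h3 | h3
  -- For at most three coordinates, `C` has the largest possible size at `T`, so every intermediate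
  -- shortening divides the size by exactly 4 per coordinate.
  · obtain ⟨T, hUT, hT⟩ := Finset.exists_superset_card_eq h3 (by simp)
    have h4 := size_le_pow_mul (shorten C U) (T \ U)
    rw [shorten_shorten, Finset.union_sdiff_of_subset hUT, h.size_shorten_three hT,
      Finset.card_sdiff_of_subset hUT, hT] at h4
    have h5 := size_le_pow_mul C U
    rw [h.size_eq] at h5
    obtain rfl : m = 6 - U.card := by omega
    generalize U.card = u at *
    interval_cases u <;> norm_num at h4 h5 ⊢ <;> omega
  · rcases (by omega : U.card = 4 ∨ U.card = 5) with h4 | h4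
    · obtain rfl : m = 2 := by omega
      obtain ⟨i, V, hi, rfl, hV⟩ := Finset.card_eq_succ.mp h4
      rw [shorten_insert]
      exact (h.isShort V).size_shorten_of_64 hV (h.size_shorten_three hV) i (by simpa using hi)
    · obtain rfl : m = 1 := by omega
      obtain ⟨j, W, hj, rfl, hW⟩ := Finset.card_eq_succ.mp h4
      obtain ⟨i, V, hi, rfl, hV⟩ := Finset.card_eq_succ.mp hW
      have h5 := (h.isShort V).size_shorten_of_64 hV (h.size_shorten_three hV) i (by simpa using hi)
      have h6 := (h.isShort V).deficient_eq_empty hV (h.size_shorten_three hV) i (by simpa using hi)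
      rw [deficient, Finset.filter_eq_empty_iff] at h6
      have h7 := h6 (x := j) (by simpa using hj)
      rw [shorten_insert, shorten_insert]
      rw [h5] at h7
      omega

end Independence

/-! ### Weight distributions in terms of the level. -/

/-- The sign sum of the subcode vanishing on `U`, divided by `2 ^ (6 - |U|)`. -/
noncomputable def level (C : Submodule (ZMod 2) (QuaternaryWord 12)) (U : Finset (Fin 12)) : ℤ :=
  signSum (shorten C U) / 2 ^ (6 - U.card)

section Distributions

variable {C : Submodule (ZMod 2) (QuaternaryWord 12)} {U : Finset (Fin 12)}

/-- The inductive step for the distributions: double counting carries an affine dependence on the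
level from `U ∪ {i}` to `U`. -/
theorem IsFullCode.sum_affine (h : IsFullCode C) {m : ℕ} (hm : U.card + m = 6) (j : ℕ) (a b : ℤ)
    (H : ∀ i ∈ Uᶜ, (weightCount (shorten C (insert i U)) (6 + j) : ℤ) =
      a + b * level C (insert i U)) :
    (m + 6) * a + b * ∑ i ∈ Uᶜ, level C (insert i U) =
      (m - j : ℕ) * weightCount (shorten C U) (6 + j) := by
  have h1 := congrArg (fun a : ℕ => (a : ℤ)) ((h.isShort U).sum_weightCount hm j)
  simp only [Nat.cast_sum, ← shorten_insert] at h1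
  rw [Finset.sum_congr rfl H, Finset.sum_add_distrib, ← Finset.mul_sum, Finset.sum_const,
    card_compl_add hm] at h1
  push_cast at h1
  rw [← h1]
  simp

theorem hasLevel_of_signSum_eq {m : ℕ} (hm : U.card + m = 6)
    (hs : size (shorten C U) = 4 ^ m) {f : ℤ} (hf : signSum (shorten C U) = 2 ^ m * f) :
    HasLevel (shorten C U) m (level C U) ∧ level C U = f := by
  have h1 : level C U = f := by
    rw [level, hf, show 6 - U.card = m by omega, Int.mul_ediv_cancel_left _ (by positivity)]
  exact ⟨⟨hs, by rw [h1, hf]⟩, h1⟩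

theorem IsFullCode.distribution_two (h : IsFullCode C) (hU : U.card = 4) :
    HasLevel (shorten C U) 2 (level C U) ∧
      (level C U = 1 ∨ level C U = 2 ∨ level C U = 4) ∧
      (weightCount (shorten C U) 6 : ℤ) = 8 + 1 * level C U ∧
      (weightCount (shorten C U) 7 : ℤ) = 8 + (-2) * level C U ∧
      (weightCount (shorten C U) 8 : ℤ) = -1 + 1 * level C U := by
  have h16 := h.size_shorten (U := U) (m := 2) (by omega) (by norm_num)
  obtain ⟨f, hf, hf', h6, h7, h8, -, h9⟩ := (h.isShort U).of_size_eq_16 hU (by rw [h16]; rfl)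
  have hd : deficient (shorten C U) U = ∅ := by
    by_contra hne
    obtain ⟨i, hi⟩ := Finset.nonempty_iff_ne_empty.mpr hne
    have h10 := h9 i hi
    have hiU : i ∉ U := by simpa using (Finset.mem_filter.mp hi).1
    rw [← shorten_insert, h.size_shorten (m := 1)
      (by rw [Finset.card_insert_of_notMem hiU]; omega) le_rfl] at h10
    omega
  rw [hd, Finset.card_empty] at h6 h8
  obtain ⟨h1, h2⟩ := hasLevel_of_signSum_eq (by omega) h16 hf.signSum_eq
  rw [h2] at h1 ⊢
  exact ⟨h1, hf', by omega, by omega, by omega⟩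

/-- The double count determines all weights except the top one, where its factor `m - j` is 0; the
size supplies that one. The sign sum then identifies the level with a shift of `A₆`, which makes
every count, and the sum of the levels one step below, affine in it. The larger cases repeat this.
-/
theorem IsFullCode.distribution_three (h : IsFullCode C) (hU : U.card = 3) :
    HasLevel (shorten C U) 3 (level C U) ∧
      ∑ i ∈ Uᶜ, level C (insert i U) = 12 + 3 * level C U ∧
      (weightCount (shorten C U) 6 : ℤ) = 28 + 1 * level C U ∧
      (weightCount (shorten C U) 7 : ℤ) = 24 + (-3) * level C U ∧
      (weightCount (shorten C U) 8 : ℤ) = 3 + 3 * level C U ∧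
      (weightCount (shorten C U) 9 : ℤ) = 8 + (-1) * level C U := by
  have hs := h.size_shorten (U := U) (m := 3) (by omega) (by norm_num)
  have hcard : ∀ i ∈ Uᶜ, (insert i U).card = 4 := fun i hi => by
    rw [Finset.card_insert_of_notMem (by simpa using hi)]; omega
  have h6 := h.sum_affine (m := 3) (by omega) 0 8 1
    fun i hi => (h.distribution_two (hcard i hi)).2.2.1
  have h7 := h.sum_affine (m := 3) (by omega) 1 8 (-2)
    fun i hi => (h.distribution_two (hcard i hi)).2.2.2.1
  have h8 := h.sum_affine (m := 3) (by omega) 2 (-1) 1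
    fun i hi => (h.distribution_two (hcard i hi)).2.2.2.2
  have hS := (h.isShort U).size_eq (m := 3) (by omega)
  have hF := (h.isShort U).signSum_eq (m := 3) (by omega)
  rw [hs] at hS
  simp only [Finset.sum_range_succ, Finset.sum_range_zero] at hS hF
  norm_num at h6 h7 h8 hS hF
  obtain ⟨h1, h2⟩ := hasLevel_of_signSum_eq (f := weightCount (shorten C U) 6 - 28)
    (by omega) hs (by omega)
  exact ⟨h1, by omega, by omega, by omega, by omega, by omega⟩

theorem IsFullCode.distribution_four (h : IsFullCode C) (hU : U.card = 2) :
    HasLevel (shorten C U) 4 (level C U) ∧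
      ∑ i ∈ Uᶜ, level C (insert i U) = 16 + 4 * level C U ∧
      (weightCount (shorten C U) 6 : ℤ) = 74 + 1 * level C U ∧
      (weightCount (shorten C U) 7 : ℤ) = 64 + (-4) * level C U ∧
      (weightCount (shorten C U) 8 : ℤ) = 39 + 6 * level C U ∧
      (weightCount (shorten C U) 9 : ℤ) = 64 + (-4) * level C U ∧
      (weightCount (shorten C U) 10 : ℤ) = 14 + 1 * level C U := by
  have hs := h.size_shorten (U := U) (m := 4) (by omega) (by norm_num)
  have hcard : ∀ i ∈ Uᶜ, (insert i U).card = 3 := fun i hi => by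
    rw [Finset.card_insert_of_notMem (by simpa using hi)]; omega
  have h6 := h.sum_affine (m := 4) (by omega) 0 28 1
    fun i hi => (h.distribution_three (hcard i hi)).2.2.1
  have h7 := h.sum_affine (m := 4) (by omega) 1 24 (-3)
    fun i hi => (h.distribution_three (hcard i hi)).2.2.2.1
  have h8 := h.sum_affine (m := 4) (by omega) 2 3 3
    fun i hi => (h.distribution_three (hcard i hi)).2.2.2.2.1
  have h9 := h.sum_affine (m := 4) (by omega) 3 8 (-1)
    fun i hi => (h.distribution_three (hcard i hi)).2.2.2.2.2
  have hS := (h.isShort U).size_eq (m := 4) (by omega)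
  have hF := (h.isShort U).signSum_eq (m := 4) (by omega)
  rw [hs] at hS
  simp only [Finset.sum_range_succ, Finset.sum_range_zero] at hS hF
  norm_num at h6 h7 h8 h9 hS hF
  obtain ⟨h1, h2⟩ := hasLevel_of_signSum_eq (f := weightCount (shorten C U) 6 - 74)
    (by omega) hs (by omega)
  exact ⟨h1, by omega, by omega, by omega, by omega, by omega, by omega⟩

theorem IsFullCode.distribution_five (h : IsFullCode C) (hU : U.card = 1) :
    HasLevel (shorten C U) 5 (level C U) ∧
      ∑ i ∈ Uᶜ, level C (insert i U) = 16 + 5 * level C U ∧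
      (weightCount (shorten C U) 6 : ℤ) = 166 + 1 * level C U ∧
      (weightCount (shorten C U) 7 : ℤ) = 160 + (-5) * level C U ∧
      (weightCount (shorten C U) 8 : ℤ) = 175 + 10 * level C U ∧
      (weightCount (shorten C U) 9 : ℤ) = 320 + (-10) * level C U ∧
      (weightCount (shorten C U) 10 : ℤ) = 170 + 5 * level C U ∧
      (weightCount (shorten C U) 11 : ℤ) = 32 + (-1) * level C U := by
  have hs := h.size_shorten (U := U) (m := 5) (by omega) (by norm_num)
  have hcard : ∀ i ∈ Uᶜ, (insert i U).card = 2 := fun i hi => by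
    rw [Finset.card_insert_of_notMem (by simpa using hi)]; omega
  have h6 := h.sum_affine (m := 5) (by omega) 0 74 1
    fun i hi => (h.distribution_four (hcard i hi)).2.2.1
  have h7 := h.sum_affine (m := 5) (by omega) 1 64 (-4)
    fun i hi => (h.distribution_four (hcard i hi)).2.2.2.1
  have h8 := h.sum_affine (m := 5) (by omega) 2 39 6
    fun i hi => (h.distribution_four (hcard i hi)).2.2.2.2.1
  have h9 := h.sum_affine (m := 5) (by omega) 3 64 (-4)
    fun i hi => (h.distribution_four (hcard i hi)).2.2.2.2.2.1
  have h10 := h.sum_affine (m := 5) (by omega) 4 14 1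
    fun i hi => (h.distribution_four (hcard i hi)).2.2.2.2.2.2
  have hS := (h.isShort U).size_eq (m := 5) (by omega)
  have hF := (h.isShort U).signSum_eq (m := 5) (by omega)
  rw [hs] at hS
  simp only [Finset.sum_range_succ, Finset.sum_range_zero] at hS hF
  norm_num at h6 h7 h8 h9 h10 hS hF
  obtain ⟨h1, h2⟩ := hasLevel_of_signSum_eq (f := weightCount (shorten C U) 6 - 166)
    (by omega) hs (by omega)
  exact ⟨h1, by omega, by omega, by omega, by omega, by omega, by omega, by omega⟩

theorem IsFullCode.distribution_six (h : IsFullCode C) :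
    HasLevel C 6 (level C ∅) ∧
      ∑ i, level C {i} = 6 * level C ∅ ∧
      (weightCount C 6 : ℤ) = 332 + level C ∅ ∧
      (weightCount C 7 : ℤ) = 384 - 6 * level C ∅ ∧
      (weightCount C 8 : ℤ) = 525 + 15 * level C ∅ ∧
      (weightCount C 9 : ℤ) = 1280 - 20 * level C ∅ ∧
      (weightCount C 10 : ℤ) = 1020 + 15 * level C ∅ ∧
      (weightCount C 11 : ℤ) = 384 - 6 * level C ∅ ∧
      (weightCount C 12 : ℤ) = 170 + level C ∅ := by
  have hs := h.size_shorten (U := ∅) (m := 6) (by simp) (by norm_num)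
  have hcard : ∀ i ∈ (∅ : Finset (Fin 12))ᶜ, (insert i (∅ : Finset (Fin 12))).card = 1 :=
    fun i hi => by simp
  have h6 := h.sum_affine (m := 6) (by simp) 0 166 1
    fun i hi => (h.distribution_five (hcard i hi)).2.2.1
  have h7 := h.sum_affine (m := 6) (by simp) 1 160 (-5)
    fun i hi => (h.distribution_five (hcard i hi)).2.2.2.1
  have h8 := h.sum_affine (m := 6) (by simp) 2 175 10
    fun i hi => (h.distribution_five (hcard i hi)).2.2.2.2.1
  have h9 := h.sum_affine (m := 6) (by simp) 3 320 (-10)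
    fun i hi => (h.distribution_five (hcard i hi)).2.2.2.2.2.1
  have h10 := h.sum_affine (m := 6) (by simp) 4 170 5
    fun i hi => (h.distribution_five (hcard i hi)).2.2.2.2.2.2.1
  have h11 := h.sum_affine (m := 6) (by simp) 5 32 (-1)
    fun i hi => (h.distribution_five (hcard i hi)).2.2.2.2.2.2.2
  have hS := (h.isShort ∅).size_eq (m := 6) (by simp)
  have hF := (h.isShort ∅).signSum_eq (m := 6) (by simp)
  rw [hs] at hS
  simp only [Finset.sum_range_succ, Finset.sum_range_zero] at hS hF
  obtain ⟨h1, h2⟩ := hasLevel_of_signSum_eq (C := C) (U := ∅) (m := 6)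
    (f := weightCount (shorten C ∅) 6 - 332) (by simp) hs
    (by norm_num at h6 h7 h8 h9 h10 h11 hS hF ⊢; omega)
  rw [shorten_empty] at *
  simp only [Finset.compl_empty, insert_empty_eq] at h6 h7 h8 h9 h10 h11
  norm_num at h6 h7 h8 h9 h10 h11 hS hF
  exact ⟨h1, by omega, by omega, by omega, by omega, by omega, by omega, by omega, by omega⟩

end Distributions

/-! ### The possible levels for one, two and three vanishing coordinates. -/

section Levels

variable {C : Submodule (ZMod 2) (QuaternaryWord 12)} {U : Finset (Fin 12)}

theorem sum_two_valued {ι : Type*} (s : Finset ι) (f : ι → ℤ) (a b : ℤ) (hab : a ≠ b)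
    (h : ∀ i ∈ s, f i = a ∨ f i = b) :
    ∑ i ∈ s, f i = s.card * a + (b - a) * (s.filter (fun i => f i = b)).card := by
  have h1 : ∀ i ∈ s, f i = a + (b - a) * (if f i = b then 1 else 0) := by
    intro i hi
    rcases h i hi with h1 | h1 <;> rw [h1]
    · rw [if_neg hab]; ring
    · rw [if_pos rfl]; ring
  rw [Finset.sum_congr rfl h1, Finset.sum_add_distrib, ← Finset.mul_sum, Finset.sum_boole,
    Finset.sum_const, nsmul_eq_mul]

theorem insert_compl_card {m : ℕ} (hU : U.card = m) : ∀ i ∈ Uᶜ, (insert i U).card = m + 1 :=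
  fun i hi => by rw [Finset.card_insert_of_notMem (by simpa using hi), hU]

theorem shorten_insert_le (i : Fin 12) : shorten C (insert i U) ≤ shorten C U :=
  shorten_anti (Finset.subset_insert i U)

theorem IsFullCode.shorten_sup_shorten (h : IsFullCode C) {m : ℕ} (hm : U.card + (m + 2) = 6)
    (h1 : 1 ≤ m) {i j : Fin 12} (hi : i ∈ Uᶜ) (hj : j ∈ Uᶜ) (hij : i ≠ j) :
    shorten C (insert i U) ⊔ shorten C (insert j U) = shorten C U := by
  have hi' := insert_compl_card rfl i hi
  have hj' := insert_compl_card rfl j hj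
  have hij' : (insert j (insert i U)).card = U.card + 1 + 1 := by
    rw [Finset.card_insert_of_notMem, hi']
    simp only [mem_compl, mem_insert, not_or] at hj ⊢
    exact ⟨hij.symm, hj⟩
  refine sup_eq_of_size (shorten_insert_le i) (shorten_insert_le j) ?_
  have h2 : insert i U ∪ insert j U = insert j (insert i U) := by
    ext x; simp only [mem_union, mem_insert]; tauto
  rw [shorten_inf_shorten, h2, h.size_shorten hm (by omega),
    h.size_shorten (U := insert j (insert i U)) (m := m) (by omega) h1,
    h.size_shorten (U := insert i U) (m := m + 1) (by omega) (by omega),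
    h.size_shorten (U := insert j U) (m := m + 1) (by omega) (by omega)]
  ring

theorem IsShort.eq_zero_of_card (h : IsShort U C) {c : QuaternaryWord 12} (hc : c ∈ C)
    (hU : 6 < U.card) : c = 0 := by
  by_contra h0
  have h1 := h.six_le c hc h0
  have h2 := h.hammingNorm_add_card_le hc
  omega

/-- If the signs cancel, but not over the shortened codes, then there is an odd radical word
without zeros outside `U`. -/
theorem exists_odd_of_level_eq_zero {m : ℕ} (hm : U.card + m = 6)
    (hE : HasLevel (shorten C U) m 0)
    (hi : ∀ i ∈ Uᶜ, signSum (shorten C (insert i U)) ≠ 0) :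
    ∃ r ∈ rad (shorten C U), sgn r = -1 ∧ (∀ i ∈ Uᶜ, r i ≠ 0) ∧ hammingNorm r = m + 6 := by
  obtain ⟨r, hr, hr1⟩ := exists_odd_of_signSum_eq_zero (D := shorten C U)
    (by rw [hE.signSum_eq, mul_zero])
  have h1 : ∀ i ∈ Uᶜ, r i ≠ 0 := by
    intro i hi' h0
    have h2 : r ∈ shorten C (insert i U) := by
      rw [shorten_insert, mem_shorten]
      exact ⟨rad_le hr, by simpa using h0⟩
    have h3 := isEven_rad_of_signSum_ne_zero (hi i hi') r
      (inf_rad_le_rad (shorten_insert_le i) ⟨h2, hr⟩)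
    omega
  refine ⟨r, hr, hr1, h1, ?_⟩
  rw [hammingNorm, ← card_compl_add hm]
  congr 1
  ext i
  simp only [mem_filter, mem_univ, true_and, mem_compl]
  refine ⟨fun h2 h3 => h2 ((rad_le hr).2 i h3), fun h2 => h1 i (by simpa using h2)⟩

/-- The symplectic form of two symbols. -/
def symbolForm (a b : ZMod 2 × ZMod 2) : ZMod 2 := a.1 * b.2 + a.2 * b.1

theorem symbolForm_sub (a b c : ZMod 2 × ZMod 2) :
    symbolForm (a - b) c = symbolForm a c - symbolForm b c := by
  simp only [symbolForm, Prod.fst_sub, Prod.snd_sub]; ring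

theorem symbolForm_self (a : ZMod 2 × ZMod 2) : symbolForm a a = 0 := by
  revert a; decide

theorem symbolPairing_eq (a b : ZMod 2 × ZMod 2) :
    symbolPairing a b = if symbolForm a b = 0 then 1 else -1 := rfl

theorem symbol_weight_add (a r : ZMod 2 × ZMod 2) (hr : r ≠ 0) :
    (if a ≠ 0 then 1 else 0) + (if a + r ≠ 0 then 1 else 0) =
      1 + (if symbolForm a r ≠ 0 then 1 else 0) := by
  revert a r; decide

/-- A radical word without zeros outside `U` makes a binary code of length `9`, dimension `5` and
minimum distance `4`, which does not exist by the sphere packing bound for its puncturing. -/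
theorem IsShort.no_full_radical_word {E : Submodule (ZMod 2) (QuaternaryWord 12)}
    (h : IsShort U E) (hU : U.card = 3) (hE : size E = 64) {r : QuaternaryWord 12}
    (hr : r ∈ rad E) (hr0 : ∀ i ∈ Uᶜ, r i ≠ 0) : False := by
  have hUc : (Uᶜ).card = 9 := card_compl_add (U := U) (m := 3) (by omega)
  have hrE : r ∈ E := rad_le hr
  have hβ : ∀ y ∈ E, Even (univ.filter fun i => symbolForm (y i) (r i) ≠ 0).card := by
    intro y hy
    have h1 : pairing y r = 1 := hr.1 y hy
    simp only [pairing, symbolPairing_eq, Finset.prod_ite, Finset.prod_const_one, one_mul,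
      Finset.prod_const] at h1
    exact (neg_one_pow_eq_one_iff_even (by norm_num)).mp h1
  -- At each coordinate outside `U` the symbols of `y` and `y + r` contribute 1 to the total weight,
  -- and 2 when `y` pairs nontrivially with `r` there.
  have hsum : ∀ y ∈ E, hammingNorm y + hammingNorm (y + r) =
      9 + (univ.filter fun i => symbolForm (y i) (r i) ≠ 0).card := by
    intro y hy
    simp only [hammingNorm, Finset.card_filter]
    rw [← Finset.sum_add_distrib, ← hUc, Finset.card_eq_sum_ones,
      ← Finset.sum_subset (Finset.subset_univ Uᶜ),
      ← Finset.sum_subset (Finset.subset_univ Uᶜ) (f := fun i =>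
        if symbolForm (y i) (r i) ≠ 0 then 1 else 0), ← Finset.sum_add_distrib]
    · exact Finset.sum_congr rfl fun i hi => symbol_weight_add _ _ (hr0 i hi)
    · intro i _ hi
      rw [mem_compl, not_not] at hi
      rw [h.eq_zero y hy i hi]
      simp [symbolForm]
    · intro i _ hi
      rw [mem_compl, not_not] at hi
      simp [h.eq_zero y hy i hi, h.eq_zero r hrE i hi]
  -- Otherwise both weights are at least 6, so the binary weight is at least 3; being even, it is at
  -- least 4.
  have hkey : ∀ y ∈ E, (univ.filter fun i => symbolForm (y i) (r i) ≠ 0).card ≤ 3 →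
      y = 0 ∨ y + r = 0 := by
    intro y hy hle
    by_contra! hne
    have h1 := h.six_le y hy hne.1
    have h2 := h.six_le _ (E.add_mem hy hrE) hne.2
    have h3 := hsum y hy
    obtain ⟨k, hk⟩ := hβ y hy
    omega
  obtain ⟨i₀, hi₀⟩ : (Uᶜ).Nonempty := by rw [← Finset.card_pos]; omega
  set K := Uᶜ.erase i₀ with hK
  have hKc : K.card = 8 := by rw [hK, Finset.card_erase_of_mem hi₀, hUc]
  -- The binary word of `y`, punctured at `i₀`, with at most one error: `none` is no error and `some
  -- k` an error at `k`. Radius-one balls are disjoint, so the fibres of `φ` on `E` have at most the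
  -- two elements coming from `y` and `y + r`.
  let φ : QuaternaryWord 12 × Option K → (K → ZMod 2) := fun p k =>
    symbolForm (p.1 k) (r k) + (if p.2 = some k then 1 else 0)
  have hφ : ∀ p q : QuaternaryWord 12 × Option K, p.1 ∈ E → q.1 ∈ E → φ p = φ q →
      p.2 = q.2 ∧ (p.1 = q.1 ∨ p.1 = q.1 + r) := by
    rintro ⟨x, o⟩ ⟨x', o'⟩ hx hx' hpq
    simp only at hx hx' ⊢
    have h1 : ∀ k : K, symbolForm ((x - x') k) (r k) =
        (if o' = some k then 1 else 0) - (if o = some k then 1 else 0) := by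
      intro k
      have := congrFun hpq k
      simp only [φ] at this
      rw [Pi.sub_apply, symbolForm_sub, sub_eq_sub_iff_add_eq_add, this, add_comm]
    have h2 : (univ.filter fun i => symbolForm ((x - x') i) (r i) ≠ 0) ⊆
        {i₀} ∪ (o.elim ∅ (fun k => {k.1}) ∪ o'.elim ∅ (fun k => {k.1})) := by
      intro i hi
      simp only [mem_filter, mem_univ, true_and] at hi
      simp only [mem_union, mem_singleton]
      by_cases hi0 : i = i₀
      · exact Or.inl hi0
      right
      have hiK : i ∈ K := by
        rw [hK, mem_erase]
        refine ⟨hi0, ?_⟩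
        rw [mem_compl]
        intro hiU
        apply hi
        rw [h.eq_zero _ (E.sub_mem hx hx') i hiU]
        simp [symbolForm]
      have h3 := h1 ⟨i, hiK⟩
      by_contra! hne
      have h4 : o ≠ some ⟨i, hiK⟩ := by
        rintro rfl; simp at hne
      have h5 : o' ≠ some ⟨i, hiK⟩ := by
        rintro rfl; simp at hne
      rw [if_neg h4, if_neg h5, sub_zero] at h3
      exact hi h3
    have h3 : ∀ o : Option K, (o.elim (∅ : Finset (Fin 12)) (fun k => {k.1})).card ≤ 1 := by
      rintro (_ | k) <;> simp
    have h4 := (Finset.card_le_card h2).trans ((Finset.card_union_le _ _).trans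
      (Nat.add_le_add_left (Finset.card_union_le _ _) _))
    rw [Finset.card_singleton] at h4
    have h5 := hkey (x - x') (E.sub_mem hx hx') (by have := h3 o; have := h3 o'; omega)
    have h6 : ∀ i, symbolForm ((x - x') i) (r i) = 0 := by
      intro i
      rcases h5 with h5 | h5
      · rw [h5]; simp [symbolForm]
      · have h7 : x - x' = r := by
          rw [add_eq_zero_iff_eq_neg] at h5
          rw [h5, neg_eq_iff_add_eq_zero, word_add_self]
        rw [h7, symbolForm_self]
    constructor
    · have h7 : ∀ k : K, (o' = some k ↔ o = some k) := by
        intro k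
        have h8 := h1 k
        rw [h6] at h8
        by_cases ho : o = some k <;> by_cases ho' : o' = some k <;> simp [ho, ho'] at h8 ⊢
      rcases o with _ | k
      · rcases o' with _ | k'
        · rfl
        · exact absurd ((h7 k').mp rfl) (by simp)
      · exact ((h7 k).mpr rfl).symm
    · rcases h5 with h5 | h5
      · exact Or.inl (sub_eq_zero.mp h5)
      · right
        have h7 : x - x' = r := by
          rw [add_eq_zero_iff_eq_neg] at h5
          rw [h5, neg_eq_iff_add_eq_zero, word_add_self]
        rw [← h7]; abel
  have hcount := Finset.card_le_mul_card_image_of_maps_to (f := φ)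
    (s := codewords E ×ˢ (univ : Finset (Option K))) (t := univ) (fun _ _ => mem_univ _) 2 (by
      intro y _
      by_cases hne : ((codewords E ×ˢ (univ : Finset (Option K))).filter fun p => φ p = y).Nonempty
      · obtain ⟨q, hq⟩ := hne
        simp only [mem_filter, mem_product, mem_codewords, mem_univ, and_true] at hq
        refine (Finset.card_le_card (t := {q, (q.1 + r, q.2)}) ?_).trans Finset.card_le_two
        intro p hp
        simp only [mem_filter, mem_product, mem_codewords, mem_univ, and_true] at hp
        obtain ⟨h1, h2⟩ := hφ p q hp.1 hq.1 (hp.2.trans hq.2.symm)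
        rw [mem_insert, mem_singleton]
        rcases h2 with h2 | h2
        · exact Or.inl (Prod.ext h2 h1)
        · exact Or.inr (Prod.ext h2 h1)
      · rw [Finset.not_nonempty_iff_eq_empty.mp hne]; simp)
  -- The contradiction is `64 * 9 ≤ 2 * 2 ^ 8`.
  rw [Finset.card_product, ← size, hE, Finset.card_univ, Fintype.card_option, Fintype.card_coe,
    hKc, Finset.card_univ, Fintype.card_fun, ZMod.card, Fintype.card_coe, hKc] at hcount
  norm_num at hcount

/-- Nonnegativity of `A₈ = 3 + 3f` and `A₉ = 8 - f` leaves 0 and 4 to exclude. Level 0 would give a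
radical word without zeros outside `U`. Level 4 would force exactly three even shortenings, too many
for `card_even_cover`. -/
theorem IsFullCode.level_three (h : IsFullCode C) (hU : U.card = 3) :
    level C U = 8 ∨ level C U = 2 ∨ level C U = 1 ∨ level C U = -1 := by
  obtain ⟨hlev, hsum, -, -, h8, h9⟩ := h.distribution_three hU
  have hcard := insert_compl_card hU
  have hsub := fun i hi => h.distribution_two (hcard i hi)
  have hUc : (Uᶜ).card = 9 := card_compl_add (U := U) (m := 3) (by omega)
  have hne : ∀ i ∈ Uᶜ, level C (insert i U) ≠ 0 := fun i hi => by
    have := (hsub i hi).2.1; omega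
  have h0 : level C U ≠ 0 := by
    intro h0
    rw [h0] at hlev
    obtain ⟨r, hr, -, hr0, -⟩ := exists_odd_of_level_eq_zero (m := 3) (by omega) hlev
      (fun i hi => by
        have := hne i hi
        rw [(hsub i hi).1.signSum_eq]; positivity)
    exact (h.isShort U).no_full_radical_word hU hlev.size_eq hr hr0
  obtain ⟨b, hb, h1⟩ := hlev.natAbs_eq h0
  suffices h4 : level C U ≠ 4 by interval_cases b <;> omega
  intro h4
  rw [h4] at hlev hsum
  have h24 : ∀ i ∈ Uᶜ, level C (insert i U) = 2 ∨ level C (insert i U) = 4 := by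
    intro i hi
    have h2 := (HasLevel.abs_le (shorten_insert_le i) hlev (hsub i hi).1 (by norm_num)
      (hne i hi)).2
    rcases (hsub i hi).2.1 with h3 | h3 | h3
    · rw [h3] at h2; norm_num at h2
    · exact Or.inl h3
    · exact Or.inr h3
  rw [sum_two_valued _ _ 2 4 (by norm_num) h24, hUc] at hsum
  set S := Uᶜ.filter (fun i => level C (insert i U) = 4)
  have hS : S.card = 3 := by norm_num at hsum; omega
  have hcov := card_even_cover (E := shorten C U) S (fun i => shorten C (insert i U))
    (by omega) (fun i hi => by
      obtain ⟨hi, hi4⟩ := Finset.mem_filter.mp hi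
      refine ⟨isEven_of_signSum_eq ?_, shorten_insert_le i⟩
      rw [(hsub i hi).1.signSum_eq, (hsub i hi).1.size_eq, hi4]; norm_num)
    (fun i hi j hj hij => h.shorten_sup_shorten (m := 1) (by omega) le_rfl
      (Finset.mem_filter.mp hi).1 (Finset.mem_filter.mp hj).1 hij)
    (by rw [hlev.signSum_eq]; norm_num)
  rw [hS, hlev.signSum_eq, hlev.size_eq, ← hlev.sq_eq (by norm_num)] at hcov
  norm_num at hcov

/-- Level 0 would produce an odd word of weight 10. The other values to exclude violate the sum
relation or the sign rule, except -2: there the sum relation forces six changes of sign, so the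
radical of order 4 vanishes at eight coordinates, which minimum weight 6 forbids. -/
theorem IsFullCode.level_four (h : IsFullCode C) (hU : U.card = 2) :
    level C U = 16 ∨ level C U = 4 ∨ level C U = 1 := by
  obtain ⟨hlev, hsum, -, h7, h8, -, -⟩ := h.distribution_four hU
  have hcard := insert_compl_card hU
  have hsub := fun i hi => h.level_three (hcard i hi)
  have hlevi := fun i hi => (h.distribution_three (hcard i hi)).1
  have hUc : (Uᶜ).card = 10 := card_compl_add (U := U) (m := 4) (by omega)
  have hne : ∀ i ∈ Uᶜ, level C (insert i U) ≠ 0 := fun i hi => by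
    have := hsub i hi; omega
  have h0 : level C U ≠ 0 := by
    intro h0
    rw [h0] at hlev
    obtain ⟨r, hr, hr1, -, hr2⟩ := exists_odd_of_level_eq_zero (m := 4) (by omega) hlev
      (fun i hi => by
        have := hne i hi
        rw [(hlevi i hi).signSum_eq]; positivity)
    rw [sgn_eq_pow, hr2] at hr1
    norm_num at hr1
  have habs : ∀ i ∈ Uᶜ, |level C (insert i U)| ≤ 2 * |level C U| ∧
      |level C U| ≤ 2 * |level C (insert i U)| := fun i hi =>
    HasLevel.abs_le (shorten_insert_le i) hlev (hlevi i hi) h0 (hne i hi)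
  have hneg : ∀ i ∈ Uᶜ, level C U * level C (insert i U) < 0 →
      level C (insert i U) = -level C U ∧ rad (shorten C U) ≤ shorten C (insert i U) :=
    fun i hi => HasLevel.eq_neg (shorten_insert_le i) hlev (hlevi i hi)
  obtain ⟨i₀, hi₀⟩ : (Uᶜ).Nonempty := by rw [← Finset.card_pos]; omega
  obtain ⟨b, hb, h1⟩ := hlev.natAbs_eq h0
  have hcases : level C U = 16 ∨ level C U = 8 ∨ level C U = 4 ∨ level C U = 2 ∨ level C U = 1 ∨
      level C U = -1 ∨ level C U = -2 ∨ level C U = -4 := by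
    interval_cases b <;> omega
  rcases hcases with hf | hf | hf | hf | hf | hf | hf | hf
  · exact Or.inl hf
  · exfalso
    rw [hf] at habs hsum
    have h2 : ∀ i ∈ Uᶜ, level C (insert i U) = 8 := by
      intro i hi
      have h3 := (habs i hi).2
      rcases hsub i hi with h4 | h4 | h4 | h4 <;> rw [h4] at h3 ⊢ <;> norm_num at h3
    rw [Finset.sum_congr rfl h2, Finset.sum_const, hUc] at hsum
    norm_num at hsum
  · exact Or.inr (Or.inl hf)
  · exfalso
    rw [hf] at habs hsum hneg
    have h2 : ∀ i ∈ Uᶜ, level C (insert i U) ≤ 2 := by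
      intro i hi
      have h3 := (habs i hi).1
      rcases hsub i hi with h4 | h4 | h4 | h4 <;> rw [h4] at h3 ⊢ <;>
        first | (norm_num at h3; done) | norm_num
    have h3 := Finset.sum_le_sum h2
    rw [hsum, Finset.sum_const, hUc] at h3
    norm_num at h3
  · exact Or.inr (Or.inr hf)
  · exfalso
    rw [hf] at habs hsum hneg
    have h2 : ∀ i ∈ Uᶜ, level C (insert i U) ≤ 1 := by
      intro i hi
      by_contra! h3
      have := (hneg i hi (by omega)).1
      omega
    have h3 := Finset.sum_le_sum h2
    rw [hsum, Finset.sum_const, hUc] at h3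
    norm_num at h3
  · exfalso
    rw [hf] at hsum hneg
    have h2 : ∀ i ∈ Uᶜ, level C (insert i U) = -1 ∨ level C (insert i U) = 2 := by
      intro i hi
      rcases hsub i hi with h4 | h4 | h4 | h4
      · have := (hneg i hi (by omega)).1; omega
      · exact Or.inr h4
      · have := (hneg i hi (by omega)).1; omega
      · exact Or.inl h4
    rw [sum_two_valued _ _ (-1) 2 (by norm_num) h2, hUc] at hsum
    set S := Uᶜ.filter (fun i => level C (insert i U) = 2)
    have hS : S.card = 6 := by norm_num at hsum; omega
    have hdisj : Disjoint U S := by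
      rw [Finset.disjoint_right]
      intro i hi
      simpa using (Finset.mem_filter.mp hi).1
    have hR : IsShort (U ∪ S) (rad (shorten C U)) := by
      refine ⟨fun c hc i hi => ?_, fun c hc => h.six_le c (rad_le hc).1⟩
      rcases Finset.mem_union.mp hi with hi | hi
      · exact (rad_le hc).2 i hi
      · obtain ⟨hi, hi2⟩ := Finset.mem_filter.mp hi
        exact ((hneg i hi (by omega)).2 hc).2 i (Finset.mem_insert_self i U)
    have h3 := hR.size_eq_one (by rw [Finset.card_union_of_disjoint hdisj]; omega)
    have h4 := hlev.sq_eq h0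
    rw [h3, hf] at h4
    norm_num at h4
  · exfalso
    rw [hf] at habs hneg
    have h3 := (habs i₀ hi₀).2
    rcases hsub i₀ hi₀ with h4 | h4 | h4 | h4
    · have := (hneg i₀ hi₀ (by omega)).1; omega
    · have := (hneg i₀ hi₀ (by omega)).1; omega
    all_goals rw [h4] at h3; norm_num at h3

/-- All levels 16, 4, 1 one step below are congruent to 1 modulo 3, so the sum relation forces `f`
to be 2 modulo 3. They are also at least 1, which gives `f ≥ -1`. -/
theorem IsFullCode.level_five (h : IsFullCode C) (hU : U.card = 1) :
    level C U = 32 ∨ level C U = 8 ∨ level C U = 2 ∨ level C U = -1 := by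
  obtain ⟨hlev, hsum, -, -, -, -, -, h11⟩ := h.distribution_five hU
  have hcard := insert_compl_card hU
  have hsub := fun i hi => h.level_four (hcard i hi)
  have hUc : (Uᶜ).card = 11 := card_compl_add (U := U) (m := 5) (by omega)
  have h1 : (∑ i ∈ Uᶜ, (1 : ℤ)) ≤ ∑ i ∈ Uᶜ, level C (insert i U) :=
    Finset.sum_le_sum fun i hi => by have := hsub i hi; omega
  have h3 : (3 : ℤ) ∣ ∑ i ∈ Uᶜ, (level C (insert i U) - 1) :=
    Finset.dvd_sum fun i hi => by have := hsub i hi; omega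
  rw [Finset.sum_sub_distrib] at h3
  simp only [Finset.sum_const, hUc, nsmul_eq_mul, hsum] at h1 h3
  norm_num at h1 h3
  obtain ⟨b, hb, h2⟩ := hlev.natAbs_eq (by omega)
  interval_cases b <;> omega

theorem IsFullCode.level_four_of_level_five_eq_two (h : IsFullCode C) (hU : U.card = 1)
    (hf : level C U = 2) :
    (∀ i ∈ Uᶜ, level C (insert i U) = 1 ∨ level C (insert i U) = 4) ∧
      (Uᶜ.filter fun i => level C (insert i U) = 4).card = 5 ∧
      ∀ i ∈ Uᶜ, level C (insert i U) = 4 → rad (shorten C U) ≤ shorten C (insert i U) := by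
  obtain ⟨hlev, hsum, -⟩ := h.distribution_five hU
  rw [hf] at hlev hsum
  have hcard := insert_compl_card hU
  have hsub := fun i hi => h.level_four (hcard i hi)
  have hlevi := fun i hi => (h.distribution_four (hcard i hi)).1
  have hUc : (Uᶜ).card = 11 := card_compl_add (U := U) (m := 5) (by omega)
  have h14 : ∀ i ∈ Uᶜ, level C (insert i U) = 1 ∨ level C (insert i U) = 4 := by
    intro i hi
    rcases hsub i hi with h1 | h1 | h1
    · have := (HasLevel.abs_le (shorten_insert_le i) hlev (hlevi i hi) (by norm_num)
        (by omega)).1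
      rw [h1] at this
      norm_num at this
    · exact Or.inr h1
    · exact Or.inl h1
  refine ⟨h14, ?_, fun i hi hi4 => ?_⟩
  · rw [sum_two_valued _ _ 1 4 (by norm_num) h14, hUc] at hsum
    norm_num at hsum
    omega
  · exact HasLevel.rad_le_of_two_mul_le (shorten_insert_le i) hlev (hlevi i hi) (by norm_num)
      (by omega) (by rw [hi4]; norm_num)

theorem IsFullCode.level_four_of_level_five_eq_eight (h : IsFullCode C) (hU : U.card = 1)
    (hf : level C U = 8) :
    (Uᶜ.filter fun i => level C (insert i U) = 16).card = 1 := by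
  obtain ⟨hlev, hsum, -⟩ := h.distribution_five hU
  rw [hf] at hlev hsum
  have hcard := insert_compl_card hU
  have hsub := fun i hi => h.level_four (hcard i hi)
  have hlevi := fun i hi => (h.distribution_four (hcard i hi)).1
  have hUc : (Uᶜ).card = 11 := card_compl_add (U := U) (m := 5) (by omega)
  have h4 : ∀ i ∈ Uᶜ, level C (insert i U) = 4 ∨ level C (insert i U) = 16 := by
    intro i hi
    rcases hsub i hi with h1 | h1 | h1
    · exact Or.inr h1
    · exact Or.inl h1
    · have := (HasLevel.abs_le (shorten_insert_le i) hlev (hlevi i hi) (by norm_num)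
        (by omega)).2
      rw [h1] at this
      norm_num at this
  rw [sum_two_valued _ _ 4 16 (by norm_num) h4, hUc] at hsum
  norm_num at hsum
  omega

end Levels

/-! ### Two complementary blocks of six coordinates. -/

/-- The number of nonzero coordinates of a word in `T`. -/
def weightOn {n : ℕ} (T : Finset (Fin n)) (c : QuaternaryWord n) : ℕ :=
  (T.filter fun i => c i ≠ 0).card

/-- The parity sign of a word restricted to `T`. -/
def signOn {n : ℕ} (T : Finset (Fin n)) (c : QuaternaryWord n) : ℤ := ∏ i ∈ T, symbolSign (c i)

section Blocks

theorem signOn_eq_pow {n : ℕ} (T : Finset (Fin n)) (c : QuaternaryWord n) :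
    signOn T c = (-1) ^ weightOn T c := by
  simp only [signOn, symbolSign, weightOn, Finset.prod_ite]
  simp

theorem signOn_eq_or {n : ℕ} (T : Finset (Fin n)) (c : QuaternaryWord n) :
    signOn T c = 1 ∨ signOn T c = -1 := by
  rw [signOn_eq_pow]; exact neg_one_pow_eq_or ℤ _

theorem signOn_mul_compl {n : ℕ} (T : Finset (Fin n)) (c : QuaternaryWord n) :
    signOn T c * signOn Tᶜ c = sgn c := Finset.prod_mul_prod_compl T _

theorem weightOn_add_compl {n : ℕ} (T : Finset (Fin n)) (c : QuaternaryWord n) :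
    weightOn T c + weightOn Tᶜ c = hammingNorm c := by
  rw [weightOn, weightOn, hammingNorm, ← Finset.card_union_of_disjoint
    (Finset.disjoint_filter_filter disjoint_compl_right), ← Finset.filter_union,
    Finset.union_compl]

theorem weightOn_congr {n : ℕ} {T : Finset (Fin n)} {c d : QuaternaryWord n}
    (h : ∀ i ∈ T, c i = d i) : weightOn T c = weightOn T d := by
  rw [weightOn, weightOn, Finset.filter_congr fun i hi => by rw [h i hi]]

theorem weightOn_add_le {n : ℕ} (T : Finset (Fin n)) (c d : QuaternaryWord n) :
    weightOn T (c + d) ≤ weightOn T c + weightOn T d := by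
  refine (Finset.card_le_card (t := (T.filter fun i => c i ≠ 0) ∪ T.filter fun i => d i ≠ 0)
    ?_).trans (Finset.card_union_le _ _)
  intro i hi
  simp only [mem_filter, mem_union, Pi.add_apply] at hi ⊢
  by_contra! hne
  exact hi.2 (by rw [hne.1 hi.1, hne.2 hi.1, add_zero])

theorem weightOn_neg {n : ℕ} (T : Finset (Fin n)) (c : QuaternaryWord n) :
    weightOn T (-c) = weightOn T c := by
  simp [weightOn]

theorem sum_choose_zeros {n : ℕ} (D : Submodule (ZMod 2) (QuaternaryWord n)) (T : Finset (Fin n))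
    (t : ℕ) : ∑ c ∈ codewords D, (T.card - weightOn T c).choose t =
      ∑ S ∈ T.powersetCard t, size (shorten D S) := by
  classical
  have h1 : ∀ c ∈ codewords D, (T.card - weightOn T c).choose t =
      ∑ S ∈ T.powersetCard t, if ∀ i ∈ S, c i = 0 then 1 else 0 := by
    intro c _
    have h2 := Finset.card_filter_add_card_filter_not (s := T) (fun i => c i = 0)
    rw [show T.card - weightOn T c = (T.filter fun i => c i = 0).card by
      rw [← h2]; simp [weightOn], ← Finset.card_powersetCard, Finset.sum_boole, Nat.cast_id]
    congr 1
    ext S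
    simp only [mem_powersetCard, mem_filter, Finset.subset_iff]
    exact ⟨fun h => ⟨⟨fun i hi => (h.1 hi).1, h.2⟩, fun i hi => (h.1 hi).2⟩,
      fun h => ⟨fun i hi => ⟨h.1.1 hi, h.2 i hi⟩, h.1.2⟩⟩
  rw [Finset.sum_congr rfl h1, Finset.sum_comm]
  refine Finset.sum_congr rfl fun S _ => ?_
  rw [Finset.sum_boole, Nat.cast_id, size]
  congr 1
  ext c
  simp only [mem_filter, mem_codewords, mem_shorten]

/-- The number of words with `k` zeros on `T`. -/
noncomputable def zeroCount {n : ℕ} (D : Submodule (ZMod 2) (QuaternaryWord n))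
    (T : Finset (Fin n)) (k : ℕ) : ℕ :=
  ((codewords D).filter fun c => T.card - weightOn T c = k).card

theorem sum_zeroCount {n : ℕ} (D : Submodule (ZMod 2) (QuaternaryWord n)) (T : Finset (Fin n))
    (g : ℕ → ℤ) : ∑ c ∈ codewords D, g (T.card - weightOn T c) =
      ∑ k ∈ range (T.card + 1), g k * zeroCount D T k := by
  rw [← Finset.sum_fiberwise_of_maps_to (t := range (T.card + 1))
    (g := fun c => T.card - weightOn T c)]
  · refine Finset.sum_congr rfl fun w _ => ?_
    rw [Finset.sum_congr rfl (g := fun _ => g w)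
      (fun c hc => by rw [(Finset.mem_filter.mp hc).2])]
    rw [Finset.sum_const, nsmul_eq_mul, mul_comm]
    rfl
  · intro c _
    simp only [mem_range]
    omega

variable {C : Submodule (ZMod 2) (QuaternaryWord 12)} {T : Finset (Fin 12)}

theorem IsFullCode.sum_choose_zeros (h : IsFullCode C) (hT : T.card = 6) {t : ℕ} (ht : t ≤ 5) :
    ∑ k ∈ range 7, (k.choose t : ℤ) * zeroCount C T k = Nat.choose 6 t * 4 ^ (6 - t) := by
  have h1 := sum_zeroCount C T (fun k => (k.choose t : ℤ))
  rw [hT] at h1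
  rw [← h1]
  have h2 := _root_.sum_choose_zeros C T t
  have h3 : ∀ S ∈ T.powersetCard t, size (shorten C S) = 4 ^ (6 - t) := fun S hS => by
    have := (mem_powersetCard.mp hS).2
    exact h.size_shorten (by omega) (by omega)
  rw [hT, Finset.sum_congr rfl h3, Finset.sum_const, card_powersetCard, hT, smul_eq_mul] at h2
  exact_mod_cast h2

/-- Independence of any five coordinates gives the binomial moments of order at most 5 of the number
of zeros on `T`. With the number of words vanishing on all of `T` they determine every count. -/
theorem IsFullCode.zeroCount_eq (h : IsFullCode C) (hT : T.card = 6)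
    (hs : size (shorten C T) = 4) :
    zeroCount C T 4 = 180 ∧ ∑ c ∈ codewords C, signOn T c = 256 := by
  have h6 : zeroCount C T 6 = 4 := by
    rw [← hs, size, zeroCount]
    congr 1
    ext c
    have hle : weightOn T c ≤ 6 := hT ▸ Finset.card_filter_le _ _
    have h0 : weightOn T c = 0 ↔ ∀ i ∈ T, c i = 0 := by
      rw [weightOn, Finset.card_eq_zero, Finset.filter_eq_empty_iff]
      simp
    simp only [mem_filter, mem_codewords, mem_shorten, hT, ← h0]
    exact and_congr_right fun _ => by omega
  have e0 := h.sum_choose_zeros hT (t := 0) (by norm_num)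
  have e1 := h.sum_choose_zeros hT (t := 1) (by norm_num)
  have e2 := h.sum_choose_zeros hT (t := 2) (by norm_num)
  have e3 := h.sum_choose_zeros hT (t := 3) (by norm_num)
  have e4 := h.sum_choose_zeros hT (t := 4) (by norm_num)
  have e5 := h.sum_choose_zeros hT (t := 5) (by norm_num)
  have hF : ∑ c ∈ codewords C, signOn T c =
      ∑ k ∈ range 7, (-1 : ℤ) ^ k * zeroCount C T k := by
    have h1 := sum_zeroCount C T (fun k => (-1 : ℤ) ^ k)
    rw [hT] at h1
    rw [← h1]
    refine Finset.sum_congr rfl fun c _ => ?_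
    have hle : weightOn T c ≤ 6 := hT ▸ Finset.card_filter_le _ _
    rw [signOn_eq_pow]
    generalize weightOn T c = w at *
    interval_cases w <;> norm_num
  simp only [Finset.sum_range_succ, Finset.sum_range_zero] at e0 e1 e2 e3 e4 e5 hF
  norm_num [Nat.choose] at e0 e1 e2 e3 e4 e5 hF
  rw [h6] at e0 e1 e2 e3 e4 e5 hF
  norm_num at e0 e1 e2 e3 e4 e5 hF
  constructor <;> omega

/-- The words of `C` with an even number of nonzero coordinates in `T` and outside `T`. -/
noncomputable def evenBlockWords (C : Submodule (ZMod 2) (QuaternaryWord 12))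
    (T : Finset (Fin 12)) : Finset (QuaternaryWord 12) :=
  (codewords C).filter fun c => signOn T c = 1 ∧ signOn Tᶜ c = 1

/-- The translates of the words of weight `2` on `T` by the words supported on `T`. -/
noncomputable def shiftedWords (C : Submodule (ZMod 2) (QuaternaryWord 12))
    (T : Finset (Fin 12)) : Finset (QuaternaryWord 12) :=
  (((codewords C).filter fun c => weightOn T c = 2) ×ˢ codewords (shorten C Tᶜ)).image
    fun p => p.1 + p.2

/-- Averaging the indicator `(1 + signOn T c) (1 + signOn Tᶜ c) / 4` gives `(4096 + 3 * 256) / 4`.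
-/
theorem IsFullCode.card_evenBlockWords (h : IsFullCode C) (hT : T.card = 6)
    (hs : size (shorten C T) = 4) (hs' : size (shorten C Tᶜ) = 4) (hF : signSum C = 256) :
    (evenBlockWords C T).card = 1216 := by
  have h1 := (h.zeroCount_eq hT hs).2
  have h2 := (h.zeroCount_eq (T := Tᶜ) (by rw [card_compl, hT]; rfl) hs').2
  have h3 : ∑ c ∈ codewords C, (1 + signOn T c + signOn Tᶜ c + sgn c) =
      ∑ c ∈ codewords C, 4 * (if signOn T c = 1 ∧ signOn Tᶜ c = 1 then 1 else 0) := by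
    refine Finset.sum_congr rfl fun c _ => ?_
    rw [← signOn_mul_compl T c]
    rcases signOn_eq_or T c with h4 | h4 <;> rcases signOn_eq_or Tᶜ c with h5 | h5 <;>
      rw [h4, h5] <;> norm_num
  rw [← Finset.mul_sum, Finset.sum_boole, Finset.sum_add_distrib, Finset.sum_add_distrib,
    Finset.sum_add_distrib, h1, h2, ← signSum, hF] at h3
  have h4 : (∑ c ∈ codewords C, (1 : ℤ)) = 4096 := by
    rw [Finset.sum_const, ← size, h.size_eq]; norm_num
  rw [h4] at h3
  have h5 : (evenBlockWords C T).card =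
      ((codewords C).filter fun c => signOn T c = 1 ∧ signOn Tᶜ c = 1).card := rfl
  omega

/-- There are `180 * 4` pairs. They give distinct sums, since the difference of two words of
`T`-weight 2 that agree outside `T` has weight at most 4, hence is zero. -/
theorem IsFullCode.card_shiftedWords (h : IsFullCode C) (hT : T.card = 6)
    (hs : size (shorten C T) = 4) (hs' : size (shorten C Tᶜ) = 4) :
    (shiftedWords C T).card = 720 := by
  rw [shiftedWords, Finset.card_image_of_injOn, Finset.card_product, ← size, hs']
  · have h1 := (h.zeroCount_eq hT hs).1
    have h2 : ((codewords C).filter fun c => weightOn T c = 2) =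
        (codewords C).filter fun c => T.card - weightOn T c = 4 := by
      refine Finset.filter_congr fun c _ => ?_
      have hle : weightOn T c ≤ 6 := hT ▸ Finset.card_filter_le _ _
      omega
    rw [h2, ← zeroCount, h1]
  · rintro ⟨c, r⟩ hc ⟨d, s⟩ hd hcd
    simp only [coe_product, Set.mem_prod, mem_coe, mem_filter, mem_codewords] at hc hd hcd
    have h1 : c - d = s - r := by rw [sub_eq_sub_iff_add_eq_add, hcd, add_comm]
    have h2 : c - d = 0 := by
      by_contra h0
      have h3 := h.six_le _ (C.sub_mem hc.1.1 hd.1.1) h0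
      rw [← weightOn_add_compl T] at h3
      have h4 : weightOn Tᶜ (c - d) = 0 := by
        rw [h1, weightOn, Finset.card_eq_zero, Finset.filter_eq_empty_iff]
        intro i hi
        simp [hc.2.2 i hi, hd.2.2 i hi]
      have h5 := weightOn_add_le T c (-d)
      rw [← sub_eq_add_neg, weightOn_neg] at h5
      omega
    rw [h2] at h1
    exact Prod.ext (sub_eq_zero.mp h2) (sub_eq_zero.mp h1.symm).symm

/-- Four words over `F₂²` forming a group with pairwise distinct entries in a coordinate
take each value once there. -/
theorem card_filter_add_eq_zero {D : Submodule (ZMod 2) (QuaternaryWord 12)} (hs : size D = 4)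
    {i : Fin 12} (hi : ∀ r ∈ D, r i = 0 → r = 0) (a : ZMod 2 × ZMod 2) :
    ((codewords D).filter fun r => a + r i = 0).card = 1 := by
  have h1 : (codewords D).image (fun r => r i) = univ := by
    apply Finset.eq_univ_of_card
    rw [Finset.card_image_of_injOn, ← size, hs]
    · rfl
    · intro r hr s hs hrs
      simp only [mem_coe, mem_codewords] at hr hs
      exact sub_eq_zero.mp (hi _ (D.sub_mem hr hs) (by simpa [sub_eq_zero] using hrs))
  have h2 : -a ∈ (codewords D).image (fun r => r i) := h1 ▸ mem_univ _
  obtain ⟨r, hr, hra⟩ := Finset.mem_image.mp h2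
  rw [Finset.card_eq_one]
  refine ⟨r, ?_⟩
  ext s
  simp only [mem_filter, mem_codewords, mem_singleton] at hr ⊢
  constructor
  · rintro ⟨hs, hsa⟩
    refine sub_eq_zero.mp (hi _ (D.sub_mem hs hr) ?_)
    rw [Pi.sub_apply, hra, sub_neg_eq_add, add_comm, hsa]
  · rintro rfl
    exact ⟨hr, by rw [hra, add_neg_cancel]⟩

/-- Adding radical words keeps the total parity, so the point is that a word `c` of weight 2 on `T`
is even on `Tᶜ`. Its four translates by the words of `C` vanishing on `T` have the same parity on
`Tᶜ`, and weight at least 4 there. -/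
theorem IsFullCode.shiftedWords_subset (h : IsFullCode C) (hT : T.card = 6)
    (hs : size (shorten C T) = 4) (hF : signSum C ≠ 0)
    (hR : shorten C T ≤ rad C) (hR' : shorten C Tᶜ ≤ rad C) :
    shiftedWords C T ⊆ evenBlockWords C T := by
  have hRe := isEven_rad_of_signSum_ne_zero hF
  have hadd : ∀ c ∈ C, ∀ r ∈ rad C, sgn (c + r) = sgn c := by
    intro c hc r hr
    rw [sgn_add, hRe r hr, hr.1 c hc, mul_one, mul_one]
  have hTc : (Tᶜ).card = 6 := by rw [card_compl, hT]; rfl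
  have hzero : ∀ i ∈ Tᶜ, ∀ r ∈ shorten C T, r i = 0 → r = 0 := by
    intro i hi r hr hri
    have h1 : IsShort (insert i T) (shorten (shorten C T) {i}) :=
      (h.isShort T).shorten_singleton i
    refine h1.eq_zero_of_card (c := r) ⟨hr, by simpa using hri⟩ ?_
    rw [Finset.card_insert_of_notMem (by simpa using hi)]; omega
  have hbase : ∀ c ∈ C, weightOn T c = 2 → signOn T c = 1 ∧ signOn Tᶜ c = 1 := by
    intro c hc hc2
    have h1 : signOn T c = 1 := by rw [signOn_eq_pow, hc2]; rfl
    refine ⟨h1, ?_⟩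
    have hw : ∀ r ∈ codewords (shorten C T), weightOn Tᶜ (c + r) ≤ 6 ∧
        4 ≤ weightOn Tᶜ (c + r) ∧ signOn Tᶜ (c + r) = signOn Tᶜ c := by
      intro r hr
      rw [mem_codewords] at hr
      have h2 : ∀ i ∈ T, (c + r) i = c i := fun i hi => by simp [hr.2 i hi]
      have h3 : weightOn T (c + r) = 2 := by rw [weightOn_congr h2, hc2]
      have h4 : signOn T (c + r) = 1 := by rw [signOn_eq_pow, h3]; rfl
      have h5 := signOn_mul_compl T (c + r)
      rw [hadd c hc r (hR hr), ← signOn_mul_compl T c, h1, h4, one_mul, one_mul] at h5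
      refine ⟨hTc ▸ Finset.card_filter_le _ _, ?_, h5⟩
      have h6 : c + r ≠ 0 := by
        intro h0
        rw [h0] at h3
        simp [weightOn] at h3
      have h7 := h.six_le _ (C.add_mem hc hr.1) h6
      rw [← weightOn_add_compl T] at h7
      omega
    -- At each of the six coordinates of `Tᶜ` the four translates take every symbol once, so
    -- together they have six zeros there.
    have hz : ∑ r ∈ codewords (shorten C T), (6 - weightOn Tᶜ (c + r)) = 6 := by
      have h2 : ∀ r ∈ codewords (shorten C T), 6 - weightOn Tᶜ (c + r) =
          ∑ i ∈ Tᶜ, if c i + r i = 0 then 1 else 0 := by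
        intro r _
        have h3 := Finset.card_filter_add_card_filter_not (s := Tᶜ) (fun i => (c + r) i = 0)
        rw [Finset.sum_boole, Nat.cast_id]
        rw [hTc] at h3
        change _ + weightOn Tᶜ (c + r) = 6 at h3
        simp only [Pi.add_apply] at h3
        omega
      rw [Finset.sum_congr rfl h2, Finset.sum_comm]
      rw [Finset.sum_congr rfl (g := fun _ => 1)]
      · simp [hTc]
      · intro i hi
        rw [Finset.sum_boole, Nat.cast_id]
        exact card_filter_add_eq_zero hs (hzero i hi) (c i)
    by_contra hodd
    have hodd := (signOn_eq_or Tᶜ c).resolve_left hodd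
    -- If the parity were odd, all four weights would be 5, with four zeros in total instead of six.
    have h3 : ∀ r ∈ codewords (shorten C T), 6 - weightOn Tᶜ (c + r) = 1 := by
      intro r hr
      obtain ⟨h4, h5, h6⟩ := hw r hr
      rw [hodd, signOn_eq_pow] at h6
      generalize weightOn Tᶜ (c + r) = w at *
      interval_cases w <;> first | rfl | norm_num at h6
    rw [Finset.sum_congr rfl h3, Finset.sum_const, ← size, hs] at hz
    norm_num at hz
  intro w hw
  simp only [shiftedWords, mem_image, mem_product, mem_filter, mem_codewords] at hw
  obtain ⟨⟨c, r⟩, ⟨⟨hc, hc2⟩, hr⟩, rfl⟩ := hw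
  simp only at hc hc2 hr ⊢
  obtain ⟨h1, h2⟩ := hbase c hc hc2
  have h3 : signOn Tᶜ (c + r) = 1 := by
    rw [signOn_eq_pow, weightOn_congr (d := c) (fun i hi => by simp [hr.2 i hi]),
      ← signOn_eq_pow, h2]
  simp only [evenBlockWords, mem_filter, mem_codewords]
  refine ⟨C.add_mem hc hr.1, ?_, h3⟩
  have h4 := signOn_mul_compl T (c + r)
  rwa [hadd c hc r (hR' hr), ← signOn_mul_compl T c, h1, h2, h3, mul_one, mul_one] at h4

/-- A common element would yield a codeword of weight 2 on `T` and 2 on `Tᶜ`, of total weight 4. -/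
theorem IsFullCode.disjoint_shiftedWords (h : IsFullCode C) :
    Disjoint (shiftedWords C T) (shiftedWords C Tᶜ) := by
  rw [Finset.disjoint_left]
  intro w hw hw'
  simp only [shiftedWords, mem_image, mem_product, mem_filter, mem_codewords, compl_compl] at hw hw'
  obtain ⟨⟨c, r⟩, ⟨⟨hc, hc2⟩, hr⟩, rfl⟩ := hw
  obtain ⟨⟨d, s⟩, ⟨⟨hd, hd2⟩, hs⟩, hds⟩ := hw'
  simp only at hc hc2 hr hd hd2 hs hds
  have h1 : weightOn T (c - s) = 2 :=
    (weightOn_congr fun i hi => by simp [hs.2 i hi]).trans hc2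
  have h2 : weightOn Tᶜ (c - s) = 2 := by
    refine (weightOn_congr fun i hi => ?_).trans hd2
    have h3 : c - s = d - r := by rw [sub_eq_sub_iff_add_eq_add, hds, add_comm]
    rw [h3]
    simp [hr.2 i hi]
  have h3 : c - s ≠ 0 := by
    intro h0; rw [h0] at h1; simp [weightOn] at h1
  have h4 := h.six_le _ (C.sub_mem hc hs.1) h3
  rw [← weightOn_add_compl T] at h4
  omega

/-- A code of level `4` has no two complementary blocks of radical words. -/
theorem IsFullCode.no_radical_blocks (h : IsFullCode C) (hT : T.card = 6)
    (hs : size (shorten C T) = 4) (hs' : size (shorten C Tᶜ) = 4) (hF : signSum C = 256)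
    (hR : shorten C T ≤ rad C) (hR' : shorten C Tᶜ ≤ rad C) : False := by
  have hTc : (Tᶜ).card = 6 := by rw [card_compl, hT]; rfl
  have h1 := h.shiftedWords_subset hT hs (by rw [hF]; norm_num) hR hR'
  have h2 := h.shiftedWords_subset (T := Tᶜ) hTc hs' (by rw [hF]; norm_num) hR'
    (by rwa [compl_compl])
  have h3 : evenBlockWords C Tᶜ = evenBlockWords C T := by
    simp only [evenBlockWords, compl_compl, and_comm]
  rw [h3] at h2
  -- Two disjoint sets of 720 words do not fit into 1216.
  have h4 := Finset.card_le_card (Finset.union_subset h1 h2)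
  rw [Finset.card_union_of_disjoint h.disjoint_shiftedWords, h.card_shiftedWords hT hs hs',
    h.card_shiftedWords hTc hs' (by rwa [compl_compl]),
    h.card_evenBlockWords hT hs hs' hF] at h4
  omega

end Blocks

/-! ### The level of the whole code. -/

section TopLevel

variable {C : Submodule (ZMod 2) (QuaternaryWord 12)}

theorem mem_compl_singleton_iff {i j : Fin 12} : j ∈ ({i} : Finset (Fin 12))ᶜ ↔ j ≠ i := by simp

theorem IsFullCode.level_singleton (h : IsFullCode C) (i : Fin 12) :
    HasLevel (shorten C {i}) 5 (level C {i}) ∧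
      (level C {i} = 32 ∨ level C {i} = 8 ∨ level C {i} = 2 ∨ level C {i} = -1) :=
  ⟨(h.distribution_five (card_singleton i)).1, h.level_five (card_singleton i)⟩

theorem pair_comm_insert (i j : Fin 12) :
    (insert i {j} : Finset (Fin 12)) = insert j {i} := Finset.pair_comm i j

/-- The coordinates `j` for which `{i, j}` has level `4`, together with `i`. -/
noncomputable def block (C : Submodule (ZMod 2) (QuaternaryWord 12)) (i : Fin 12) :
    Finset (Fin 12) :=
  insert i (({i} : Finset (Fin 12))ᶜ.filter fun j => level C (insert j {i}) = 4)

theorem mem_block_self (i : Fin 12) : i ∈ block C i := Finset.mem_insert_self _ _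

theorem IsFullCode.card_block (h : IsFullCode C) {i : Fin 12} (hi : level C {i} = 2) :
    (block C i).card = 6 := by
  rw [block, Finset.card_insert_of_notMem (by simp),
    (h.level_four_of_level_five_eq_two (card_singleton i) hi).2.1]

theorem IsFullCode.level_of_mem_block (h : IsFullCode C) {i j : Fin 12} (hi : level C {i} = 2)
    (hj : j ∈ block C i) : level C {j} ≠ -1 := by
  rcases Finset.mem_insert.mp hj with rfl | hj
  · omega
  · obtain ⟨hji, h4⟩ := Finset.mem_filter.mp hj
    intro h1
    rw [mem_compl_singleton_iff] at hji
    have h2 := (h.distribution_four (U := insert j {i})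
      (by rw [Finset.card_pair hji])).1
    have h3 := (HasLevel.abs_le (E := shorten C {j})
      (by rw [pair_comm_insert]; exact shorten_insert_le i)
      (h.level_singleton j).1 h2 (by omega) (by omega)).1
    rw [h1, h4] at h3
    norm_num at h3

/-- The radical vanishes at each coordinate where the level doubles. It has `2² = 4` words, already
the maximum for a code vanishing at six coordinates. -/
theorem IsFullCode.rad_eq_shorten_block (h : IsFullCode C) {i : Fin 12} (hi : level C {i} = 2) :
    rad (shorten C {i}) = shorten C (block C i) ∧ size (shorten C (block C i)) = 4 := by
  have h1 := (h.level_singleton i).1.sq_eq (by omega)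
  have hle : rad (shorten C {i}) ≤ shorten C (block C i) := by
    intro r hr
    refine ⟨(rad_le hr).1, fun j hj => ?_⟩
    rcases Finset.mem_insert.mp hj with rfl | hj
    · exact (rad_le hr).2 j (mem_singleton_self j)
    · obtain ⟨hji, h4⟩ := Finset.mem_filter.mp hj
      exact ((h.level_four_of_level_five_eq_two (card_singleton i) hi).2.2 j hji h4 hr).2 j
        (mem_insert_self j _)
  have h4 := (h.isShort (block C i)).size_le_four (h.card_block hi)
  rw [hi] at h1
  have h5 : size (rad (shorten C {i})) = 4 := by
    have : ((size (rad (shorten C {i})) : ℕ) : ℤ) = 4 := by rw [← h1]; norm_num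
    exact_mod_cast this
  have h6 := eq_of_le_of_size_le hle (by omega)
  exact ⟨h6, h6 ▸ h5⟩

/-- The sum relation gives a set `P` of six coordinates of level 2, and the block of each is `P`.
The four words vanishing on `P` are then orthogonal to the shortenings at two coordinates, which
span `C`; but the radical of `C` has order 1. -/
theorem IsFullCode.level_ne_one (h : IsFullCode C) : level C ∅ ≠ 1 := by
  intro hf
  obtain ⟨hlev, hsum, -⟩ := h.distribution_six
  rw [hf] at hlev hsum
  have hval : ∀ i ∈ (univ : Finset (Fin 12)), level C {i} = -1 ∨ level C {i} = 2 := by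
    intro i _
    have h1 := (HasLevel.abs_le shorten_le hlev (h.level_singleton i).1 (by norm_num)
      (by have := (h.level_singleton i).2; omega)).1
    rcases (h.level_singleton i).2 with h2 | h2 | h2 | h2
    · rw [h2] at h1; norm_num at h1
    · rw [h2] at h1; norm_num at h1
    · exact Or.inr h2
    · exact Or.inl h2
  rw [sum_two_valued _ _ (-1) 2 (by norm_num) hval] at hsum
  set P := (univ : Finset (Fin 12)).filter (fun i => level C {i} = 2)
  have hP : P.card = 6 := by norm_num at hsum; omega
  have hblock : ∀ i ∈ P, block C i = P := by
    intro i hi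
    have hi2 := (Finset.mem_filter.mp hi).2
    refine Finset.eq_of_subset_of_card_le (fun j hj => ?_) (by rw [hP, h.card_block hi2])
    exact Finset.mem_filter.mpr ⟨mem_univ j,
      (hval j (mem_univ j)).resolve_left (h.level_of_mem_block hi2 hj)⟩
  obtain ⟨i, hi, k, hk, hik⟩ := Finset.one_lt_card.mp (show 1 < P.card by omega)
  have hQ : ∀ i ∈ P, shorten C {i} ≤ perp (shorten C P) ∧ size (shorten C P) = 4 := by
    intro i hi
    have h1 := h.rad_eq_shorten_block (Finset.mem_filter.mp hi).2
    rw [hblock i hi] at h1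
    exact ⟨le_perp_comm.mp (h1.1 ▸ rad_le_perp), h1.2⟩
  have hsup := h.shorten_sup_shorten (U := ∅) (m := 4) (by simp) (by norm_num)
    (by simp) (by simp) hik
  simp only [insert_empty_eq, shorten_empty] at hsup
  have h1 : C ≤ perp (shorten C P) := hsup.ge.trans (sup_le (hQ i hi).1 (hQ k hk).1)
  have h2 : shorten C P ≤ rad C := le_inf (le_perp_comm.mp h1) shorten_le
  have h3 := size_le h2
  rw [(hQ i hi).2] at h3
  have h4 := hlev.sq_eq (by norm_num)
  norm_num at h4
  omega

/-- All twelve coordinates have level 2, and their blocks partition the coordinates into two sixes: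
distinct blocks cannot share the words of a radical, which would vanish at more than six
coordinates. This is the situation of `no_radical_blocks`. -/
theorem IsFullCode.level_ne_four (h : IsFullCode C) : level C ∅ ≠ 4 := by
  intro hf
  obtain ⟨hlev, hsum, -⟩ := h.distribution_six
  rw [hf] at hlev hsum
  have hne : ∀ i, level C {i} ≠ 0 := fun i => by have := (h.level_singleton i).2; omega
  have hval : ∀ i ∈ (univ : Finset (Fin 12)), level C {i} = 2 ∨ level C {i} = 8 := by
    intro i _
    have h1 := HasLevel.abs_le shorten_le hlev (h.level_singleton i).1 (by norm_num) (hne i)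
    rcases (h.level_singleton i).2 with h2 | h2 | h2 | h2
    · rw [h2] at h1; norm_num at h1
    · exact Or.inr h2
    · exact Or.inl h2
    · rw [h2] at h1; norm_num at h1
  have h2 : ∀ i, level C {i} = 2 := by
    intro i
    refine (hval i (mem_univ i)).resolve_right fun h8 => ?_
    rw [sum_two_valued _ _ 2 8 (by norm_num) hval] at hsum
    norm_num at hsum
    exact hsum h8
  have hR : ∀ i, shorten C {i} ⊓ rad C = shorten C (block C i) := by
    intro i
    rw [← (h.rad_eq_shorten_block (h2 i)).1]
    exact HasLevel.rad_eq_of_two_mul_le shorten_le hlev (h.level_singleton i).1 (by norm_num)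
      (hne i) (by rw [h2 i]; norm_num)
  have hsz : ∀ i, size (shorten C (block C i)) = 4 := fun i => (h.rad_eq_shorten_block (h2 i)).2
  have hcard : ∀ i, (block C i).card = 6 := fun i => h.card_block (h2 i)
  have hblock : ∀ i, ∀ j ∈ block C i, block C j = block C i := by
    intro i j hj
    have h3 : shorten C (block C i) ≤ shorten C (block C j) := by
      rw [← hR j]
      exact le_inf (shorten_anti (by simpa using hj)) (hR i ▸ inf_le_right)
    by_contra hne
    have h4 : shorten C (block C i) ≤ shorten C (block C i ∪ block C j) := by
      rw [← shorten_inf_shorten]; exact le_inf le_rfl h3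
    have h5 : 6 < (block C i ∪ block C j).card := by
      by_contra! hle
      apply hne
      have h6 : block C i = block C i ∪ block C j :=
        Finset.eq_of_subset_of_card_le subset_union_left (by rw [hcard]; exact hle)
      refine Finset.eq_of_subset_of_card_le (fun x hx => ?_) (by rw [hcard, hcard])
      rw [h6]; exact mem_union_right _ hx
    have h6 := size_le h4
    rw [hsz, (h.isShort _).size_eq_one h5] at h6
    omega
  set T := block C 0 with hT
  obtain ⟨i, hi⟩ : (Tᶜ).Nonempty := by
    rw [← Finset.card_pos, card_compl, hcard]; norm_num
  have hTc : block C i = Tᶜ := by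
    refine Finset.eq_of_subset_of_card_le (fun j hj => ?_) (by rw [card_compl, hcard, hcard]; rfl)
    rw [mem_compl]
    intro hj'
    have h3 := (hblock i j hj).symm.trans (hblock 0 j hj')
    rw [mem_compl, hT, ← h3] at hi
    exact hi (mem_block_self i)
  refine h.no_radical_blocks (T := T) (hcard 0) (hsz 0) (hTc ▸ hsz i)
    (by rw [hlev.signSum_eq]; norm_num) (hR 0 ▸ inf_le_right) ?_
  rw [← hTc, ← hR i]
  exact inf_le_right

/-- All coordinates have level 8, and each has a unique partner with pair level 16. The six pairs
give even subcodes of size 256 that pairwise span `C`, against `card_even_cover`: 9728 exceeds 5120.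
-/
theorem IsFullCode.level_ne_sixteen (h : IsFullCode C) : level C ∅ ≠ 16 := by
  intro hf
  obtain ⟨hlev, hsum, -⟩ := h.distribution_six
  rw [hf] at hlev hsum
  have hval : ∀ i ∈ (univ : Finset (Fin 12)), level C {i} = 8 ∨ level C {i} = 32 := by
    intro i _
    have h1 := HasLevel.abs_le shorten_le hlev (h.level_singleton i).1 (by norm_num)
      (by have := (h.level_singleton i).2; omega)
    rcases (h.level_singleton i).2 with h2 | h2 | h2 | h2
    · exact Or.inr h2
    · exact Or.inl h2
    · rw [h2] at h1; norm_num at h1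
    · rw [h2] at h1; norm_num at h1
  have h8 : ∀ i, level C {i} = 8 := by
    intro i
    refine (hval i (mem_univ i)).resolve_right fun h8 => ?_
    rw [sum_two_valued _ _ 8 32 (by norm_num) hval] at hsum
    norm_num at hsum
    exact hsum h8
  have hex : ∀ i, ∃ j, (({i} : Finset (Fin 12))ᶜ.filter
      fun j => level C (insert j {i}) = 16) = {j} := fun i =>
    Finset.card_eq_one.mp (h.level_four_of_level_five_eq_eight (card_singleton i) (h8 i))
  choose p hp using hex
  have hmem : ∀ i j, j = p i ↔ j ≠ i ∧ level C (insert j {i}) = 16 := by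
    intro i j
    rw [← mem_singleton, ← hp i, mem_filter, mem_compl_singleton_iff]
  have hpi : ∀ i, p i ≠ i ∧ level C (insert (p i) {i}) = 16 := fun i => (hmem i (p i)).mp rfl
  have hinv : ∀ i, p (p i) = i := by
    intro i
    refine ((hmem (p i) i).mpr ⟨(hpi i).1.symm, ?_⟩).symm
    rw [pair_comm_insert]; exact (hpi i).2
  set S := (univ : Finset (Fin 12)).filter (fun i => i < p i) with hS
  have hScard : S.card = 6 := by
    have h1 := Finset.card_filter_add_card_filter_not (s := (univ : Finset (Fin 12)))
      (fun i => i < p i)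
    have h2 : S.card = ((univ : Finset (Fin 12)).filter (fun i => ¬ i < p i)).card := by
      refine Finset.card_bij' (fun i _ => p i) (fun i _ => p i) ?_ ?_ ?_ ?_
      · intro i hi
        simp only [hS, mem_filter, mem_univ, true_and, not_lt, hinv] at hi ⊢
        exact hi.le
      · intro i hi
        simp only [hS, mem_filter, mem_univ, true_and, not_lt, hinv] at hi ⊢
        exact lt_of_le_of_ne hi (hpi i).1
      · intro i _; exact hinv i
      · intro i _; exact hinv i
    rw [← h2, ← hS, card_univ, Fintype.card_fin] at h1
    omega
  have hcard2 : ∀ i, (insert (p i) {i} : Finset (Fin 12)).card = 2 := fun i =>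
    Finset.card_pair (hpi i).1
  have hlevp := fun i => (h.distribution_four (hcard2 i)).1
  have hcov := card_even_cover (E := C) S (fun i => shorten C (insert (p i) {i}))
    (by omega) (fun i _ => by
      refine ⟨isEven_of_signSum_eq ?_, shorten_le⟩
      rw [(hlevp i).signSum_eq, (hlevp i).size_eq, (hpi i).2]; norm_num)
    (fun i hi j hj hij => by
      have hi' := (Finset.mem_filter.mp hi).2
      have hj' := (Finset.mem_filter.mp hj).2
      have hdisj : Disjoint (insert (p i) {i} : Finset (Fin 12)) (insert (p j) {j}) := by
        rw [Finset.disjoint_left]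
        intro x hx hx'
        simp only [mem_insert, mem_singleton] at hx hx'
        rcases hx with rfl | rfl <;> rcases hx' with hx' | rfl
        · exact hij (by rw [← hinv i, hx', hinv])
        · rw [hinv] at hj'; exact absurd hi' (not_lt.mpr hj'.le)
        · rw [hx', hinv] at hi'; exact absurd hi' (not_lt.mpr hj'.le)
        · exact hij rfl
      refine sup_eq_of_size shorten_le shorten_le ?_
      rw [shorten_inf_shorten, h.size_eq, (hlevp i).size_eq, (hlevp j).size_eq,
        h.size_shorten (m := 2) (by
          rw [Finset.card_union_of_disjoint hdisj, hcard2, hcard2]) (by norm_num)]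
      norm_num)
    (by rw [hlev.signSum_eq]; norm_num)
  rw [hScard, hlev.signSum_eq, hlev.size_eq, ← hlev.sq_eq (by norm_num)] at hcov
  norm_num at hcov

theorem IsFullCode.level_six (h : IsFullCode C) : level C ∅ = 64 ∨ level C ∅ = -2 := by
  obtain ⟨hlev, hsum, -⟩ := h.distribution_six
  have hsub := h.level_singleton
  have hne : ∀ i, level C {i} ≠ 0 := fun i => by have := (hsub i).2; omega
  have h0 : level C ∅ ≠ 0 := by
    intro h0
    rw [h0] at hlev
    obtain ⟨r, hr, hr1, -, hr2⟩ := exists_odd_of_level_eq_zero (C := C) (U := ∅) (m := 6)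
      (by simp) (by rwa [shorten_empty]) (fun i _ => by
        have := hne i
        rw [insert_empty_eq, (hsub i).1.signSum_eq]; positivity)
    rw [sgn_eq_pow, hr2] at hr1
    norm_num at hr1
  have habs : ∀ i, |level C {i}| ≤ 2 * |level C ∅| ∧ |level C ∅| ≤ 2 * |level C {i}| := fun i =>
    HasLevel.abs_le shorten_le hlev (hsub i).1 h0 (hne i)
  have hneg : ∀ i, level C ∅ * level C {i} < 0 → level C {i} = -level C ∅ :=
    fun i hi => (HasLevel.eq_neg shorten_le hlev (hsub i).1 hi).1
  have hlow : (∑ i : Fin 12, (-1 : ℤ)) ≤ ∑ i, level C {i} :=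
    Finset.sum_le_sum fun i _ => by have := (hsub i).2; omega
  rw [hsum] at hlow
  norm_num at hlow
  -- The level of `C` must be twice a constant level below it. The values 32, 8, 2, -1 each force
  -- the lower levels to be equal to the level of `C`, and so fail.
  have hconst : ∀ a : ℤ, (∀ i, level C {i} = a) → 12 * a = 6 * level C ∅ := by
    intro a ha
    rw [← hsum, Finset.sum_congr rfl (fun i _ => ha i)]
    simp
  have h1 := h.level_ne_one
  have h4 := h.level_ne_four
  have h16 := h.level_ne_sixteen
  obtain ⟨b, hb, h2⟩ := hlev.natAbs_eq h0
  have hcases : level C ∅ = 64 ∨ level C ∅ = 32 ∨ level C ∅ = 8 ∨ level C ∅ = 2 ∨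
      level C ∅ = -1 ∨ level C ∅ = -2 := by
    interval_cases b <;> omega
  rcases hcases with hf | hf | hf | hf | hf | hf
  · exact Or.inl hf
  · rw [hf] at habs
    have := hconst 32 fun i => by
      have h5 := (habs i).2
      rcases (hsub i).2 with h6 | h6 | h6 | h6 <;> rw [h6] at h5 ⊢ <;> norm_num at h5
    omega
  · rw [hf] at habs
    have := hconst 8 fun i => by
      have h5 := habs i
      rcases (hsub i).2 with h6 | h6 | h6 | h6 <;> rw [h6] at h5 ⊢ <;> norm_num at h5
    omega
  · rw [hf] at habs hneg
    have := hconst 2 fun i => by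
      have h5 := habs i
      rcases (hsub i).2 with h6 | h6 | h6 | h6
      · rw [h6] at h5; norm_num at h5
      · rw [h6] at h5; norm_num at h5
      · exact h6
      · have := hneg i (by omega); omega
    omega
  · rw [hf] at habs hneg
    have := hconst (-1) fun i => by
      have h5 := habs i
      rcases (hsub i).2 with h6 | h6 | h6 | h6
      · rw [h6] at h5; norm_num at h5
      · rw [h6] at h5; norm_num at h5
      · have := hneg i (by omega); omega
      · exact h6
    omega
  · exact Or.inr hf

theorem weightDistribution_eq {n : ℕ} (C : Submodule (ZMod 2) (QuaternaryWord n)) (i : ℕ) :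
    weightDistribution C i = weightCount C i := by
  rw [weightDistribution, weightCount, ← Set.ncard_coe_finset]
  congr 1
  ext c
  simp

theorem IsAdditiveCode.isFullCode (h : IsAdditiveCode 12 6 6 C) : IsFullCode C := by
  refine ⟨?_, fun c hc h0 => h.minWeight.2 ⟨c, hc, h0, rfl⟩⟩
  have h1 : Module.finrank (ZMod 2) C = 12 := by
    have := h.dim_eq
    norm_num at this
    exact_mod_cast this
  rw [size_eq_two_pow, h1]
  norm_num

theorem IsAdditiveCode.weightDistribution_eq (h : IsAdditiveCode 12 6 6 C) :
    weightDistribution C = linearDistribution ∨ weightDistribution C = quantumDistribution := by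
  have hC := h.isFullCode
  obtain ⟨-, -, h6, h7, h8, h9, h10, h11, h12⟩ := hC.distribution_six
  have hs : IsShort ∅ C := ⟨by simp, hC.six_le⟩
  have hzero : ∀ w, (0 < w ∧ w < 6) ∨ 12 < w → weightCount C w = 0 := fun w hw =>
    hs.weightCount_eq_zero (by simpa using hw)
  have h0 := weightCount_zero (D := C)
  have key : ∀ f : ℕ → ℕ, f 0 = 1 → (∀ w, (0 < w ∧ w < 6) ∨ 12 < w → f w = 0) →
      weightCount C 6 = f 6 → weightCount C 7 = f 7 → weightCount C 8 = f 8 →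
      weightCount C 9 = f 9 → weightCount C 10 = f 10 → weightCount C 11 = f 11 →
      weightCount C 12 = f 12 → weightDistribution C = f := by
    intro f f0 fz f6 f7 f8 f9 f10 f11 f12
    funext w
    rw [_root_.weightDistribution_eq]
    by_cases hw : (0 < w ∧ w < 6) ∨ 12 < w
    · rw [hzero w hw, fz w hw]
    · have : w = 0 ∨ w = 6 ∨ w = 7 ∨ w = 8 ∨ w = 9 ∨ w = 10 ∨ w = 11 ∨ w = 12 := by omega
      rcases this with rfl | rfl | rfl | rfl | rfl | rfl | rfl | rfl
      · rw [h0, f0]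
      all_goals assumption
  rcases hC.level_six with hf | hf <;> rw [hf] at h6 h7 h8 h9 h10 h11 h12
  · right
    refine key _ rfl (fun w hw => ?_) ?_ ?_ ?_ ?_ ?_ ?_ ?_
    · unfold quantumDistribution; split <;> omega
    all_goals simp only [quantumDistribution]; omega
  · left
    refine key _ rfl (fun w hw => ?_) ?_ ?_ ?_ ?_ ?_ ?_ ?_
    · unfold linearDistribution; split <;> omega
    all_goals simp only [linearDistribution]; omega

end TopLevel

/-! ### The two examples, verified by computation. -/

/-- The word whose `i`th symbol is formed by the bits `i` and `i + 12` of `x`. -/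
def wordOfNat (x : ℕ) : QuaternaryWord 12 := fun i =>
  (if x.testBit i then 1 else 0, if x.testBit (i + 12) then 1 else 0)

/-- The number of the lowest `k` bits of `y` which are set. -/
def bitCount : ℕ → ℕ → ℕ
  | 0, _ => 0
  | k + 1, y => bitCount k y + y / 2 ^ k % 2

/-- All nonempty sums of the words of a list satisfy `p`, and, if `b` holds, so do
all their sums with `a`. -/
def checkSums (p : ℕ → Bool) : List ℕ → Bool → ℕ → Bool
  | [], b, a => !b || p a
  | g :: l, b, a => checkSums p l b a && checkSums p l true (a ^^^ g)

/-- The code spanned by a list of words. -/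
def codeOfList (l : List ℕ) : Submodule (ZMod 2) (QuaternaryWord 12) :=
  Submodule.span (ZMod 2) {c | ∃ g ∈ l, wordOfNat g = c}

section Examples

theorem wordOfNat_xor (x y : ℕ) : wordOfNat (x ^^^ y) = wordOfNat x + wordOfNat y := by
  funext i
  simp only [wordOfNat, Nat.testBit_xor, Pi.add_apply, Prod.mk_add_mk]
  cases x.testBit i <;> cases y.testBit i <;> cases x.testBit (i + 12) <;>
    cases y.testBit (i + 12) <;> decide

theorem bitCount_eq_sum (k y : ℕ) :
    bitCount k y = ∑ i : Fin k, if y.testBit i then 1 else 0 := by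
  induction k with
  | zero => rfl
  | succ k ih =>
    rw [bitCount, ih, Fin.sum_univ_castSucc]
    congr 1
    rw [← Nat.toNat_testBit, Fin.val_last]
    cases y.testBit k <;> rfl

theorem hammingNorm_wordOfNat (x : ℕ) :
    hammingNorm (wordOfNat x) = bitCount 12 (x ||| x >>> 12) := by
  rw [bitCount_eq_sum, hammingNorm, Finset.card_filter]
  refine Finset.sum_congr rfl fun i _ => ?_
  simp only [wordOfNat, Nat.testBit_or, Nat.testBit_shiftRight, add_comm 12]
  by_cases h1 : x.testBit i <;> by_cases h2 : x.testBit (i + 12) <;> simp [h1, h2]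

theorem codeOfList_cons (g : ℕ) (l : List ℕ) :
    codeOfList (g :: l) = Submodule.span (ZMod 2) {wordOfNat g} ⊔ codeOfList l := by
  rw [codeOfList, codeOfList, ← Submodule.span_union]
  congr 1
  ext c
  simp [eq_comm]

theorem codeOfList_nil : codeOfList [] = ⊥ := by
  simp [codeOfList]

theorem mem_codeOfList_of_mem {g : ℕ} {l : List ℕ} (h : g ∈ l) : wordOfNat g ∈ codeOfList l :=
  Submodule.subset_span ⟨g, h, rfl⟩

theorem mem_codeOfList_cons {g : ℕ} {l : List ℕ} {x : QuaternaryWord 12} :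
    x ∈ codeOfList (g :: l) ↔ x ∈ codeOfList l ∨ ∃ y ∈ codeOfList l, wordOfNat g + y = x := by
  rw [codeOfList_cons, Submodule.mem_sup]
  constructor
  · rintro ⟨u, hu, y, hy, rfl⟩
    obtain ⟨r, rfl⟩ := Submodule.mem_span_singleton.mp hu
    rcases (by decide : ∀ r : ZMod 2, r = 0 ∨ r = 1) r with rfl | rfl
    · left; simpa using hy
    · right; exact ⟨y, hy, by simp⟩
  · rintro (h | ⟨y, hy, rfl⟩)
    · exact ⟨0, Submodule.zero_mem _, x, h, by simp⟩
    · exact ⟨_, Submodule.mem_span_singleton_self _, y, hy, rfl⟩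

theorem checkSums_true {p : ℕ → Bool} : ∀ {l : List ℕ} {a : ℕ}, checkSums p l true a = true →
    ∀ x ∈ codeOfList l, ∃ b, wordOfNat b = wordOfNat a + x ∧ p b = true
  | [], a, h, x, hx => by
    rw [codeOfList_nil, Submodule.mem_bot] at hx
    exact ⟨a, by rw [hx, add_zero], by simpa [checkSums] using h⟩
  | g :: l, a, h, x, hx => by
    rw [checkSums, Bool.and_eq_true] at h
    rcases mem_codeOfList_cons.mp hx with hx | ⟨y, hy, rfl⟩
    · exact checkSums_true h.1 x hx
    · obtain ⟨b, hb, hp⟩ := checkSums_true h.2 y hy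
      exact ⟨b, by rw [hb, wordOfNat_xor, add_assoc], hp⟩

/-- Each generator is independent of the later ones: all its sums with their span pass `p`, hence
are nonzero. -/
theorem checkSums_false {p : ℕ → Bool} (hp0 : ∀ b, p b = true → wordOfNat b ≠ 0) :
    ∀ {l : List ℕ}, checkSums p l false 0 = true →
      Module.finrank (ZMod 2) (codeOfList l) = l.length ∧
        ∀ x ∈ codeOfList l, x ≠ 0 → ∃ b, wordOfNat b = x ∧ p b = true
  | [], _ => by
    rw [codeOfList_nil]
    exact ⟨by simp, fun x hx h0 => absurd ((Submodule.mem_bot _).mp hx) h0⟩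
  | g :: l, h => by
    rw [checkSums, Bool.and_eq_true, Nat.zero_xor] at h
    obtain ⟨h1, h2⟩ := checkSums_false hp0 h.1
    have h3 := checkSums_true h.2
    have hg : wordOfNat g ∉ codeOfList l := by
      intro hg
      obtain ⟨b, hb, hpb⟩ := h3 _ hg
      exact hp0 b hpb (by rw [hb, word_add_self])
    have hg0 : wordOfNat g ≠ 0 := fun h0 => hg (h0 ▸ Submodule.zero_mem _)
    constructor
    · have h4 := Submodule.finrank_sup_add_finrank_inf_eq
        (Submodule.span (ZMod 2) {wordOfNat g}) (codeOfList l)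
      have h5 : Submodule.span (ZMod 2) {wordOfNat g} ⊓ codeOfList l = ⊥ := by
        rw [← disjoint_iff, disjoint_comm, Submodule.disjoint_span_singleton' hg0]
        exact hg
      rw [h5, finrank_bot, add_zero, ← codeOfList_cons, finrank_span_singleton hg0, h1] at h4
      rw [h4, List.length_cons, add_comm]
    · intro x hx hx0
      rcases mem_codeOfList_cons.mp hx with hx | ⟨y, hy, rfl⟩
      · exact h2 x hx hx0
      · exact h3 y hy

/-- A list of twelve words all of whose nonempty sums have weight at least `6` spans an additive
`[12, 6, 6]` code. -/
theorem isAdditiveCode_codeOfList {l : List ℕ} (hl : l.length = 12) {p : ℕ → Bool}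
    (hp : ∀ b, p b = true → 6 ≤ bitCount 12 (b ||| b >>> 12))
    (h : checkSums p l false 0 = true) : IsAdditiveCode 12 6 6 (codeOfList l) := by
  obtain ⟨h1, h2⟩ := checkSums_false (p := p) (fun b hb h0 => by
    have h3 := hp b hb
    rw [← hammingNorm_wordOfNat, h0, hammingNorm_zero] at h3
    omega) h
  rw [hl] at h1
  have hC : IsFullCode (codeOfList l) := by
    refine ⟨by rw [size_eq_two_pow, h1]; norm_num, fun c hc h0 => ?_⟩
    obtain ⟨b, rfl, hb⟩ := h2 c hc h0
    rw [hammingNorm_wordOfNat]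
    exact hp b hb
  refine ⟨by norm_num, by rw [h1]; norm_num, ?_, ?_⟩
  -- Weight 6 is attained without a search, since `A₆ = 332 + f` with `f` equal to 64 or -2.
  · have h3 := hC.distribution_six.2.2.1
    have h4 : 0 < weightCount (codeOfList l) 6 := by
      rcases hC.level_six with hf | hf <;> rw [hf] at h3 <;> omega
    obtain ⟨c, hc⟩ := Finset.card_pos.mp h4
    simp only [mem_filter, mem_codewords] at hc
    exact ⟨c, hc.1, fun h0 => by rw [h0, hammingNorm_zero] at hc; omega, hc.2⟩
  · rintro w ⟨c, hc, h0, rfl⟩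
    exact hC.six_le c hc h0

/-- The extended quadratic residue code of length `12` over `F₄`: shifts of a generator polynomial
of the cyclic code of length `11`, with a parity symbol, and their multiples by `ω`. -/
def linearGenerators : List ℕ :=
  [75837, 8581138, 149626, 8773668, 297204, 9158728, 592360, 9928848, 1182672, 11469088, 2363296,
    14549568]

/-- The dodecacode: the cyclic shifts of `ω10100100101`. -/
def quantumGenerators : List ℕ :=
  [6730, 9365, 18730, 33365, 66730, 133460, 262825, 525650, 1051300, 2098505, 4197010, 8389925]

theorem checkSums_linearGenerators :
    checkSums (fun b => decide (6 ≤ bitCount 12 (b ||| b >>> 12))) linearGenerators false 0 =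
      true := by
  decide +kernel

theorem checkSums_quantumGenerators :
    checkSums (fun b => decide (6 ≤ bitCount 12 (b ||| b >>> 12) ∧
      bitCount 12 (b ||| b >>> 12) % 2 = 0)) quantumGenerators false 0 = true := by
  decide +kernel

theorem mulOmega_add (x y : ZMod 2 × ZMod 2) :
    mulOmega (x + y) = mulOmega x + mulOmega y := by
  revert x y; decide

theorem isF4Linear_codeOfList {l : List ℕ}
    (h : ∀ g ∈ l, (fun i => mulOmega (wordOfNat g i)) ∈ codeOfList l) :
    IsF4Linear (codeOfList l) := by
  intro c hc
  refine Submodule.span_induction (p := fun c _ => (fun i => mulOmega (c i)) ∈ codeOfList l)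
    ?_ ?_ ?_ ?_ hc
  · rintro _ ⟨g, hg, rfl⟩
    exact h g hg
  · exact (codeOfList l).zero_mem
  · intro x y _ _ hx hy
    have h1 : (fun i => mulOmega ((x + y) i)) =
        (fun i => mulOmega (x i)) + fun i => mulOmega (y i) := by
      funext i; exact mulOmega_add _ _
    rw [h1]
    exact Submodule.add_mem _ hx hy
  · intro r x _ hx
    rcases (by decide : ∀ r : ZMod 2, r = 0 ∨ r = 1) r with rfl | rfl
    · rw [zero_smul]; exact (codeOfList l).zero_mem
    · simpa using hx

theorem isF4Linear_linearGenerators : IsF4Linear (codeOfList linearGenerators) := by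
  refine isF4Linear_codeOfList fun g hg => ?_
  -- The generators come in pairs `g, ωg`, and `ω (ωg) = g + ωg`.
  have h1 : ∀ g ∈ linearGenerators, ∃ a ∈ linearGenerators,
      (fun i => mulOmega (wordOfNat g i)) = wordOfNat a ∨
      ∃ b ∈ linearGenerators, (fun i => mulOmega (wordOfNat g i)) = wordOfNat (a ^^^ b) := by
    decide +kernel
  obtain ⟨a, ha, h2 | ⟨b, hb, h2⟩⟩ := h1 g hg
  · rw [h2]; exact mem_codeOfList_of_mem ha
  · rw [h2, wordOfNat_xor]
    exact Submodule.add_mem _ (mem_codeOfList_of_mem ha) (mem_codeOfList_of_mem hb)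

/-- A generator of weight 7 rules out the quantum distribution. -/
theorem weightDistribution_linearGenerators :
    IsAdditiveCode 12 6 6 (codeOfList linearGenerators) ∧
      weightDistribution (codeOfList linearGenerators) = linearDistribution := by
  have h := isAdditiveCode_codeOfList (l := linearGenerators) rfl (by simp)
    checkSums_linearGenerators
  refine ⟨h, h.weightDistribution_eq.resolve_right fun hq => ?_⟩
  have h7 := congrFun hq 7
  rw [weightDistribution_eq] at h7
  have h8 : wordOfNat 75837 ∈ (codewords (codeOfList linearGenerators)).filter
      (fun c => hammingNorm c = 7) := by
    rw [mem_filter, mem_codewords, hammingNorm_wordOfNat]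
    exact ⟨mem_codeOfList_of_mem (by decide), by decide⟩
  exact absurd h7 (Finset.card_pos.mpr ⟨_, h8⟩).ne'

/-- The computation also checks that all weights are even, whereas the linear distribution has words
of weight 7. -/
theorem weightDistribution_quantumGenerators :
    IsAdditiveCode 12 6 6 (codeOfList quantumGenerators) ∧
      weightDistribution (codeOfList quantumGenerators) = quantumDistribution := by
  have h := isAdditiveCode_codeOfList (l := quantumGenerators) rfl
    (fun b hb => (of_decide_eq_true hb).1) checkSums_quantumGenerators
  refine ⟨h, h.weightDistribution_eq.resolve_left fun hq => ?_⟩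
  have h7 := congrFun hq 7
  rw [weightDistribution_eq] at h7
  obtain ⟨c, hc⟩ := Finset.card_pos.mp (show 0 < weightCount (codeOfList quantumGenerators) 7 by
    rw [h7]; decide)
  simp only [mem_filter, mem_codewords] at hc
  obtain ⟨b, hb, hp⟩ := (checkSums_false (fun b hb h0 => by
    have h3 := (of_decide_eq_true hb).1
    rw [← hammingNorm_wordOfNat, h0, hammingNorm_zero] at h3
    omega) checkSums_quantumGenerators).2 c hc.1 (by
      rintro rfl; rw [hammingNorm_zero] at hc; omega)
  have h3 := (of_decide_eq_true hp).2
  rw [← hammingNorm_wordOfNat, hb, hc.2] at h3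
  omega

end Examples

theorem theorem2 :
    (∀ C : Submodule (ZMod 2) (QuaternaryWord 12), IsAdditiveCode 12 6 6 C →
      weightDistribution C = linearDistribution ∨
        weightDistribution C = quantumDistribution) ∧
    (∃ C : Submodule (ZMod 2) (QuaternaryWord 12), IsAdditiveCode 12 6 6 C ∧ IsF4Linear C ∧
      weightDistribution C = linearDistribution) ∧
    (∃ C : Submodule (ZMod 2) (QuaternaryWord 12), IsAdditiveCode 12 6 6 C ∧
      weightDistribution C = quantumDistribution) :=
  ⟨fun _ h => h.weightDistribution_eq,
    ⟨_, weightDistribution_linearGenerators.1, isF4Linear_linearGenerators,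
      weightDistribution_linearGenerators.2⟩,
    ⟨_, weightDistribution_quantumGenerators.1, weightDistribution_quantumGenerators.2⟩⟩
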